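/- Let $h:\mathbb S^2\to\mathbb S^2$ be a homeomorphism with finite fixed-point set $\mathrm{Fix}(h)$, and let $U=\mathbb S^2\setminus\mathrm{Fix}(h)$. (No hypothesis on indices is made, and $h$ need not preserve orientation; in particular the statement applies to every orientation-preserving homeomorphism of the sphere with finitely many fixed points.) A triadic graph is a subset $F\subset U$, closed in $U$, such that every $x\in F$ has an open neighbourhood in $\mathbb S^2$ with a homeomorphism onto an open subset of the plane that sends $x$ to $0$ and carries $F$ to the trace of either a straight line through $0$ or the union of three half-lines issuing from $0$ in distinct directions (with angles $2\pi/3$). A brick of $F$ is the closure in $U$ of a connected component of $U\setminus F$. Two distinct bricks are adjacent if they intersect. A set $B$ is free if $B\cap h(B)=\emptyset$. Then $h$ admits a brick decomposition, that is, there is a triadic graph $F\subset U$ which is (i) compact: no fixed point of $h$ lies in the closure in $\mathbb S^2$ of a brick of $F$; (ii) free: every brick of $F$ is free; (iii) minimal: for any two adjacent bricks $B,B'$ of $F$, the union $B\cup B'$ is not free. -/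

import Mathlib

namespace BrickDecomposition

open Set

/-- The two-dimensional sphere. -/
abbrev S2 : Type := Metric.sphere (0 : EuclideanSpace ℝ (Fin 3)) 1

/-- The complement `U` of the fixed-point set of `h` in the sphere. -/
def domain (h : S2 ≃ₜ S2) : Set S2 := (Function.fixedPoints h)ᶜ

/-- First local model: a straight line through the origin of the plane. -/
def lineModel : Set ℂ := {z | z.im = 0}

/-- Second local model: three half-lines in the plane issuing from the origin,
in the directions of the three cube roots of unity. -/
def triodModel : Set ℂ := {z | ∃ r : ℝ, ∃ ζ : ℂ, 0 ≤ r ∧ ζ ^ 3 = 1 ∧ z = r * ζ}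

/-- Near the point `x`, the subset `F` of the sphere looks like the planar drawing `M` near `0`:
some chart of the sphere defined around `x` sends `x` to `0` and carries `F` onto `M`. -/
def LooksLike (F : Set S2) (x : S2) (M : Set ℂ) : Prop :=
  ∃ φ : OpenPartialHomeomorph S2 ℂ, x ∈ φ.source ∧ φ x = 0 ∧ φ.IsImage F M

/-- A triadic graph: a subset of `U`, closed in `U`, which near each of its points
is a line or a triod. -/
structure IsTriadicGraph (h : S2 ≃ₜ S2) (F : Set S2) : Prop where
  subset_domain : F ⊆ domain h
  closed_in_domain : closure F ∩ domain h ⊆ F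
  local_model : ∀ x ∈ F, LooksLike F x lineModel ∨ LooksLike F x triodModel

/-- A brick of `F`: the closure in `U` of a connected component of `U \ F`. -/
def IsBrick (h : S2 ≃ₜ S2) (F B : Set S2) : Prop :=
  ∃ x ∈ domain h \ F, B = closure (connectedComponentIn (domain h \ F) x) ∩ domain h

/-- A set is free if it is disjoint from its image. -/
def IsFree (h : S2 ≃ₜ S2) (B : Set S2) : Prop := Disjoint B (h '' B)

/-- Two distinct bricks that intersect. -/
def AreAdjacent (B B' : Set S2) : Prop := B ≠ B' ∧ (B ∩ B').Nonempty

/-- No fixed point is in the closure (in the sphere) of a brick. -/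
def IsCompactGraph (h : S2 ≃ₜ S2) (F : Set S2) : Prop :=
  ∀ B, IsBrick h F B → Disjoint (closure B) (Function.fixedPoints h)

/-- Every brick is free. -/
def IsFreeGraph (h : S2 ≃ₜ S2) (F : Set S2) : Prop :=
  ∀ B, IsBrick h F B → IsFree h B

/-- The union of two adjacent bricks is never free. -/
def IsMinimalGraph (h : S2 ≃ₜ S2) (F : Set S2) : Prop :=
  ∀ B B', IsBrick h F B → IsBrick h F B' → AreAdjacent B B' → ¬ IsFree h (B ∪ B')

/-- A brick decomposition for `h`: a triadic graph that is compact, free and minimal. -/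
structure IsBrickDecomposition (h : S2 ≃ₜ S2) (F : Set S2) : Prop where
  triadic : IsTriadicGraph h F
  compact : IsCompactGraph h F
  free : IsFreeGraph h F
  minimal : IsMinimalGraph h F

end BrickDecomposition

/-! Away from the fixed points the sphere is covered by finitely many small free discs, so a fine
tiling by free tiles with triadic boundary is easy to produce. Starting from it, one merges tiles as
long as the unions remain connected and free. Zorn's lemma gives a maximal coarsening, and
maximality is exactly minimality of the graph: a free union of two adjacent bricks would be a
strictly coarser admissible partition. The difficulty is compactness: an infinite sequence of
mergers may produce a free brick that accumulates at a fixed point. The tiling near a fixed point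
therefore has to be prepared so that no free connected union of tiles can reach it.

Around each fixed point polar coordinates are used, the level `u` tending to infinity at the point.
Between two consecutive integer levels (counted from `w₀`) there is a finite stack of rows of
bricks, whose bricks are grouped by labels into free connected pieces, and the stack contains a
barrier (`PolarEnd.exists_barrier`). There are two sorts of barrier. Either the labels split into a
lower and an upper family such that two pieces of different families which meet never have a free
union; a free connected union of pieces then cannot cross the stack
(`IsScaffold.not_freeSet_of_split`). Or one piece contains a whole circle around the fixed point; a
free connected set `B` containing such a circle `C` cannot accumulate at the point
(`notMem_closure_of_circle`). Indeed `h(B)` and `h⁻¹(B)` would be connected, disjoint from `C` and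
accumulating at the point, hence inside the disc bounded by `C`; then `h` would send the whole
complement of the disc into the disc, which is excluded when the disc is small.

The barrier is built by a terminating procedure (`PolarEnd.Game.step`). It starts with one row of
small bricks, all of whose labels are called old, and adds thin rows with the invariant that a piece
meeting a piece of the last row either cannot be merged with it or is its neighbour in that row
(`PolarEnd.Stack`). If two neighbours have a free union, they are merged. If not, an old piece is
prolonged over the next brick. When it can cover that brick, the brick disappears from the last row.
When it cannot, there is a first angle at which freeness fails; a new brick placed there is not
mergeable with the old piece, and one further row buries the old piece under the new brick, the
previous piece and possibly a second new brick, none of which can be merged with it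
(`PolarEnd.Game.progress_of_run`). The pair (number of old labels in the last row, number of bricks
of the last row) decreases lexicographically. At the end the last row is a single annular brick, or
it has no old label, and its labels form the upper family of a split.

The rest of the sphere is divided by free round caps in general position: each region is a cap minus
the earlier closed caps, so near a crossing the boundary is a full line with a half-line ending on
it. Such T-shaped junctions are also those of rows with unaligned cuts. In a tiling with only
T-shaped junctions, every coarsening has a boundary that is locally a line or a triod, whatever
classes are identified (`isTriadicGraph_graphOf`), and two tiles that meet also meet along an arc,
which makes the bricks of the graph coincide with the classes (`isBrick_graphOf`). -/

namespace BrickDecomposition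

open Set Topology

/-! ### Free sets and their free neighbourhoods. -/

section FreeSets

variable {S : Type*} [TopologicalSpace S]

/-- A set is free for `h` when no point of it is sent into it. -/
def FreeSet (h : S ≃ₜ S) (A : Set S) : Prop := ∀ x ∈ A, h x ∉ A

variable {h : S ≃ₜ S}

theorem FreeSet.mono {A B : Set S} (hB : FreeSet h B) (hAB : A ⊆ B) : FreeSet h A :=
  fun x hx hx' => hB x (hAB hx) (hAB hx')

theorem not_freeSet {A : Set S} : ¬ FreeSet h A ↔ ∃ x ∈ A, h x ∈ A := by
  simp [FreeSet]

theorem freeSet_empty : FreeSet h ∅ := fun _ hx => hx.elim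

/-- A free compact set has a free open neighbourhood. -/
theorem FreeSet.exists_isOpen [T2Space S] {K : Set S} (hK : IsCompact K) (hf : FreeSet h K) :
    ∃ V, IsOpen V ∧ K ⊆ V ∧ FreeSet h V := by
  have hd : Disjoint K (h '' K) := by
    rw [Set.disjoint_left]
    rintro _ hx ⟨y, hy, rfl⟩
    exact hf y hy hx
  obtain ⟨A, B, hA, hB, hKA, hKB, hAB⟩ :=
    SeparatedNhds.of_isCompact_isCompact hK (hK.image h.continuous) hd
  refine ⟨A ∩ h ⁻¹' B, hA.inter (hB.preimage h.continuous),
    fun x hx => ⟨hKA hx, hKB ⟨x, hx, rfl⟩⟩, ?_⟩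
  rintro x ⟨_, hx⟩ ⟨hx', _⟩
  exact Set.disjoint_left.1 hAB hx' hx

end FreeSets

/-! ### Ends in polar coordinates and periodic rows of bricks. -/

/-- Polar coordinates `(u, θ)` on a neighbourhood of an end, `θ` being taken modulo `1`,
together with the absence of fixed points above the level `w₀`. -/
structure PolarEnd {S : Type*} [TopologicalSpace S] (h : S ≃ₜ S) (w₀ : ℝ) where
  Φ : ℝ × ℝ → S
  continuous : Continuous Φ
  isOpenMap : IsOpenMap Φ
  per : ∀ u θ, Φ (u, θ + 1) = Φ (u, θ)
  inj : ∀ u θ u' θ', Φ (u, θ) = Φ (u', θ') → u = u' ∧ ∃ k : ℤ, θ' = θ + k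
  nofix : ∀ u θ, w₀ ≤ u → h (Φ (u, θ)) ≠ Φ (u, θ)

/-- A row of bricks between the levels `bot` and `top`: its cuts and its labels, indexed
by the integers, periodic with period `m`. -/
structure Row where
  bot : ℝ
  top : ℝ
  m : ℕ
  a : ℤ → ℝ
  lab : ℤ → ℕ
  bot_lt : bot < top
  m_pos : 0 < m
  a_mono : StrictMono a
  a_add : ∀ i, a (i + m) = a i + 1
  lab_add : ∀ i, lab (i + m) = lab i

/-- The map sending `d` to `n` and fixing every other integer. -/
def relabel (d n l : ℕ) : ℕ := if l = d then n else l

namespace Row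

theorem a_add_mul (r : Row) (i k : ℤ) : r.a (i + k * r.m) = r.a i + k := by
  induction k using Int.induction_on with
  | zero => simp
  | succ k ih =>
    have := r.a_add (i + k * r.m)
    rw [show i + ((k : ℤ) + 1) * r.m = i + k * r.m + r.m by ring, this, ih]; push_cast; ring
  | pred k ih =>
    have := r.a_add (i + (-(k : ℤ) - 1) * r.m)
    rw [show i + (-(k : ℤ) - 1) * r.m + r.m = i + -(k : ℤ) * r.m by ring, ih] at this
    push_cast at this ⊢; linarith

theorem lab_add_mul (r : Row) (i k : ℤ) : r.lab (i + k * r.m) = r.lab i := by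
  induction k using Int.induction_on with
  | zero => simp
  | succ k ih =>
    rw [show i + ((k : ℤ) + 1) * r.m = i + k * r.m + r.m by ring, r.lab_add, ih]
  | pred k ih =>
    have := r.lab_add (i + (-(k : ℤ) - 1) * r.m)
    rw [← this, show i + (-(k : ℤ) - 1) * r.m + r.m = i + -(k : ℤ) * r.m by ring, ih]

theorem a_lt (r : Row) (i : ℤ) : r.a i < r.a (i + 1) := r.a_mono (by omega)

/-- `r'` is placed on top of `r`, no cut of `r'` being aligned with a cut of `r`. -/
def Over (r r' : Row) : Prop :=
  r'.bot = r.top ∧ ∀ i, ∃ k, r.a k < r'.a i ∧ r'.a i < r.a (k + 1)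

/-- The `i`-th brick of `r'`, placed on `r`, touches a brick of `r` labelled `l`. -/
def Touch (r r' : Row) (i : ℤ) (l : ℕ) : Prop :=
  ∃ k, r.lab k = l ∧ ∃ θ ∈ Icc (r'.a i) (r'.a (i + 1)), θ ∈ Icc (r.a k) (r.a (k + 1))

/-- The labels `l` and `l'` are carried by consecutive bricks. -/
def NextTo (r : Row) (l l' : ℕ) : Prop :=
  ∃ k, (r.lab k = l ∧ r.lab (k + 1) = l') ∨ (r.lab k = l' ∧ r.lab (k + 1) = l)

theorem NextTo.symm {r : Row} {l l' : ℕ} (H : r.NextTo l l') : r.NextTo l' l :=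
  H.imp fun _ hk => hk.symm

/-- Distinct bricks have distinct labels. -/
def Inj (r : Row) : Prop := ∀ i j, r.lab i = r.lab j → (r.m : ℤ) ∣ j - i

/-- Renumbering of the bricks of a row. -/
def shift (r : Row) (s : ℤ) : Row where
  bot := r.bot
  top := r.top
  m := r.m
  a i := r.a (i + s)
  lab i := r.lab (i + s)
  bot_lt := r.bot_lt
  m_pos := r.m_pos
  a_mono i j hij := r.a_mono (by omega)
  a_add i := by rw [show i + (r.m : ℤ) + s = i + s + r.m by ring, r.a_add]
  lab_add i := by rw [show i + (r.m : ℤ) + s = i + s + r.m by ring, r.lab_add]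

/-- Change of labels. -/
def map (r : Row) (f : ℕ → ℕ) : Row where
  bot := r.bot
  top := r.top
  m := r.m
  a := r.a
  lab i := f (r.lab i)
  bot_lt := r.bot_lt
  m_pos := r.m_pos
  a_mono := r.a_mono
  a_add := r.a_add
  lab_add i := by rw [r.lab_add]

theorem cells_inter {r : Row} {p q : ℤ} {θ : ℝ} (hp : θ ∈ Icc (r.a p) (r.a (p + 1)))
    (hq : θ ∈ Icc (r.a q) (r.a (q + 1))) : q = p ∨ q = p + 1 ∨ p = q + 1 := by
  have h1 : p ≤ q + 1 := r.a_mono.le_iff_le.1 (hp.1.trans hq.2)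
  have h2 : q ≤ p + 1 := r.a_mono.le_iff_le.1 (hq.1.trans hp.2)
  omega

end Row

/-! ### Boxes, bricks, and the invariant of a stack of labelled rows. -/

section Polar

variable {S : Type*} [TopologicalSpace S] {h : S ≃ₜ S} {w₀ : ℝ}

namespace PolarEnd

variable (E : PolarEnd h w₀)

theorem per_int (u θ : ℝ) (k : ℤ) : E.Φ (u, θ + k) = E.Φ (u, θ) := by
  induction k using Int.induction_on with
  | zero => simp
  | succ k ih => push_cast at ih ⊢; rw [← add_assoc, E.per, ih]
  | pred k ih =>
    push_cast at ih ⊢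
    rw [← ih, ← E.per, show θ + (-(k : ℝ) - 1) + 1 = θ + -k by ring]

/-- The closed box `[u, v] × [a, b]`. -/
def box (u v a b : ℝ) : Set S := E.Φ '' (Icc u v ×ˢ Icc a b)

theorem isCompact_box (u v a b : ℝ) : IsCompact (E.box u v a b) :=
  (isCompact_Icc.prod isCompact_Icc).image E.continuous

theorem isPreconnected_box (u v a b : ℝ) : IsPreconnected (E.box u v a b) :=
  (isPreconnected_Icc.prod isPreconnected_Icc).image _ E.continuous.continuousOn

theorem box_mono {u v a b u' v' a' b' : ℝ} (h1 : u' ≤ u) (h2 : v ≤ v') (h3 : a' ≤ a)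
    (h4 : b ≤ b') : E.box u v a b ⊆ E.box u' v' a' b' :=
  image_mono (prod_mono (Icc_subset_Icc h1 h2) (Icc_subset_Icc h3 h4))

theorem mem_box {u v a b w θ : ℝ} :
    E.Φ (w, θ) ∈ E.box u v a b ↔ w ∈ Icc u v ∧ ∃ k : ℤ, θ + k ∈ Icc a b := by
  constructor
  · rintro ⟨⟨w', θ'⟩, ⟨h1, h2⟩, h3⟩
    obtain ⟨rfl, k, rfl⟩ := E.inj _ _ _ _ h3.symm
    exact ⟨h1, k, h2⟩
  · rintro ⟨h1, k, h2⟩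
    exact ⟨(w, θ + k), ⟨h1, h2⟩, E.per_int _ _ _⟩

theorem mem_box_of {u v a b w θ : ℝ} (hw : w ∈ Icc u v) (hθ : θ ∈ Icc a b) :
    E.Φ (w, θ) ∈ E.box u v a b := ⟨_, ⟨hw, hθ⟩, rfl⟩

theorem box_add_int (u v a b : ℝ) (k : ℤ) : E.box u v (a + k) (b + k) = E.box u v a b := by
  ext x
  constructor
  · rintro ⟨⟨w, θ⟩, ⟨hw, h1, h2⟩, rfl⟩
    exact E.mem_box.2 ⟨hw, -k, by simp only [Int.cast_neg]; constructor <;> simp at * <;> linarith⟩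
  · rintro ⟨⟨w, θ⟩, ⟨hw, h1, h2⟩, rfl⟩
    exact E.mem_box.2 ⟨hw, k, by constructor <;> simp at * <;> linarith⟩

/-- If an open set contains a box, it contains a larger one. -/
theorem eventually_box_subset {V : Set S} (hV : IsOpen V) {u v a b : ℝ} (huv : u ≤ v)
    (hle : a ≤ b) (hsub : E.box u v a b ⊆ V) :
    ∀ᶠ ε in 𝓝[>] (0 : ℝ), E.box (u - ε) (v + ε) (a - ε) (b + ε) ⊆ V := by
  have hK : IsCompact (Icc u v ×ˢ Icc a b : Set (ℝ × ℝ)) := isCompact_Icc.prod isCompact_Icc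
  obtain ⟨δ, hδ, hsub'⟩ := hK.exists_thickening_subset_open (hV.preimage E.continuous)
    (image_subset_iff.1 hsub)
  filter_upwards [Ioo_mem_nhdsGT hδ] with ε hε
  rintro _ ⟨⟨w, θ⟩, ⟨hw, hθ⟩, rfl⟩
  apply hsub'
  rw [Metric.mem_thickening_iff]
  have key : ∀ a b θ : ℝ, a ≤ b → θ ∈ Icc (a - ε) (b + ε) →
      |θ - max a (min b θ)| < δ := by
    intro a b θ hle hθ
    simp only [mem_Icc, mem_Ioo] at hθ hε
    rw [abs_lt]
    rcases le_total θ b with h1 | h1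
    · rw [min_eq_right h1]
      rcases le_total a θ with h2 | h2
      · rw [max_eq_right h2]; constructor <;> linarith
      · rw [max_eq_left h2]; constructor <;> linarith
    · rw [min_eq_left h1, max_eq_right hle]; constructor <;> linarith
  refine ⟨(max u (min v w), max a (min b θ)), ⟨by simp [huv], by simp [hle]⟩, ?_⟩
  rw [Prod.dist_eq, max_lt_iff, Real.dist_eq, Real.dist_eq]
  exact ⟨key _ _ _ huv hw, key _ _ _ hle hθ⟩

/-- The `i`-th brick of a row. -/
def brick (r : Row) (i : ℤ) : Set S := E.box r.bot r.top (r.a i) (r.a (i + 1))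

/-- The union of the bricks of a row carrying the label `l`. -/
def rowPiece (r : Row) (l : ℕ) : Set S := ⋃ i, ⋃ (_ : r.lab i = l), E.brick r i

theorem brick_add_mul (r : Row) (i k : ℤ) : E.brick r (i + k * r.m) = E.brick r i := by
  rw [brick, brick, show i + k * r.m + 1 = i + 1 + k * r.m by ring, r.a_add_mul, r.a_add_mul,
    E.box_add_int]

theorem mem_rowPiece {r : Row} {l : ℕ} {w θ : ℝ} : E.Φ (w, θ) ∈ E.rowPiece r l ↔
    w ∈ Icc r.bot r.top ∧ ∃ i, r.lab i = l ∧ θ ∈ Icc (r.a i) (r.a (i + 1)) := by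
  simp only [rowPiece, mem_iUnion, brick, E.mem_box, exists_prop]
  constructor
  · rintro ⟨i, hi, hw, k, h1, h2⟩
    refine ⟨hw, i + (-k) * r.m, by rw [r.lab_add_mul, hi], ?_⟩
    rw [show i + (-k) * r.m + 1 = i + 1 + (-k) * r.m by ring, r.a_add_mul, r.a_add_mul]
    push_cast
    constructor <;> linarith
  · rintro ⟨hw, i, hi, hθ⟩
    exact ⟨i, hi, hw, 0, by simpa using hθ⟩

theorem rowPiece_eq (r : Row) (hr : r.Inj) (i : ℤ) : E.rowPiece r (r.lab i) = E.brick r i := by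
  apply subset_antisymm
  · refine iUnion_subset fun j => iUnion_subset fun hj => ?_
    obtain ⟨k, hk⟩ := hr i j hj.symm
    rw [show j = i + k * r.m by linarith, E.brick_add_mul]
  · exact subset_iUnion₂_of_subset i rfl subset_rfl

theorem rowPiece_eq_empty {r : Row} {l : ℕ} (hl : l ∉ range r.lab) : E.rowPiece r l = ∅ := by
  simp only [rowPiece, iUnion_eq_empty]
  exact fun i hi => (hl ⟨i, hi⟩).elim

/-- The pieces of a finite stack of rows, seen from its last row `r`. -/
structure Stack (r : Row) (pc : ℕ → Set S) : Prop where
  fin : ∃ b, ∀ l, b ≤ l → pc l = ∅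
  compact : ∀ l, IsCompact (pc l)
  range : ∀ l, pc l ⊆ range E.Φ
  level : ∀ l v θ, E.Φ (v, θ) ∈ pc l → v ≤ r.top
  touch : ∀ l θ, E.Φ (r.top, θ) ∈ pc l → ∃ i, r.lab i = l ∧ θ ∈ Icc (r.a i) (r.a (i + 1))
  arc : ∀ i θ, θ ∈ Icc (r.a i) (r.a (i + 1)) → E.Φ (r.top, θ) ∈ pc (r.lab i)
  free : ∀ l, FreeSet h (pc l)
  conn : ∀ l, IsPreconnected (pc l)
  sep : ∀ l i, l ≠ r.lab i → (pc l ∩ pc (r.lab i)).Nonempty →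
    ¬ FreeSet h (pc l ∪ pc (r.lab i)) ∨ r.NextTo l (r.lab i)

theorem finite_range_lab (r : Row) : (Set.range r.lab).Finite := by
  apply ((Set.finite_Ico (0 : ℤ) r.m).image r.lab).subset
  rintro _ ⟨i, rfl⟩
  have hm : (0 : ℤ) < r.m := by exact_mod_cast r.m_pos
  refine ⟨i % r.m, ⟨Int.emod_nonneg _ hm.ne', Int.emod_lt_of_pos _ hm⟩, ?_⟩
  have := r.lab_add_mul (i % r.m) (i / r.m)
  rw [← this, mul_comm, Int.emod_add_mul_ediv]

/-- Adding a row to a stack. -/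
theorem Stack.push {r r' : Row} {pc : ℕ → Set S} (st : E.Stack r pc) (ho : r.Over r')
    (hinj : r'.Inj) (hfree : ∀ i, FreeSet h (pc (r'.lab i) ∪ E.brick r' i))
    (hconn : ∀ i, pc (r'.lab i) = ∅ ∨ r.Touch r' i (r'.lab i))
    (H1 : ∀ i l, l ≠ r'.lab i → r.Touch r' i l →
      ¬ FreeSet h ((pc l ∪ E.rowPiece r' l) ∪ (pc (r'.lab i) ∪ E.rowPiece r' (r'.lab i))) ∨
        r'.NextTo l (r'.lab i))
    (H2 : ∀ i l, l ≠ r'.lab i → r.NextTo l (r'.lab i) →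
      ¬ FreeSet h ((pc l ∪ E.rowPiece r' l) ∪ (pc (r'.lab i) ∪ E.rowPiece r' (r'.lab i))) ∨
        r'.NextTo l (r'.lab i)) :
    E.Stack r' (fun l => pc l ∪ E.rowPiece r' l) where
  fin := by
    obtain ⟨b, hb⟩ := st.fin
    obtain ⟨b', hb'⟩ := (finite_range_lab r').bddAbove
    refine ⟨max b (b' + 1), fun l hl => ?_⟩
    rw [hb l (le_trans (le_max_left _ _) hl), empty_union]
    apply E.rowPiece_eq_empty
    intro hl'
    have := hb' hl'
    have := le_trans (le_max_right _ _) hl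
    omega
  compact l := by
    apply (st.compact l).union
    by_cases hl : l ∈ Set.range r'.lab
    · obtain ⟨i, rfl⟩ := hl
      rw [E.rowPiece_eq r' hinj]
      exact E.isCompact_box _ _ _ _
    · rw [E.rowPiece_eq_empty hl]; exact isCompact_empty
  range l := by
    apply union_subset (st.range l)
    exact iUnion₂_subset fun i _ => image_subset_range _ _
  level l v θ hv := by
    rcases hv with hv | hv
    · have := st.level l v θ hv
      have := r'.bot_lt; have := ho.1; linarith
    · exact (E.mem_rowPiece.1 hv).1.2
  touch l θ hθ := by
    rcases hθ with hv | hv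
    · have := st.level l _ θ hv
      have := r'.bot_lt; have := ho.1; linarith
    · exact (E.mem_rowPiece.1 hv).2
  arc i θ hθ := Or.inr (E.mem_rowPiece.2 ⟨⟨r'.bot_lt.le, le_rfl⟩, i, rfl, hθ⟩)
  free l := by
    by_cases hl : l ∈ Set.range r'.lab
    · obtain ⟨i, rfl⟩ := hl
      rw [E.rowPiece_eq r' hinj]
      exact hfree i
    · rw [E.rowPiece_eq_empty hl, union_empty]; exact st.free l
  conn l := by
    by_cases hl : l ∈ Set.range r'.lab
    · obtain ⟨i, rfl⟩ := hl
      rw [E.rowPiece_eq r' hinj]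
      rcases hconn i with he | ⟨k, hk, θ, hθ, hθ'⟩
      · rw [he, empty_union]; exact E.isPreconnected_box _ _ _ _
      · refine (st.conn _).union (E.Φ (r.top, θ)) ?_ ?_ (E.isPreconnected_box _ _ _ _)
        · rw [← hk]; exact st.arc k θ hθ'
        · exact E.mem_box_of ⟨ho.1.le, ho.1 ▸ r'.bot_lt.le⟩ hθ
    · rw [E.rowPiece_eq_empty hl, union_empty]; exact st.conn l
  sep l i hl := by
    rintro ⟨x, hx, hx'⟩
    -- An earlier piece lies below the level `r.top` and the new row above it, so contacts occur on
    -- that level only, where the bricks of `r` under the contact are known.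
    have hlev : ∀ l l' x, x ∈ pc l → x ∈ E.rowPiece r' l' →
        ∃ j, r'.lab j = l' ∧ r.Touch r' j l := by
      intro l l' x hx hx'
      obtain ⟨⟨v, θ⟩, rfl⟩ := st.range l hx
      obtain ⟨hv, j, hj, hθ⟩ := E.mem_rowPiece.1 hx'
      obtain rfl : v = r.top := le_antisymm (st.level l v θ hx) (ho.1 ▸ hv.1)
      obtain ⟨k, hk, hk'⟩ := st.touch l θ hx
      exact ⟨j, hj, k, hk, θ, hθ, hk'⟩
    rcases hx with hx | hx <;> rcases hx' with hx' | hx'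
    -- Contact inside the earlier pieces: the label of the new brick was already in the row `r`, so
    -- the previous invariant applies. Being neighbours in `r` no longer counts once `r` is covered;
    -- this is the role of `H2`.
    · rcases hconn i with he | ⟨k, hk, -⟩
      · rw [he] at hx'; exact hx'.elim
      · rw [← hk] at hx' hl
        rcases st.sep l k hl ⟨x, hx, hx'⟩ with h' | h'
        · left
          intro hf
          refine h' (hf.mono ?_)
          rw [hk]
          exact union_subset_union subset_union_left subset_union_left
        · rw [hk] at hl h'
          exact H2 i l hl h'
    · obtain ⟨j, hj, ht⟩ := hlev l _ x hx hx'
      have := H1 j l (hj ▸ hl) ht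
      rwa [hj] at this
    · obtain ⟨j, rfl, ht⟩ := hlev _ l x hx' hx
      have := H1 j _ hl.symm ht
      rw [union_comm] at this
      exact this.imp_right Row.NextTo.symm
    · right
      obtain ⟨⟨v, θ⟩, rfl⟩ := iUnion₂_subset (fun j _ => image_subset_range _ _) hx
      obtain ⟨-, p, hp, hθ⟩ := E.mem_rowPiece.1 hx
      obtain ⟨-, q, hq, hθ'⟩ := E.mem_rowPiece.1 hx'
      rcases Row.cells_inter hθ hθ' with rfl | rfl | rfl
      · exact (hl (hp.symm.trans hq)).elim
      · exact ⟨p, Or.inl ⟨hp, hq⟩⟩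
      · exact ⟨q, Or.inr ⟨hq, hp⟩⟩

/-- Uniform free neighbourhoods of the pieces of a stack. -/
theorem Stack.thin [T2Space S] {r : Row} {pc : ℕ → Set S} (st : E.Stack r pc) :
    ∃ V : ℕ → Set S, (∀ l, FreeSet h (V l) ∧ pc l ⊆ V l) ∧ ∀ᶠ ε in 𝓝[>] (0 : ℝ),
      ∀ i, E.box (r.top - ε) (r.top + ε) (r.a i - ε) (r.a (i + 1) + ε) ⊆ V (r.lab i) := by
  choose V hV hpV hfV using fun l => (st.free l).exists_isOpen (st.compact l)
  refine ⟨V, fun l => ⟨hfV l, hpV l⟩, ?_⟩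
  have hfin := (Set.finite_Ico (0 : ℤ) r.m)
  have : ∀ i ∈ Ico (0 : ℤ) r.m, ∀ᶠ ε in 𝓝[>] (0 : ℝ),
      E.box (r.top - ε) (r.top + ε) (r.a i - ε) (r.a (i + 1) + ε) ⊆ V (r.lab i) := fun i _ =>
    E.eventually_box_subset (hV _) le_rfl (r.a_lt i).le (by
      rintro _ ⟨⟨w, θ⟩, ⟨hw, hθ⟩, rfl⟩
      obtain rfl : w = r.top := le_antisymm hw.2 hw.1
      exact hpV _ (st.arc i θ hθ))
  filter_upwards [(Filter.eventually_all_finite hfin).2 this] with ε hε i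
  have hm : (0 : ℤ) < r.m := by exact_mod_cast r.m_pos
  have key := hε (i % r.m) ⟨Int.emod_nonneg _ hm.ne', Int.emod_lt_of_pos _ hm⟩
  have hi : i = i % r.m + (i / r.m) * r.m := by rw [mul_comm, Int.emod_add_mul_ediv]
  have h1 := r.a_add_mul (i % r.m) (i / r.m)
  have h2 := r.a_add_mul (i % r.m + 1) (i / r.m)
  have h3 := r.lab_add_mul (i % r.m) (i / r.m)
  rw [← hi] at h1 h3
  rw [show i % (r.m : ℤ) + 1 + i / r.m * r.m = i % r.m + i / r.m * r.m + 1 by ring, ← hi] at h2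
  rw [h1, h2, h3, show r.a (i % r.m) + ((i / r.m : ℤ) : ℝ) - ε
    = r.a (i % r.m) - ε + ((i / r.m : ℤ) : ℝ) by ring,
    show r.a (i % r.m + 1) + ((i / r.m : ℤ) : ℝ) + ε
    = r.a (i % r.m + 1) + ε + ((i / r.m : ℤ) : ℝ) by ring, E.box_add_int]
  exact key

theorem rowPiece_shift (r : Row) (s : ℤ) (l : ℕ) :
    E.rowPiece (r.shift s) l = E.rowPiece r l := by
  apply subset_antisymm <;> refine iUnion₂_subset fun j hj => ?_
  · refine subset_iUnion₂_of_subset (j + s) hj ?_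
    simp only [brick, Row.shift, show j + 1 + s = j + s + 1 by ring, subset_rfl]
  · refine subset_iUnion₂_of_subset (j - s) (by simpa [Row.shift] using hj) ?_
    simp only [brick, Row.shift, show j - s + 1 + s = j + 1 by ring, sub_add_cancel, subset_rfl]

theorem Stack.shift {r : Row} {pc : ℕ → Set S} (st : E.Stack r pc) (s : ℤ) :
    E.Stack (r.shift s) pc where
  fin := st.fin
  compact := st.compact
  range := st.range
  level := st.level
  touch l θ hθ := by
    obtain ⟨i, hi, h'⟩ := st.touch l θ hθ
    exact ⟨i - s, by simpa [Row.shift] using hi, by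
      simpa [Row.shift, show i - s + 1 + s = i + 1 by ring] using h'⟩
  arc i θ hθ := st.arc (i + s) θ (by
    simpa [Row.shift, show i + 1 + s = i + s + 1 by ring] using hθ)
  free := st.free
  conn := st.conn
  sep l i hl hne := by
    rcases st.sep l (i + s) hl hne with h' | ⟨k, hk⟩
    · exact Or.inl h'
    · refine Or.inr ⟨k - s, ?_⟩
      simpa [Row.shift, show k - s + 1 + s = k + 1 by ring] using hk

/-- The pieces after the label `d` has been changed into `n`. -/
def mergePieces (pc : ℕ → Set S) (d n : ℕ) (l : ℕ) : Set S :=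
  if l = n then pc n ∪ pc d else if l = d then ∅ else pc l

/-- Consecutive bricks share the point of the top level over their common cut, so the merged piece
is connected. The separation property survives because relabelling only enlarges pieces and
preserves neighbours. Two bricks of the row now carry the same label: injectivity is lost, and is
recovered by deleting one of them in the next row. -/
theorem Stack.merge {r : Row} {pc : ℕ → Set S} (st : E.Stack r pc) {d n : ℕ} (hdn : d ≠ n)
    (hnext : r.NextTo d n) (hfree : FreeSet h (pc n ∪ pc d)) :
    E.Stack (r.map (relabel d n)) (mergePieces pc d n) := by
  have hmem : ∀ l x, x ∈ mergePieces pc d n l ↔ ∃ l', relabel d n l' = l ∧ x ∈ pc l' := by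
    intro l x
    simp only [mergePieces, relabel]
    split_ifs with h1 h2
    · subst h1
      constructor
      · rintro (hx | hx)
        · exact ⟨l, by simp, hx⟩
        · exact ⟨d, by simp, hx⟩
      · rintro ⟨l', hl', hx⟩
        split_ifs at hl' with h3
        · exact Or.inr (h3 ▸ hx)
        · exact Or.inl (hl' ▸ hx)
    · simp only [mem_empty_iff_false, false_iff, not_exists, not_and]
      intro l' hl'
      split_ifs at hl' with h3
      · exact (h1 hl'.symm).elim
      · exact (h3 (hl'.trans h2)).elim
    · constructor
      · exact fun hx => ⟨l, by simp [h2], hx⟩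
      · rintro ⟨l', hl', hx⟩
        split_ifs at hl' with h3
        · exact (h1 hl'.symm).elim
        · exact hl' ▸ hx
  have hsub : ∀ l, pc l ⊆ mergePieces pc d n (relabel d n l) :=
    fun l x hx => (hmem _ _).2 ⟨l, rfl, hx⟩
  have hN : ∀ l l', r.NextTo l l' →
      (r.map (relabel d n)).NextTo (relabel d n l) (relabel d n l') := by
    rintro l l' ⟨k, ⟨rfl, rfl⟩ | ⟨rfl, rfl⟩⟩
    · exact ⟨k, Or.inl ⟨rfl, rfl⟩⟩
    · exact ⟨k, Or.inr ⟨rfl, rfl⟩⟩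
  obtain ⟨kd, hkd⟩ : ∃ k, r.lab k = d := by
    obtain ⟨k, ⟨h1, -⟩ | ⟨-, h1⟩⟩ := hnext <;> exact ⟨_, h1⟩
  refine ⟨?_, ?_, ?_, ?_, ?_, ?_, ?_, ?_, ?_⟩
  · obtain ⟨b, hb⟩ := st.fin
    refine ⟨max b (n + 1), fun l hl => ?_⟩
    have h1 := le_trans (le_max_left _ _) hl
    have h2 := le_trans (le_max_right _ _) hl
    simp only [mergePieces]
    rw [if_neg (by omega), hb l h1]
    split_ifs <;> rfl
  · intro l
    simp only [mergePieces]
    split_ifs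
    exacts [(st.compact _).union (st.compact _), isCompact_empty, st.compact _]
  · intro l x hx
    obtain ⟨l', -, hx⟩ := (hmem _ _).1 hx
    exact st.range l' hx
  · intro l v θ hx
    obtain ⟨l', -, hx⟩ := (hmem _ _).1 hx
    exact st.level l' v θ hx
  · intro l θ hx
    obtain ⟨l', h', hx⟩ := (hmem _ _).1 hx
    obtain ⟨i, rfl, hi⟩ := st.touch l' θ hx
    exact ⟨i, h', hi⟩
  · intro i θ hθ
    exact hsub _ (st.arc i θ hθ)
  · intro l
    simp only [mergePieces]
    split_ifs
    exacts [hfree, freeSet_empty, st.free _]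
  · intro l
    simp only [mergePieces]
    split_ifs
    · obtain ⟨k, ⟨h1, h2⟩ | ⟨h1, h2⟩⟩ := hnext
      · refine (st.conn n).union (E.Φ (r.top, r.a (k + 1))) ?_ ?_ (st.conn d)
        · rw [← h2]; exact st.arc _ _ ⟨le_rfl, (r.a_lt _).le⟩
        · rw [← h1]; exact st.arc _ _ ⟨(r.a_lt _).le, le_rfl⟩
      · refine (st.conn n).union (E.Φ (r.top, r.a (k + 1))) ?_ ?_ (st.conn d)
        · rw [← h1]; exact st.arc _ _ ⟨(r.a_lt _).le, le_rfl⟩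
        · rw [← h2]; exact st.arc _ _ ⟨le_rfl, (r.a_lt _).le⟩
    · exact isPreconnected_empty
    · exact st.conn l
  · intro l i hl
    rintro ⟨x, hx, hx'⟩
    obtain ⟨l1, rfl, hx1⟩ := (hmem _ _).1 hx
    obtain ⟨l2, h2, hx2⟩ := (hmem _ _).1 hx'
    -- The part of a merged piece containing the contact point may come from `d` or from `n`; both
    -- are labels of the last row, so the invariant before the merge can be applied to it.
    have hl2 : ∃ j, r.lab j = l2 := by
      have h2' : relabel d n l2 = relabel d n (r.lab i) := h2
      simp only [relabel] at h2'
      split_ifs at h2' with h3 h4 h4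
      · exact ⟨kd, by rw [hkd, h3]⟩
      · exact ⟨kd, by rw [hkd, h3]⟩
      · obtain ⟨k, ⟨-, h1⟩ | ⟨h1, -⟩⟩ := hnext <;> exact ⟨_, h1.trans h2'.symm⟩
      · exact ⟨i, h2'.symm⟩
    obtain ⟨j, rfl⟩ := hl2
    have hne : l1 ≠ r.lab j := by
      rintro rfl
      exact hl h2
    rcases st.sep l1 j hne ⟨x, hx1, hx2⟩ with h' | h'
    · left
      rw [← h2]
      exact fun hf => h' (hf.mono (union_subset_union (hsub _) (hsub _)))
    · right
      rw [← h2]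
      exact hN _ _ h'

end PolarEnd

end Polar

end BrickDecomposition

/-! ### Rows prescribed on one period, and the record of the rows already laid. -/

namespace BrickDecomposition

open Set Topology

namespace Row

/-- The row with `m` bricks per period whose cuts and labels are prescribed on a period. -/
def ofPeriod (bot top : ℝ) (m : ℕ) (f : ℤ → ℝ) (g : ℤ → ℕ) (hbt : bot < top) (hm : 0 < m)
    (hf : ∀ i : ℤ, 0 ≤ i → i + 1 < m → f i < f (i + 1)) (hf' : f (m - 1) < f 0 + 1) : Row where
  bot := bot
  top := top
  m := m
  a i := f (i % m) + (i / m : ℤ)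
  lab i := g (i % m)
  bot_lt := hbt
  m_pos := hm
  a_mono := by
    have hm' : (0 : ℤ) < m := by exact_mod_cast hm
    refine strictMono_int_of_lt_succ fun i => ?_
    have h0 := Int.emod_nonneg i hm'.ne'
    have h1 := Int.emod_lt_of_pos i hm'
    have h2 := Int.emod_add_mul_ediv i m
    by_cases hlt : i % m + 1 < m
    · have h3 : (i + 1) % (m : ℤ) = i % m + 1 := by
        rw [Int.emod_eq_iff hm'.ne']
        refine ⟨by omega, by rw [Int.natAbs_natCast]; omega, ?_⟩
        exact ⟨-(i / m), by linarith⟩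
      have h4 : (i + 1) / (m : ℤ) = i / m := by
        have := Int.emod_add_mul_ediv (i + 1) m
        rw [h3] at this
        have : (m : ℤ) * ((i + 1) / m) = m * (i / m) := by linarith
        exact mul_left_cancel₀ hm'.ne' this
      rw [h3, h4]
      have := hf _ h0 hlt
      linarith
    · have h5 : i % m = m - 1 := by omega
      have h3 : (i + 1) % (m : ℤ) = 0 := by
        rw [Int.emod_eq_iff hm'.ne']
        exact ⟨le_rfl, by rw [Int.natAbs_natCast]; omega, ⟨-(i / m + 1), by linarith⟩⟩
      have h4 : (i + 1) / (m : ℤ) = i / m + 1 := by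
        have := Int.emod_add_mul_ediv (i + 1) m
        rw [h3] at this
        have : (m : ℤ) * ((i + 1) / m) = m * (i / m + 1) := by linarith
        exact mul_left_cancel₀ hm'.ne' this
      rw [h3, h4, h5]
      push_cast
      linarith
  a_add i := by
    have hm' : (m : ℤ) ≠ 0 := by exact_mod_cast hm.ne'
    rw [Int.add_emod_right, Int.add_ediv_of_dvd_right dvd_rfl, Int.ediv_self hm']
    push_cast; ring
  lab_add i := by rw [Int.add_emod_right]

section

variable {bot top : ℝ} {m : ℕ} {f : ℤ → ℝ} {g : ℤ → ℕ} {hbt : bot < top} {hm : 0 < m}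
  {hf : ∀ i : ℤ, 0 ≤ i → i + 1 < m → f i < f (i + 1)} {hf' : f (m - 1) < f 0 + 1}

theorem ofPeriod_a {i : ℤ} (h0 : 0 ≤ i) (h1 : i < m) :
    (ofPeriod bot top m f g hbt hm hf hf').a i = f i := by
  simp [ofPeriod, Int.emod_eq_of_lt h0 h1, Int.ediv_eq_zero_of_lt h0 h1]

theorem ofPeriod_lab {i : ℤ} (h0 : 0 ≤ i) (h1 : i < m) :
    (ofPeriod bot top m f g hbt hm hf hf').lab i = g i := by
  simp [ofPeriod, Int.emod_eq_of_lt h0 h1]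

theorem ofPeriod_a_last :
    (ofPeriod bot top m f g hbt hm hf hf').a m = f 0 + 1 := by
  have hm' : (m : ℤ) ≠ 0 := by exact_mod_cast hm.ne'
  simp [ofPeriod, hm.ne']

end

/-- Reduction of an index to the fundamental period. -/
theorem exists_reduce (r : Row) (i : ℤ) : ∃ j k : ℤ, 0 ≤ j ∧ j < r.m ∧ i = j + k * r.m := by
  have hm : (0 : ℤ) < r.m := by exact_mod_cast r.m_pos
  exact ⟨i % r.m, i / r.m, Int.emod_nonneg _ hm.ne', Int.emod_lt_of_pos _ hm, by
    rw [mul_comm, Int.emod_add_mul_ediv]⟩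

theorem over_of_period {r r' : Row} (hb : r'.bot = r.top)
    (H : ∀ i : ℤ, 0 ≤ i → i < r'.m → ∃ k, r.a k < r'.a i ∧ r'.a i < r.a (k + 1)) :
    r.Over r' := by
  refine ⟨hb, fun i => ?_⟩
  obtain ⟨j, k, h0, h1, rfl⟩ := r'.exists_reduce i
  obtain ⟨p, hp, hp'⟩ := H j h0 h1
  refine ⟨p + k * r.m, ?_⟩
  rw [show p + k * r.m + 1 = p + 1 + k * r.m by ring, r.a_add_mul, r.a_add_mul, r'.a_add_mul]
  constructor <;> linarith

theorem Touch.reduce {r r' : Row} {i k : ℤ} {l : ℕ} (H : r.Touch r' (i + k * r'.m) l) :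
    r.Touch r' i l := by
  obtain ⟨p, hp, θ, hθ, hθ'⟩ := H
  rw [show i + k * r'.m + 1 = i + 1 + k * r'.m by ring, r'.a_add_mul, r'.a_add_mul] at hθ
  refine ⟨p + (-k) * r.m, by rw [r.lab_add_mul, hp], θ - k, ?_, ?_⟩
  · constructor <;> linarith [hθ.1, hθ.2]
  · rw [show p + (-k) * r.m + 1 = p + 1 + (-k) * r.m by ring, r.a_add_mul, r.a_add_mul]
    push_cast
    constructor <;> linarith [hθ'.1, hθ'.2]

/-- A brick lying strictly over the cells `p, …, q - 1` touches no other one. -/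
theorem Touch.exists_cell {r r' : Row} {i : ℤ} {l : ℕ} (H : r.Touch r' i l) {p q : ℤ}
    (hp : r.a p < r'.a i) (hq : r'.a (i + 1) < r.a q) : ∃ k, p ≤ k ∧ k < q ∧ r.lab k = l := by
  obtain ⟨k, hk, θ, hθ, hθ'⟩ := H
  have h1 : p < k + 1 := r.a_mono.lt_iff_lt.1 (by linarith [hθ.1, hθ'.2])
  have h2 : k < q := r.a_mono.lt_iff_lt.1 (by linarith [hθ.2, hθ'.1])
  exact ⟨k, by omega, h2, hk⟩

end Row

namespace PolarEnd

variable {S : Type*} [TopologicalSpace S] {h : S ≃ₜ S} {w₀ : ℝ} (E : PolarEnd h w₀)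

/-- The pieces of a finite stack of rows. -/
def pieces (rows : ℕ → Row) (N : ℕ) (l : ℕ) : Set S := ⋃ n, ⋃ (_ : n ≤ N), E.rowPiece (rows n) l

/-- The row `r` and the family `pc` are the last row and the pieces of a finite stack starting
at level `w`, the cuts of whose first row avoid `bad`, and the labels of whose first row belong
to `old`. -/
def Reach (w : ℝ) (bad : Set ℝ) (r : Row) (pc : ℕ → Set S) (old : Set ℕ) : Prop :=
  ∃ (rows : ℕ → Row) (N : ℕ), (rows 0).bot = w ∧ (∀ i, (rows 0).a i ∉ bad) ∧
    (∀ n < N, (rows n).Over (rows (n + 1))) ∧ rows N = r ∧ pc = E.pieces rows N ∧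
    ∀ i, (rows 0).lab i ∈ old

variable {E} {w : ℝ} {bad : Set ℝ} {r : Row} {pc : ℕ → Set S} {old : Set ℕ}

theorem Reach.push (H : E.Reach w bad r pc old) {r' : Row} (ho : r.Over r') :
    E.Reach w bad r' (fun l => pc l ∪ E.rowPiece r' l) old := by
  obtain ⟨rows, N, h0, hbad, hover, rfl, rfl, hold⟩ := H
  refine ⟨Function.update rows (N + 1) r', N + 1, by simpa, by simpa, ?_, by simp, ?_, by simpa⟩
  · intro n hn
    rw [Function.update_of_ne (by omega)]
    rcases Nat.lt_succ_iff_lt_or_eq.1 hn with h1 | rfl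
    · rw [Function.update_of_ne (by omega)]; exact hover n h1
    · simpa using ho
  · funext l
    ext x
    simp only [pieces, mem_union, mem_iUnion, exists_prop]
    constructor
    · rintro (⟨n, hn, hx⟩ | hx)
      · exact ⟨n, by omega, by rwa [Function.update_of_ne (by omega)]⟩
      · exact ⟨N + 1, le_rfl, by simpa using hx⟩
    · rintro ⟨n, hn, hx⟩
      rcases Nat.lt_succ_iff_lt_or_eq.1 (Nat.lt_succ_of_le hn) with h1 | rfl
      · rw [Function.update_of_ne (by omega)] at hx; exact Or.inl ⟨n, by omega, hx⟩
      · exact Or.inr (by simpa using hx)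

theorem Reach.shift (H : E.Reach w bad r pc old) (s : ℤ) : E.Reach w bad (r.shift s) pc old := by
  obtain ⟨rows, N, h0, hbad, hover, rfl, rfl, hold⟩ := H
  refine ⟨Function.update rows N ((rows N).shift s), N, ?_, ?_, ?_, by simp, ?_, ?_⟩
  · rcases Nat.eq_zero_or_pos N with rfl | hN
    · simpa [Row.shift] using h0
    · rwa [Function.update_of_ne (by omega)]
  · rcases Nat.eq_zero_or_pos N with rfl | hN
    · simpa [Row.shift] using fun i => hbad (i + s)
    · rwa [Function.update_of_ne (by omega)]
  · intro n hn
    rw [Function.update_of_ne (by omega)]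
    by_cases hN : n + 1 = N
    · subst hN
      rw [Function.update_self]
      exact ⟨(hover n hn).1, fun i => (hover n hn).2 (i + s)⟩
    · rw [Function.update_of_ne hN]; exact hover n hn
  · funext l
    simp only [pieces]
    refine iUnion_congr fun n => iUnion_congr fun hn => ?_
    by_cases hN : n = N
    · subst hN; rw [Function.update_self, rowPiece_shift]
    · rw [Function.update_of_ne hN]
  · rcases Nat.eq_zero_or_pos N with rfl | hN
    · simpa [Row.shift] using fun i => hold (i + s)
    · rwa [Function.update_of_ne (by omega)]

/-- A merge is carried out retroactively in every row of the stack, so the labels of the first row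
change too; this is why the set of old labels is replaced by its image. -/
theorem Reach.merge (H : E.Reach w bad r pc old) {d n : ℕ} (hdn : d ≠ n) :
    E.Reach w bad (r.map (relabel d n)) (mergePieces pc d n) (relabel d n '' old) := by
  obtain ⟨rows, N, h0, hbad, hover, rfl, rfl, hold⟩ := H
  refine ⟨fun k => (rows k).map (relabel d n), N, h0, hbad, fun k hk => hover k hk, rfl, ?_,
    fun i => ⟨_, hold i, rfl⟩⟩
  funext l
  have key : ∀ k, E.rowPiece ((rows k).map (relabel d n)) l
      = mergePieces (E.rowPiece (rows k)) d n l := by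
    intro k
    ext x
    simp only [rowPiece, Row.map, relabel, mergePieces, mem_iUnion, exists_prop]
    split_ifs with h1 h2
    · simp only [mem_union, mem_iUnion, exists_prop]
      constructor
      · rintro ⟨i, hi, hx⟩
        split_ifs at hi with h3
        · exact Or.inr ⟨i, h3, hx⟩
        · exact Or.inl ⟨i, hi.trans h1, hx⟩
      · rintro (⟨i, hi, hx⟩ | ⟨i, hi, hx⟩)
        · exact ⟨i, by simp [hi, hdn.symm, h1], hx⟩
        · exact ⟨i, by simp [hi, h1], hx⟩
    · simp only [mem_empty_iff_false, iff_false, not_exists, not_and]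
      intro i hi
      split_ifs at hi with h3
      · exact (h1 hi.symm).elim
      · exact (h3 (hi.trans h2)).elim
    · simp only [mem_iUnion, exists_prop]
      constructor
      · rintro ⟨i, hi, hx⟩
        split_ifs at hi with h3
        · exact (h1 hi.symm).elim
        · exact ⟨i, hi, hx⟩
      · rintro ⟨i, hi, hx⟩
        exact ⟨i, by rw [if_neg (by rw [hi]; exact h2), hi], hx⟩
  simp only [pieces, key]
  simp only [mergePieces]
  split_ifs with h1 h2
  · simp only [pieces, iUnion_union_distrib]
  · simp
  · rfl

end PolarEnd

end BrickDecomposition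

/-! ### Moves on the last row: deleting a brick. -/

namespace BrickDecomposition

open Set Topology

namespace Row

theorem inj_of_period {r : Row}
    (H : ∀ i j : ℤ, 0 ≤ i → i < r.m → 0 ≤ j → j < r.m → r.lab i = r.lab j → i = j) : r.Inj := by
  intro i j hij
  obtain ⟨i', k, h0, h1, rfl⟩ := r.exists_reduce i
  obtain ⟨j', k', h0', h1', rfl⟩ := r.exists_reduce j
  rw [r.lab_add_mul, r.lab_add_mul] at hij
  obtain rfl := H _ _ h0 h1 h0' h1' hij
  exact ⟨k' - k, by ring⟩

theorem Inj.eq_of_period {r : Row} (H : r.Inj) {i j : ℤ} (h : r.lab i = r.lab j)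
    (h1 : i < j + r.m) (h2 : j < i + r.m) : i = j := by
  have := Int.eq_zero_of_abs_lt_dvd (H i j h) (by rw [abs_lt]; constructor <;> linarith)
  linarith

end Row

namespace PolarEnd

variable {S : Type*} [TopologicalSpace S] {h : S ≃ₜ S} {w₀ : ℝ} {E : PolarEnd h w₀}
  {r : Row} {pc : ℕ → Set S}

/-- Adding a row each brick of which either prolongs a brick of `r` above its neighbours at most,
or is new and lies strictly over a brick of `r`. -/
theorem Stack.push_near (st : E.Stack r pc) {r' : Row} (hbot : r'.bot = r.top)
    (hover : ∀ i : ℤ, 0 ≤ i → i < r'.m → ∃ k, r.a k < r'.a i ∧ r'.a i < r.a (k + 1))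
    (hinj : ∀ i j : ℤ, 0 ≤ i → i < r'.m → 0 ≤ j → j < r'.m → r'.lab i = r'.lab j → i = j)
    (hfree : ∀ i : ℤ, 0 ≤ i → i < r'.m →
      FreeSet h (pc (r'.lab i) ∪ E.box r'.bot r'.top (r'.a i) (r'.a (i + 1))))
    (hcons : ∀ k : ℤ, 0 ≤ k → k < r.m → r.lab k ≠ r.lab (k + 1) →
      ¬ FreeSet h ((pc (r.lab k) ∪ E.rowPiece r' (r.lab k)) ∪
        (pc (r.lab (k + 1)) ∪ E.rowPiece r' (r.lab (k + 1)))) ∨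
        r'.NextTo (r.lab k) (r.lab (k + 1)))
    (hnear : ∀ i : ℤ, 0 ≤ i → i < r'.m →
      (∃ j, r'.lab i = r.lab j ∧ r.a (j - 1) < r'.a i ∧ r'.a i < r.a (j + 1) ∧
        r.a j < r'.a (i + 1) ∧ r'.a (i + 1) < r.a (j + 2)) ∨
      (r'.lab i ∉ Set.range r.lab ∧ pc (r'.lab i) = ∅ ∧ ∃ p, r.a p < r'.a i ∧
        r'.a (i + 1) < r.a (p + 1) ∧
        (¬ FreeSet h ((pc (r.lab p) ∪ E.rowPiece r' (r.lab p)) ∪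
          (pc (r'.lab i) ∪ E.rowPiece r' (r'.lab i))) ∨ r'.NextTo (r.lab p) (r'.lab i)))) :
    r.Over r' ∧ r'.Inj ∧ E.Stack r' (fun l => pc l ∪ E.rowPiece r' l) := by
  have ho := Row.over_of_period hbot hover
  have hI := Row.inj_of_period hinj
  have hcons' : ∀ k, r.lab k ≠ r.lab (k + 1) →
      ¬ FreeSet h ((pc (r.lab k) ∪ E.rowPiece r' (r.lab k)) ∪
        (pc (r.lab (k + 1)) ∪ E.rowPiece r' (r.lab (k + 1)))) ∨
        r'.NextTo (r.lab k) (r.lab (k + 1)) := by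
    intro k
    obtain ⟨k, j, h0, h1, rfl⟩ := r.exists_reduce k
    rw [show k + j * r.m + 1 = k + 1 + j * r.m by ring, r.lab_add_mul, r.lab_add_mul]
    exact hcons k h0 h1
  have hcons'' : ∀ k, r.lab (k + 1) ≠ r.lab k →
      ¬ FreeSet h ((pc (r.lab (k + 1)) ∪ E.rowPiece r' (r.lab (k + 1))) ∪
        (pc (r.lab k) ∪ E.rowPiece r' (r.lab k))) ∨
        r'.NextTo (r.lab (k + 1)) (r.lab k) := by
    intro k hk
    rw [union_comm]
    exact (hcons' k hk.symm).imp_right Row.NextTo.symm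
  refine ⟨ho, hI, st.push E ho hI ?_ ?_ ?_ ?_⟩
  · intro i
    obtain ⟨i, k, h0, h1, rfl⟩ := r'.exists_reduce i
    rw [r'.lab_add_mul, E.brick_add_mul]
    exact hfree i h0 h1
  · intro i
    obtain ⟨i, k, h0, h1, rfl⟩ := r'.exists_reduce i
    rw [r'.lab_add_mul]
    rcases hnear i h0 h1 with ⟨j, hj, -, hj2, hj3, -⟩ | ⟨-, he, -⟩
    · right
      refine ⟨j + k * r.m, by rw [hj, r.lab_add_mul], max (r.a j) (r'.a i) + k, ?_, ?_⟩
      · rw [show i + k * r'.m + 1 = i + 1 + k * r'.m by ring, r'.a_add_mul, r'.a_add_mul]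
        exact ⟨by linarith [le_max_right (r.a j) (r'.a i)],
          add_le_add_left (max_le hj3.le (r'.a_lt i).le) _⟩
      · rw [show j + k * r.m + 1 = j + 1 + k * r.m by ring, r.a_add_mul, r.a_add_mul]
        exact ⟨by linarith [le_max_left (r.a j) (r'.a i)],
          add_le_add_left (max_le (r.a_lt j).le hj2.le) _⟩
    · exact Or.inl he
  · intro i l
    obtain ⟨i, k, h0, h1, rfl⟩ := r'.exists_reduce i
    rw [r'.lab_add_mul]
    intro hl ht
    replace ht := ht.reduce
    rcases hnear i h0 h1 with ⟨j, hj, hj1, -, -, hj4⟩ | ⟨-, he, p, hp1, hp2, hp3⟩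
    · rw [hj] at hl ⊢
      obtain ⟨k, hk1, hk2, rfl⟩ := ht.exists_cell hj1 hj4
      -- The ends of the prolonged brick stay within the cells adjacent to the cell `j`, so the only
      -- bricks under it are `j` and its two neighbours.
      obtain rfl | rfl | rfl : k = j - 1 ∨ k = j ∨ k = j + 1 := by omega
      · have := hcons' (j - 1)
        rw [sub_add_cancel] at this
        exact this hl
      · exact (hl rfl).elim
      · exact hcons'' j hl
    · obtain ⟨k, hk1, hk2, rfl⟩ := ht.exists_cell hp1 hp2
      obtain rfl : k = p := by omega
      exact hp3
  · intro i l
    obtain ⟨i, k, h0, h1, rfl⟩ := r'.exists_reduce i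
    rw [r'.lab_add_mul]
    rintro hl ⟨k, ⟨rfl, hk⟩ | ⟨hk, rfl⟩⟩
    · rw [← hk] at hl ⊢; exact hcons' k hl
    · rw [← hk] at hl ⊢; exact hcons'' k hl

/-- Specification of the row obtained from `r` by deleting the brick `0`, moving the cut between
its neighbours to `c` and moving the other cuts by `ξ` to the left. -/
structure IsDelete (r : Row) (n : ℕ) (T c ξ : ℝ) (r' : Row) : Prop where
  hm : r.m = n + 1
  hn : 1 ≤ n
  hξ : 0 < ξ
  hξ' : ∀ i, ξ < r.a (i + 1) - r.a i
  hc : r.a 0 < c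
  hc' : c < r.a 1
  bot : r'.bot = r.top
  top : r'.top = r.top + T
  m : r'.m = n
  a_zero : r'.a 0 = c
  a_mid : ∀ i : ℤ, 1 ≤ i → i < n → r'.a i = r.a (i + 1) - ξ
  a_last : r'.a n = c + 1
  lab : ∀ i : ℤ, 0 ≤ i → i < n → r'.lab i = r.lab (i + 1)

theorem exists_isDelete {r : Row} {n : ℕ} {T c ξ : ℝ} (hm : r.m = n + 1) (hn : 1 ≤ n)
    (hT : 0 < T) (hξ : 0 < ξ) (hξ' : ∀ i, ξ < r.a (i + 1) - r.a i) (hc : r.a 0 < c)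
    (hc' : c < r.a 1) : ∃ r', IsDelete r n T c ξ r' := by
  have hlast : r.a (n + 1) = r.a 0 + 1 := by
    have := r.a_add 0
    rw [hm] at this
    push_cast at this
    rwa [zero_add] at this
  refine ⟨Row.ofPeriod r.top (r.top + T) n (fun i => if i = 0 then c else r.a (i + 1) - ξ)
    (fun i => r.lab (i + 1)) (by linarith) (by omega) ?_ ?_, hm, hn, hξ, hξ', hc, hc', rfl, rfl,
    rfl, ?_, ?_, ?_, ?_⟩
  · intro i h0 h1
    rw [if_neg (show ¬ i + 1 = 0 by omega)]
    split_ifs with hi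
    · subst hi
      have := hξ' 1
      norm_num at this ⊢
      linarith
    · have := r.a_lt (i + 1); linarith
  · rw [if_pos rfl]
    split_ifs with h1
    · linarith
    · rw [sub_add_cancel]
      have := r.a_lt n
      linarith
  · rw [Row.ofPeriod_a le_rfl (by exact_mod_cast hn), if_pos rfl]
  · intro i h1 h2
    rw [Row.ofPeriod_a (by omega) h2, if_neg (by omega)]
  · rw [Row.ofPeriod_a_last, if_pos rfl]
  · intro i h1 h2
    rw [Row.ofPeriod_lab h1 h2]

/-- The brick `0` leaves the row and its neighbours `1` and `n` become consecutive. The only pairs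
of neighbours that are lost are those involving the brick `0`; `hd` says that they cannot be merged,
or that the brick `0` already carries the label of one of its neighbours. Since the latter happens
after a merge, labels are only required to be distinct on the bricks `1, …, n`. -/
theorem Stack.delete (st : E.Stack r pc) {r' : Row} {n : ℕ} {T c ξ : ℝ}
    (H : IsDelete r n T c ξ r')
    (hinj : ∀ i j : ℤ, 1 ≤ i → i ≤ n → 1 ≤ j → j ≤ n → r.lab i = r.lab j → i = j)
    (hd : r.lab 0 = r.lab 1 ∨ r.lab 0 = r.lab n ∨
      (¬ FreeSet h (pc (r.lab 0) ∪ pc (r.lab 1)) ∧ ¬ FreeSet h (pc (r.lab 0) ∪ pc (r.lab n))))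
    (hfree : ∀ i : ℤ, 0 ≤ i → i < n →
      FreeSet h (pc (r.lab (i + 1)) ∪ E.box r.top (r.top + T) (r'.a i) (r'.a (i + 1)))) :
    r.Over r' ∧ r'.Inj ∧ E.Stack r' (fun l => pc l ∪ E.rowPiece r' l) := by
  have hshift : ∀ i, r.a (i + (n + 1)) = r.a i + 1 := by
    intro i
    have := r.a_add i
    rw [H.hm] at this
    exact_mod_cast this
  have hlshift : ∀ i, r.lab (i + (n + 1)) = r.lab i := by
    intro i
    have := r.lab_add i
    rw [H.hm] at this
    exact_mod_cast this
  have hn := H.hn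
  have hξ := H.hξ
  have hξ' := H.hξ'
  have hc := H.hc
  have hc' := H.hc'
  have hnext : r'.NextTo (r.lab 1) (r.lab n) := by
    refine ⟨(n : ℤ) - 1, Or.inr ⟨?_, ?_⟩⟩
    · rw [H.lab _ (by omega) (by omega), sub_add_cancel]
    · have := r'.lab_add 0
      rw [H.m, H.lab 0 le_rfl (by omega)] at this
      rw [sub_add_cancel, ← zero_add (n : ℤ), this, zero_add]
  refine st.push_near H.bot ?_ ?_ ?_ ?_ ?_
  · rw [H.m]
    intro i h0 h1
    by_cases hi : i = 0
    · subst hi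
      exact ⟨0, by rw [H.a_zero]; exact hc, by rw [H.a_zero]; simpa using hc'⟩
    · refine ⟨i, ?_, ?_⟩ <;> rw [H.a_mid i (by omega) h1] <;> have := hξ' i <;> linarith
  · rw [H.m]
    intro i j h0 h1 h0' h1' hij
    rw [H.lab i h0 h1, H.lab j h0' h1'] at hij
    have := hinj _ _ (by omega) (by omega) (by omega) (by omega) hij
    omega
  · rw [H.m]
    intro i h0 h1
    rw [H.lab i h0 h1, H.bot, H.top]
    exact hfree i h0 h1
  · rw [H.hm]
    push_cast
    intro k h0 h1 hne
    rcases eq_or_lt_of_le h0 with rfl | h0'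
    · rw [zero_add] at hne ⊢
      rcases hd with h' | h' | ⟨h', -⟩
      · exact (hne h').elim
      · rw [h']; exact Or.inr hnext.symm
      · exact Or.inl fun hf => h' (hf.mono (union_subset_union subset_union_left
          subset_union_left))
    · by_cases hkn : k = n
      · have hz := hlshift 0
        subst hkn
        rw [zero_add] at hz
        rw [hz] at hne ⊢
        rcases hd with h' | h' | ⟨-, h'⟩
        · rw [h']; exact Or.inr hnext.symm
        · exact (hne h'.symm).elim
        · rw [union_comm] at h'
          exact Or.inl fun hf => h' (hf.mono (union_subset_union subset_union_left
            subset_union_left))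
      · refine Or.inr ⟨k - 1, Or.inl ⟨?_, ?_⟩⟩
        · rw [H.lab _ (by omega) (by omega), sub_add_cancel]
        · rw [sub_add_cancel, H.lab _ (by omega) (by omega)]
  · rw [H.m]
    intro i h0 h1
    left
    refine ⟨i + 1, H.lab i h0 h1, ?_, ?_, ?_, ?_⟩
    · rw [add_sub_cancel_right]
      by_cases hi : i = 0
      · subst hi; rw [H.a_zero]; exact hc
      · rw [H.a_mid i (by omega) h1]; have := hξ' i; linarith
    · by_cases hi : i = 0
      · subst hi; rw [H.a_zero]; have := r.a_lt 1; norm_num at this ⊢; linarith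
      · rw [H.a_mid i (by omega) h1]; have := r.a_lt (i + 1); linarith
    · by_cases hi : i + 1 = n
      · rw [hi, H.a_last]
        have := hshift 0
        have := r.a_lt n
        rw [zero_add] at *
        linarith
      · rw [H.a_mid _ (by omega) (by omega)]
        have := hξ' (i + 1); linarith
    · by_cases hi : i + 1 = n
      · rw [hi, H.a_last]
        have := hshift 1
        rw [show (n : ℤ) + 2 = 1 + (n + 1) by ring]
        linarith
      · rw [H.a_mid _ (by omega) (by omega)]
        rw [show i + 1 + 2 = i + 1 + 1 + 1 by ring]
        have := r.a_lt (i + 1 + 1); linarith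

end PolarEnd

end BrickDecomposition

/-! ### Moves on the last row: inserting or replacing a brick. -/

namespace BrickDecomposition

open Set Topology

namespace PolarEnd

variable {S : Type*} [TopologicalSpace S] {h : S ≃ₜ S} {w₀ : ℝ} {E : PolarEnd h w₀}
  {r : Row} {pc : ℕ → Set S}

/-- Specification of the row obtained from `r` by moving the cuts by `ξ` to the left, except for
the cut between the bricks `0` and `1`, replaced by a new brick over `[s, t]` labelled `x`. -/
structure IsInsert (r : Row) (T ξ s t : ℝ) (x : ℕ) (r' : Row) : Prop where
  hm : 2 ≤ r.m
  hξ : 0 < ξ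
  hξ' : ∀ i, ξ < r.a (i + 1) - r.a i
  hs : r.a 1 < s
  hst : s < t
  ht : t < r.a 2 - ξ
  bot : r'.bot = r.top
  top : r'.top = r.top + T
  m : r'.m = r.m + 1
  a_zero : r'.a 0 = r.a 0 - ξ
  a_one : r'.a 1 = s
  a_two : r'.a 2 = t
  a_mid : ∀ i : ℤ, 3 ≤ i → i ≤ r.m + 1 → r'.a i = r.a (i - 1) - ξ
  lab_zero : r'.lab 0 = r.lab 0
  lab_one : r'.lab 1 = x
  lab_mid : ∀ i : ℤ, 2 ≤ i → i ≤ r.m → r'.lab i = r.lab (i - 1)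

theorem exists_isInsert {r : Row} {T ξ s t : ℝ} (x : ℕ) (hm : 2 ≤ r.m)
    (hT : 0 < T) (hξ : 0 < ξ) (hξ' : ∀ i, ξ < r.a (i + 1) - r.a i) (hs : r.a 1 < s)
    (hst : s < t) (ht : t < r.a 2 - ξ) : ∃ r', IsInsert r T ξ s t x r' := by
  have hlast := r.a_add 0
  rw [zero_add] at hlast
  let f : ℤ → ℝ := fun i =>
    if i = 0 then r.a 0 - ξ else if i = 1 then s else if i = 2 then t else r.a (i - 1) - ξ
  have f0 : f 0 = r.a 0 - ξ := by simp [f]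
  have f1 : f 1 = s := by simp [f]
  have f2 : f 2 = t := by simp [f]
  have f3 : ∀ i, 3 ≤ i → f i = r.a (i - 1) - ξ := fun i hi => by
    simp only [f]
    rw [if_neg (by omega), if_neg (by omega), if_neg (by omega)]
  let g : ℤ → ℕ := fun i => if i = 0 then r.lab 0 else if i = 1 then x else r.lab (i - 1)
  have h01 := r.a_lt 0
  rw [zero_add] at h01
  refine ⟨Row.ofPeriod r.top (r.top + T) (r.m + 1) f g (by linarith) (by omega) ?_ ?_, hm, hξ,
    hξ', hs, hst, ht, rfl, rfl, rfl, ?_, ?_, ?_, ?_, ?_, ?_, ?_⟩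
  · intro i h0 h1
    obtain rfl | rfl | rfl | hi : i = 0 ∨ i = 1 ∨ i = 2 ∨ 3 ≤ i := by omega
    · rw [zero_add, f0, f1]; linarith
    · rw [f1, show (1 : ℤ) + 1 = 2 by rfl, f2]; exact hst
    · rw [f2, f3 _ (by omega)]; exact ht
    · rw [f3 i hi, f3 _ (by omega)]
      have := r.a_mono (show i - 1 < i + 1 - 1 by omega); linarith
  · push_cast
    rw [add_sub_cancel_right, f0]
    obtain hi | hi : r.m = 2 ∨ 3 ≤ r.m := by omega
    · have : r.a 2 = r.a 0 + 1 := by rw [← hlast, hi]; rfl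
      rw [hi]
      change f 2 < _
      rw [f2]; linarith
    · rw [f3 _ (by exact_mod_cast hi)]
      have := r.a_mono (show (r.m : ℤ) - 1 < r.m by omega); linarith
  · rw [Row.ofPeriod_a le_rfl (by push_cast; omega), f0]
  · rw [Row.ofPeriod_a (by omega) (by push_cast; omega), f1]
  · rw [Row.ofPeriod_a (by omega) (by push_cast; omega), f2]
  · intro i h1 h2
    rcases eq_or_lt_of_le h2 with h3 | h3
    · rw [show i = ((r.m + 1 : ℕ) : ℤ) by push_cast; exact h3, Row.ofPeriod_a_last, f0]
      push_cast
      rw [add_sub_cancel_right, hlast]; ring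
    · rw [Row.ofPeriod_a (by omega) (by push_cast; omega), f3 i h1]
  · rw [Row.ofPeriod_lab le_rfl (by push_cast; omega)]; simp [g]
  · rw [Row.ofPeriod_lab (by omega) (by push_cast; omega)]; simp [g]
  · intro i h1 h2
    rw [Row.ofPeriod_lab (by omega) (by push_cast; omega)]
    simp only [g]
    rw [if_neg (by omega), if_neg (by omega)]

/-- The brick `0` is prolonged over the beginning of the brick `1`, and the new brick lies strictly
over the brick `1`, which remains its neighbour. The bricks `0` and `1` are the only neighbours that
get separated, so only their union has to be non-free. -/
theorem Stack.insert (st : E.Stack r pc) {r' : Row} {T ξ s t : ℝ} {x : ℕ}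
    (H : IsInsert r T ξ s t x r') (hinj : r.Inj) (hx : x ∉ Set.range r.lab) (hpx : pc x = ∅)
    (hd : ¬ FreeSet h (pc (r.lab 0) ∪ pc (r.lab 1)))
    (hfree : ∀ i : ℤ, 0 ≤ i → i < r.m + 1 →
      FreeSet h (pc (r'.lab i) ∪ E.box r.top (r.top + T) (r'.a i) (r'.a (i + 1)))) :
    r.Over r' ∧ r'.Inj ∧ E.Stack r' (fun l => pc l ∪ E.rowPiece r' l) := by
  have hm := H.hm
  have hξ := H.hξ
  have hξ' := H.hξ'
  have hs := H.hs
  have hst := H.hst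
  have ht := H.ht
  have h01 := r.a_lt 0
  rw [zero_add] at h01
  have hr'm : (r'.m : ℤ) = r.m + 1 := by rw [H.m]; push_cast; rfl
  have hs2 := hξ' 1
  norm_num at hs2
  have h23 := r.a_lt 2
  norm_num at h23
  have hxx : ∀ i, r.lab i ≠ x := fun i hi => hx ⟨i, hi⟩
  refine st.push_near H.bot ?_ ?_ ?_ ?_ ?_
  · rw [hr'm]
    intro i h0 h1
    obtain rfl | rfl | rfl | hi : i = 0 ∨ i = 1 ∨ i = 2 ∨ 3 ≤ i := by omega
    · have := hξ' (-1)
      norm_num at this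
      refine ⟨-1, ?_, ?_⟩ <;> rw [H.a_zero] <;> norm_num <;> linarith
    · refine ⟨1, ?_, ?_⟩ <;> rw [H.a_one] <;> norm_num <;> linarith
    · refine ⟨1, ?_, ?_⟩ <;> rw [H.a_two] <;> norm_num <;> linarith
    · have := hξ' (i - 2)
      rw [show i - 2 + 1 = i - 1 by ring] at this
      refine ⟨i - 2, ?_, ?_⟩ <;> rw [H.a_mid i hi (by omega)]
      · linarith
      · rw [show i - 2 + 1 = i - 1 by ring]; linarith
  · rw [hr'm]
    have key : ∀ i j : ℤ, 0 ≤ i → i < j → j < r.m + 1 → r'.lab i = r'.lab j → False := by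
      intro i j h0 h1 h2 hij
      obtain rfl | rfl | hi : i = 0 ∨ i = 1 ∨ 2 ≤ i := by omega
      · rw [H.lab_zero] at hij
        obtain rfl | hj : j = 1 ∨ 2 ≤ j := by omega
        · rw [H.lab_one] at hij; exact hxx _ hij
        · rw [H.lab_mid j hj (by omega)] at hij
          have := hinj.eq_of_period hij (by omega) (by omega)
          omega
      · rw [H.lab_one, H.lab_mid j (by omega) (by omega)] at hij
        exact hxx _ hij.symm
      · rw [H.lab_mid i hi (by omega), H.lab_mid j (by omega) (by omega)] at hij
        have := hinj.eq_of_period hij (by omega) (by omega)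
        omega
    intro i j h0 h1 h0' h1' hij
    rcases lt_trichotomy i j with h' | h' | h'
    · exact (key i j h0 h' h1' hij).elim
    · exact h'
    · exact (key j i h0' h' h1 hij.symm).elim
  · rw [hr'm]
    intro i h0 h1
    rw [H.bot, H.top]
    exact hfree i h0 h1
  · intro k h0 h1 hne
    rcases eq_or_lt_of_le h0 with rfl | h0'
    · rw [zero_add] at hne ⊢
      exact Or.inl fun hf => hd (hf.mono (union_subset_union subset_union_left
          subset_union_left))
    · refine Or.inr ⟨k + 1, Or.inl ⟨?_, ?_⟩⟩
      · rw [H.lab_mid _ (by omega) (by omega), add_sub_cancel_right]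
      · rcases eq_or_lt_of_le (show k + 1 ≤ r.m by omega) with h2 | h2
        · have h3 := r'.lab_add 0
          have h4 := r.lab_add 0
          rw [zero_add, hr'm, H.lab_zero] at h3
          rw [zero_add] at h4
          rw [h2, h3, h4]
        · rw [H.lab_mid _ (by omega) (by omega), add_sub_cancel_right]
  · rw [hr'm]
    intro i h0 h1
    obtain rfl | rfl | rfl | hi : i = 0 ∨ i = 1 ∨ i = 2 ∨ 3 ≤ i := by omega
    · left
      have := hξ' (-1)
      norm_num at this
      refine ⟨0, H.lab_zero, ?_, ?_, ?_, ?_⟩ <;> norm_num [H.a_zero, H.a_one] <;> linarith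
    · right
      rw [H.lab_one]
      refine ⟨hx, hpx, 1, ?_, ?_, Or.inr ⟨1, Or.inr ⟨H.lab_one, ?_⟩⟩⟩
      · rw [H.a_one]; exact hs
      · norm_num [H.a_two]; linarith
      · have := H.lab_mid 2 le_rfl (by omega)
        simpa using this
    · left
      have h3 := H.a_mid 3 le_rfl (by omega)
      norm_num at h3
      refine ⟨1, H.lab_mid 2 le_rfl (by omega), ?_, ?_, ?_, ?_⟩ <;>
        norm_num [H.a_two, h3] <;> linarith
    · left
      have h2 := H.a_mid i hi (by omega)
      have h3 := H.a_mid (i + 1) (by omega) (by omega)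
      rw [add_sub_cancel_right] at h3
      have e1 := hξ' (i - 2)
      have e2 := hξ' (i - 1)
      have e3 := r.a_lt i
      rw [show i - 2 + 1 = i - 1 by ring] at e1
      rw [show i - 1 + 1 = i by ring] at e2
      refine ⟨i - 1, H.lab_mid i (by omega) (by omega), ?_, ?_, ?_, ?_⟩
      · rw [h2, show i - 1 - 1 = i - 2 by ring]; linarith
      · rw [h2, sub_add_cancel]; linarith
      · rw [h3]; linarith
      · rw [h3, show i - 1 + 2 = i + 1 by ring]; linarith

/-- Specification of the row obtained from `r` by replacing the brick `0` with a narrower new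
brick over `[c₂, c]` labelled `y`, and moving the other cuts by `ξ` to the left. -/
structure IsReplace (r : Row) (n : ℕ) (T ξ c₂ c : ℝ) (y : ℕ) (r' : Row) : Prop where
  hm : r.m = n + 1
  hn : 1 ≤ n
  hξ : 0 < ξ
  hξ' : ∀ i, ξ < r.a (i + 1) - r.a i
  hc₂ : r.a 0 < c₂
  hc₂c : c₂ < c
  hc : c < r.a 1
  bot : r'.bot = r.top
  top : r'.top = r.top + T
  m : r'.m = n + 1
  a_zero : r'.a 0 = c₂
  a_one : r'.a 1 = c
  a_mid : ∀ i : ℤ, 2 ≤ i → i ≤ n → r'.a i = r.a i - ξ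
  a_last : r'.a (n + 1) = c₂ + 1
  lab_zero : r'.lab 0 = y
  lab_mid : ∀ i : ℤ, 1 ≤ i → i ≤ n → r'.lab i = r.lab i

theorem exists_isReplace {r : Row} {n : ℕ} {T ξ c₂ c : ℝ} (y : ℕ) (hm : r.m = n + 1) (hn : 1 ≤ n)
    (hT : 0 < T) (hξ : 0 < ξ) (hξ' : ∀ i, ξ < r.a (i + 1) - r.a i) (hc₂ : r.a 0 < c₂)
    (hc₂c : c₂ < c) (hc : c < r.a 1) : ∃ r', IsReplace r n T ξ c₂ c y r' := by
  have hlast := r.a_add 0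
  rw [zero_add, hm] at hlast
  push_cast at hlast
  let f : ℤ → ℝ := fun i => if i = 0 then c₂ else if i = 1 then c else r.a i - ξ
  have f0 : f 0 = c₂ := by simp [f]
  have f1 : f 1 = c := by simp [f]
  have f3 : ∀ i, 2 ≤ i → f i = r.a i - ξ := fun i hi => by
    simp only [f]
    rw [if_neg (by omega), if_neg (by omega)]
  let g : ℤ → ℕ := fun i => if i = 0 then y else r.lab i
  have h01 := hξ' 1
  norm_num at h01
  refine ⟨Row.ofPeriod r.top (r.top + T) (n + 1) f g (by linarith) (by omega) ?_ ?_, hm, hn, hξ,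
    hξ', hc₂, hc₂c, hc, rfl, rfl, rfl, ?_, ?_, ?_, ?_, ?_, ?_⟩
  · intro i h0 h1
    obtain rfl | rfl | hi : i = 0 ∨ i = 1 ∨ 2 ≤ i := by omega
    · rw [zero_add, f0, f1]; linarith
    · rw [f1, f3 _ (by omega)]
      norm_num
      linarith
    · rw [f3 i hi, f3 _ (by omega)]
      have := r.a_lt i; linarith
  · push_cast
    rw [add_sub_cancel_right, f0]
    have h5 := r.a_lt n
    rw [hlast] at h5
    obtain hi | hi : n = 1 ∨ 2 ≤ n := by omega
    · subst hi
      push_cast at h5 ⊢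
      rw [f1]
      linarith
    · rw [f3 _ (by exact_mod_cast hi)]
      linarith
  · rw [Row.ofPeriod_a le_rfl (by push_cast; omega), f0]
  · rw [Row.ofPeriod_a (by omega) (by push_cast; omega), f1]
  · intro i h1 h2
    rw [Row.ofPeriod_a (by omega) (by push_cast; omega), f3 i h1]
  · exact Row.ofPeriod_a_last.trans (by rw [f0])
  · rw [Row.ofPeriod_lab le_rfl (by push_cast; omega)]; simp [g]
  · intro i h1 h2
    rw [Row.ofPeriod_lab (by omega) (by push_cast; omega)]
    simp only [g]
    rw [if_neg (by omega)]

/-- The label of the brick `0` leaves the row. It was a neighbour of the labels of `1` and `n` and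
it lies under the new brick, whence the three non-freeness conditions. The bricks `1` and `n` are
prolonged over the remaining ends of the brick `0`. -/
theorem Stack.replace (st : E.Stack r pc) {r' : Row} {n : ℕ} {T ξ c₂ c : ℝ} {y : ℕ}
    (H : IsReplace r n T ξ c₂ c y r') (hinj : r.Inj) (hy : y ∉ Set.range r.lab) (hpy : pc y = ∅)
    (hd : ¬ FreeSet h (pc (r.lab 0) ∪ pc (r.lab 1)))
    (hd' : ¬ FreeSet h (pc (r.lab 0) ∪ pc (r.lab n)))
    (hd'' : ¬ FreeSet h (pc (r.lab 0) ∪ E.box r.top (r.top + T) c₂ c))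
    (hfree : ∀ i : ℤ, 0 ≤ i → i < n + 1 →
      FreeSet h (pc (r'.lab i) ∪ E.box r.top (r.top + T) (r'.a i) (r'.a (i + 1)))) :
    r.Over r' ∧ r'.Inj ∧ E.Stack r' (fun l => pc l ∪ E.rowPiece r' l) := by
  have hn := H.hn
  have hξ := H.hξ
  have hξ' := H.hξ'
  have hc₂ := H.hc₂
  have hc₂c := H.hc₂c
  have hc := H.hc
  have hshift : ∀ i, r.a (i + (n + 1)) = r.a i + 1 := by
    intro i
    have := r.a_add i
    rw [H.hm] at this
    exact_mod_cast this
  have hr'm : (r'.m : ℤ) = n + 1 := by rw [H.m]; push_cast; rfl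
  have hrm : (r.m : ℤ) = n + 1 := by rw [H.hm]; push_cast; rfl
  have hs2 := hξ' 1
  norm_num at hs2
  have hxx : ∀ i, r.lab i ≠ y := fun i hi => hy ⟨i, hi⟩
  refine st.push_near H.bot ?_ ?_ ?_ ?_ ?_
  · rw [hr'm]
    intro i h0 h1
    obtain rfl | rfl | hi : i = 0 ∨ i = 1 ∨ 2 ≤ i := by omega
    · refine ⟨0, ?_, ?_⟩ <;> rw [H.a_zero] <;> norm_num <;> linarith
    · refine ⟨0, ?_, ?_⟩ <;> rw [H.a_one] <;> norm_num <;> linarith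
    · have := hξ' (i - 1)
      rw [sub_add_cancel] at this
      refine ⟨i - 1, ?_, ?_⟩ <;> rw [H.a_mid i hi (by omega)]
      · linarith
      · rw [sub_add_cancel]; linarith
  · rw [hr'm]
    have key : ∀ i j : ℤ, 0 ≤ i → i < j → j < n + 1 → r'.lab i = r'.lab j → False := by
      intro i j h0 h1 h2 hij
      obtain rfl | hi : i = 0 ∨ 1 ≤ i := by omega
      · rw [H.lab_zero, H.lab_mid j (by omega) (by omega)] at hij
        exact hxx _ hij.symm
      · rw [H.lab_mid i hi (by omega), H.lab_mid j (by omega) (by omega)] at hij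
        have := hinj.eq_of_period hij (by omega) (by omega)
        omega
    intro i j h0 h1 h0' h1' hij
    rcases lt_trichotomy i j with h' | h' | h'
    · exact (key i j h0 h' h1' hij).elim
    · exact h'
    · exact (key j i h0' h' h1 hij.symm).elim
  · rw [hr'm]
    intro i h0 h1
    rw [H.bot, H.top]
    exact hfree i h0 h1
  · rw [hrm]
    intro k h0 h1 hne
    rcases eq_or_lt_of_le h0 with rfl | h0'
    · rw [zero_add] at hne ⊢
      exact Or.inl fun hf => hd (hf.mono (union_subset_union subset_union_left
          subset_union_left))
    · by_cases hkn : k = n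
      · have hz := r.lab_add 0
        rw [zero_add, hrm] at hz
        subst hkn
        rw [hz, union_comm]
        exact Or.inl fun hf => hd' (hf.mono (union_subset_union subset_union_left
          subset_union_left))
      · exact Or.inr ⟨k, Or.inl ⟨H.lab_mid k (by omega) (by omega),
          H.lab_mid _ (by omega) (by omega)⟩⟩
  · rw [hr'm]
    intro i h0 h1
    have hnext : ∀ i : ℤ, 1 ≤ i → i ≤ n → r.a i < r'.a (i + 1) ∧ r'.a (i + 1) < r.a (i + 2) := by
      intro i h0 h1
      by_cases hi : i = n
      · subst hi
        rw [H.a_last]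
        have e1 := hshift 0
        have e2 := hshift 1
        have e3 := r.a_lt n
        rw [zero_add] at e1
        rw [show (1 : ℤ) + (n + 1) = n + 2 by ring] at e2
        constructor <;> linarith
      · rw [H.a_mid _ (by omega) (by omega)]
        have e1 := hξ' i
        have e2 := r.a_lt (i + 1)
        rw [show i + 1 + 1 = i + 2 by ring] at e2
        constructor <;> linarith
    obtain rfl | rfl | hi : i = 0 ∨ i = 1 ∨ 2 ≤ i := by omega
    · right
      rw [H.lab_zero]
      refine ⟨hy, hpy, 0, ?_, ?_, Or.inl fun hf => hd'' (hf.mono ?_)⟩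
      · rw [H.a_zero]; exact hc₂
      · norm_num [H.a_one]; linarith
      · refine union_subset_union subset_union_left (subset_union_of_subset_right ?_ _)
        refine subset_iUnion₂_of_subset 0 H.lab_zero ?_
        rw [brick, H.bot, H.top, H.a_zero, zero_add, H.a_one]
    · left
      refine ⟨1, H.lab_mid 1 le_rfl (by omega), ?_, ?_, hnext 1 le_rfl (by omega)⟩ <;>
        norm_num [H.a_one] <;> linarith
    · left
      have h2 := H.a_mid i hi (by omega)
      have e1 := hξ' (i - 1)
      have e2 := r.a_lt i
      rw [sub_add_cancel] at e1
      refine ⟨i, H.lab_mid i (by omega) (by omega), ?_, ?_, hnext i (by omega) (by omega)⟩ <;>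
        rw [h2] <;> linarith

end PolarEnd

end BrickDecomposition

/-! ### The construction of a barrier: merging neighbours. -/

namespace BrickDecomposition

open Set Topology

theorem Row.exists_gap (r : Row) : ∃ g > 0, ∀ i, g < r.a (i + 1) - r.a i := by
  have hfin := (Set.finite_Ico (0 : ℤ) r.m)
  have : ∀ᶠ g in 𝓝[>] (0 : ℝ), ∀ i ∈ Ico (0 : ℤ) r.m, g < r.a (i + 1) - r.a i := by
    rw [Filter.eventually_all_finite hfin]
    intro i _
    filter_upwards [Ioo_mem_nhdsGT (sub_pos.2 (r.a_lt i))] with g hg using hg.2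
  obtain ⟨g, hg, hg0⟩ := (this.and self_mem_nhdsWithin).exists
  refine ⟨g, hg0, fun i => ?_⟩
  obtain ⟨j, k, h0, h1, rfl⟩ := r.exists_reduce i
  rw [show j + k * r.m + 1 = j + 1 + k * r.m by ring, r.a_add_mul, r.a_add_mul]
  have := hg j ⟨h0, h1⟩
  linarith

namespace PolarEnd

variable {S : Type*} [TopologicalSpace S] {h : S ≃ₜ S} {w₀ : ℝ} (E : PolarEnd h w₀)

/-- A stack of rows obtained during the construction of a barrier below the level `W`. -/
structure Game (w : ℝ) (bad : Set ℝ) (W : ℝ) (r : Row) (pc : ℕ → Set S) (old : Set ℕ) :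
    Prop where
  reach : E.Reach w bad r pc old
  stack : E.Stack r pc
  inj : r.Inj
  finite_old : old.Finite
  top_lt : r.top < W
  le_top : w₀ ≤ r.top

/-- A decrease of the number of bricks of the last row with an old label, or of the number of
bricks of this row. -/
def Progress (r : Row) (old : Set ℕ) (r' : Row) (old' : Set ℕ) : Prop :=
  (Set.range r'.lab ∩ old').ncard < (Set.range r.lab ∩ old).ncard ∨
    ((Set.range r'.lab ∩ old').ncard ≤ (Set.range r.lab ∩ old).ncard ∧ r'.m < r.m)

variable {E} {w : ℝ} {bad : Set ℝ} {W : ℝ} {r : Row} {pc : ℕ → Set S} {old : Set ℕ}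

theorem Game.shift (G : E.Game w bad W r pc old) (s : ℤ) : E.Game w bad W (r.shift s) pc old where
  reach := G.reach.shift s
  stack := G.stack.shift E s
  inj i j hij := by
    have := G.inj (i + s) (j + s) hij
    change (r.m : ℤ) ∣ j - i; simpa using this
  finite_old := G.finite_old
  top_lt := G.top_lt
  le_top := G.le_top

theorem Progress.of_shift {s : ℤ} {r' : Row} {old' : Set ℕ}
    (H : Progress (r.shift s) old r' old') : Progress r old r' old' := by
  have : Set.range (r.shift s).lab = Set.range r.lab := by
    ext l
    constructor
    · rintro ⟨i, rfl⟩; exact ⟨i + s, rfl⟩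
    · rintro ⟨i, rfl⟩; exact ⟨i - s, by simp [Row.shift]⟩
  rw [Progress, this] at H
  exact H

theorem Row.exists_reduce_lab (r : Row) {l : ℕ} (hl : l ∈ Set.range r.lab) :
    ∃ j : ℤ, 0 ≤ j ∧ j < r.m ∧ r.lab j = l := by
  obtain ⟨i, rfl⟩ := hl
  obtain ⟨j, k, h0, h1, rfl⟩ := r.exists_reduce i
  exact ⟨j, h0, h1, by rw [r.lab_add_mul]⟩

/-- Two consecutive bricks whose pieces have a free union can be merged. -/
theorem Game.progress_of_free [T2Space S] (G : E.Game w bad W r pc old) (hm : 2 ≤ r.m)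
    (hf : FreeSet h (pc (r.lab (-1)) ∪ pc (r.lab 0))) :
    ∃ r' pc' old', E.Game w bad W r' pc' old' ∧ Progress r old r' old' := by
  obtain ⟨n, hn⟩ : ∃ n, r.m = n + 1 := ⟨r.m - 1, by omega⟩
  have hnm : (r.m : ℤ) = n + 1 := by rw [hn]; push_cast; rfl
  have hl0 : r.lab (-1) = r.lab n := by
    have := r.lab_add (-1)
    rw [← this, hnm]; congr 1; ring
  have hne : r.lab 0 ≠ r.lab n := by
    intro h'
    have := G.inj.eq_of_period h' (by omega) (by omega)
    omega
  rw [hl0] at hf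
  -- The label of the brick `0` becomes that of the brick `n` preceding it, and the duplicate brick
  -- is then deleted.
  have st := G.stack.merge E hne ⟨-1, Or.inr ⟨hl0, rfl⟩⟩ hf
  obtain ⟨V, hV, hε⟩ := st.thin E
  obtain ⟨g, hg0, hg⟩ := r.exists_gap
  obtain ⟨ε, hε, hε0⟩ := (hε.and self_mem_nhdsWithin).exists
  replace hε0 : 0 < ε := hε0
  obtain ⟨ξ, hξ0, hξ1⟩ := exists_between (show 0 < min (min ε g) (W - r.top) from
    lt_min (lt_min hε0 hg0) (sub_pos.2 G.top_lt))
  rw [lt_min_iff, lt_min_iff] at hξ1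
  obtain ⟨⟨hξε, hξg⟩, hξW⟩ := hξ1
  have hg0' := hg 0
  rw [zero_add] at hg0'
  have hrel : ∀ i : ℤ, 1 ≤ i → i ≤ n → relabel (r.lab 0) (r.lab n) (r.lab i) = r.lab i := by
    intro i h1 h2
    rw [relabel, if_neg]
    intro h'
    have := G.inj.eq_of_period h' (by omega) (by omega)
    omega
  obtain ⟨r', H⟩ := exists_isDelete (r := r.map (relabel (r.lab 0) (r.lab n))) (n := n) (T := ξ)
    (c := r.a 1 - ξ) (ξ := ξ) hn (by omega) hξ0 hξ0 (fun i => hξg.trans (hg i))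
    (show r.a 0 < r.a 1 - ξ by linarith) (show r.a 1 - ξ < r.a 1 by linarith)
  have hright : ∀ i : ℤ, 0 ≤ i → i < n → r'.a (i + 1) = r.a (i + 2) - ξ ∨
      (i + 1 = n ∧ r'.a (i + 1) = r.a (n + 2) - ξ) := by
    intro i h0 h1
    by_cases hi : i + 1 = n
    · right
      rw [hi, H.a_last]
      have := r.a_add 1
      rw [hnm, show (1 : ℤ) + (n + 1) = n + 2 by ring] at this
      exact ⟨rfl, by rw [this]; ring⟩
    · left
      rw [H.a_mid _ (by omega) (by omega)]
      rw [show i + 1 + 1 = i + 2 by ring]; rfl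
  have hleft : ∀ i : ℤ, 0 ≤ i → i < n → r'.a i = r.a (i + 1) - ξ := by
    intro i h0 h1
    by_cases hi : i = 0
    · subst hi; rw [H.a_zero, zero_add]
    · rw [H.a_mid i (by omega) h1]; rfl
  have key := st.delete H (by
    intro i j h1 h2 h3 h4 hij
    change relabel _ _ (r.lab i) = relabel _ _ (r.lab j) at hij
    rw [hrel i h1 h2, hrel j h3 h4] at hij
    exact G.inj.eq_of_period hij (by omega) (by omega)) (by
    right; left
    change relabel _ _ (r.lab 0) = relabel _ _ (r.lab n)
    rw [hrel n (by omega) le_rfl, relabel, if_pos rfl]) (by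
    intro i h0 h1
    refine (hV ((r.map (relabel (r.lab 0) (r.lab n))).lab (i + 1))).1.mono
      (union_subset (hV _).2 ?_)
    rcases hright i h0 h1 with h2 | ⟨h2, h3⟩
    · refine subset_trans (E.box_mono ?_ ?_ ?_ ?_) (hε (i + 1))
      · linarith
      · linarith
      · rw [hleft i h0 h1]; change r.a (i + 1) - ε ≤ _; linarith
      · rw [h2]; change _ ≤ r.a (i + 1 + 1) + ε
        rw [show i + 1 + 1 = i + 2 by ring]; linarith
    -- The last brick of the new row lies over two bricks of `r`, namely `n` and the translate `n +
    -- 1` of `0`. They carry the same label after the merge, so the thin boxes over both of them lie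
    -- in the same free neighbourhood.
    · have e1 := hε n
      have e2 := hε (n + 1)
      have e3 : (r.map (relabel (r.lab 0) (r.lab n))).lab (n + 1) =
          (r.map (relabel (r.lab 0) (r.lab n))).lab n := by
        change relabel _ _ (r.lab (n + 1)) = relabel _ _ (r.lab n)
        have := r.lab_add 0
        rw [hnm, zero_add] at this
        rw [this, hrel n (by omega) le_rfl, relabel, if_pos rfl]
      rw [e3] at e2
      rw [h2]
      rintro _ ⟨⟨v, θ⟩, ⟨hv, hθ⟩, rfl⟩
      change v ∈ Icc r.top (r.top + ξ) at hv
      rw [h2] at h3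
      rw [hleft i h0 h1, h2, h3] at hθ
      have hv' : v ∈ Icc (r.top - ε) (r.top + ε) :=
        ⟨by linarith [hv.1], by linarith [hv.2]⟩
      rcases le_total θ (r.a (n + 1)) with h4 | h4
      · exact e1 (E.mem_box_of hv' ⟨by change r.a n - ε ≤ θ; linarith [hθ.1],
          by change θ ≤ r.a (n + 1) + ε; linarith⟩)
      · exact e2 (E.mem_box_of hv' ⟨by change r.a (n + 1) - ε ≤ θ; linarith [hθ.1],
          by
            change θ ≤ r.a (n + 1 + 1) + ε
            rw [show (n : ℤ) + 1 + 1 = n + 2 by ring]; linarith [hθ.2]⟩))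
  obtain ⟨ho, hI, st'⟩ := key
  refine ⟨r', _, relabel (r.lab 0) (r.lab n) '' old, ⟨(G.reach.merge hne).push ho, st', hI,
    G.finite_old.image _, ?_, ?_⟩, Or.inr ⟨?_, ?_⟩⟩
  · rw [H.top]; change r.top + ξ < W; linarith
  · rw [H.top]; change w₀ ≤ r.top + ξ; linarith [G.le_top]
  · have hfin := (finite_range_lab r).inter_of_left old
    -- Both `old` and the labels are relabelled: an old label of the new row is the image of an old
    -- label of `r`, so their number does not increase.
    refine le_trans (Set.ncard_le_ncard (t := relabel (r.lab 0) (r.lab n) ''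
      (Set.range r.lab ∩ old)) ?_ (hfin.image _)) (Set.ncard_image_le hfin)
    rintro l ⟨hl, l', hl', rfl⟩
    refine ⟨l', ⟨?_, hl'⟩, rfl⟩
    obtain ⟨j, hj0, hj1, hj⟩ := Row.exists_reduce_lab r' hl
    rw [H.m] at hj1
    rw [H.lab j hj0 hj1] at hj
    change relabel _ _ (r.lab (j + 1)) = _ at hj
    rw [hrel _ (by omega) (by omega), relabel] at hj
    split_ifs at hj with h3
    · exact ⟨0, h3.symm⟩
    · exact ⟨_, hj⟩
  · rw [H.m, hn]; omega

end PolarEnd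

end BrickDecomposition

/-! ### The construction of a barrier: prolonging a piece, and its first conflict. -/

namespace BrickDecomposition

open Set Topology

namespace PolarEnd

variable {S : Type*} [TopologicalSpace S] {h : S ≃ₜ S} {w₀ : ℝ} {E : PolarEnd h w₀}
  {w : ℝ} {bad : Set ℝ} {W : ℝ} {r : Row} {pc : ℕ → Set S} {old : Set ℕ}

theorem Progress.of_subset {r' : Row} (h1 : Set.range r'.lab ∩ old ⊆ Set.range r.lab ∩ old)
    (h2 : r'.m < r.m) : Progress r old r' old :=
  Or.inr ⟨Set.ncard_le_ncard h1 ((finite_range_lab r).inter_of_left old), h2⟩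

/-- When no two consecutive pieces can be merged, a brick over which its predecessor can be
prolonged may be deleted. -/
theorem Game.progress_of_arc [T2Space S] (G : E.Game w bad W r pc old) (hm : 2 ≤ r.m)
    (hno : ∀ k, ¬ FreeSet h (pc (r.lab k) ∪ pc (r.lab (k + 1))))
    (harc : ∀ c < r.a 1, FreeSet h (pc (r.lab (-1)) ∪ E.box r.top r.top (r.a 0) c)) :
    ∃ r' pc' old', E.Game w bad W r' pc' old' ∧ Progress r old r' old' := by
  obtain ⟨n, hn⟩ : ∃ n, r.m = n + 1 := ⟨r.m - 1, by omega⟩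
  have hnm : (r.m : ℤ) = n + 1 := by rw [hn]; push_cast; rfl
  have hl0 : r.lab (-1) = r.lab n := by
    have := r.lab_add (-1)
    rw [← this, hnm]; congr 1; ring
  have hlast : r.a (n + 1) = r.a 0 + 1 := by
    have := r.a_add 0
    rwa [hnm, zero_add] at this
  have st := G.stack
  rw [hl0] at harc
  have h01 := r.a_lt 0
  rw [zero_add] at h01
  obtain ⟨V, hV, hε⟩ := st.thin E
  obtain ⟨g, hg0, hg⟩ := r.exists_gap
  obtain ⟨ε, hε, hε0⟩ := (hε.and self_mem_nhdsWithin).exists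
  replace hε0 : 0 < ε := hε0
  -- The predecessor is prolonged up to `c`, so close to `r.a 1` that the next brick covers the rest
  -- by moving its left end by less than `ε`.
  obtain ⟨c, hc1, hc2⟩ := exists_between (show max (r.a 0) (r.a 1 - ε) < r.a 1 from
    max_lt h01 (by linarith))
  rw [max_lt_iff] at hc1
  -- If `n = 1`, the predecessor and the successor of the deleted brick are the same brick, and the
  -- single remaining brick goes all the way round, from `c` to `c + 1`.
  set L : ℝ := if n = 1 then c else r.a n with hL
  have hLc : L ≤ c + 1 := by
    rw [hL]; split_ifs
    · linarith
    · have := r.a_lt n; linarith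
  -- Every point of the prolonged arc lies in the piece prolonged up to some `c' < r.a 1`. Two
  -- points of it lie in a common such set, which is free by `harc`.
  have hcov : ∀ x ∈ pc (r.lab n) ∪ E.box r.top r.top L (c + 1), ∃ c' < r.a 1,
      x ∈ pc (r.lab n) ∪ E.box r.top r.top (r.a 0) c' := by
    rintro x (hx | ⟨⟨v, θ⟩, ⟨hv, hθ⟩, rfl⟩)
    · exact ⟨c, hc2, Or.inl hx⟩
    obtain rfl : v = r.top := le_antisymm hv.2 hv.1
    by_cases h1 : r.a (n + 1) ≤ θ
    · refine ⟨c, hc2, Or.inr (E.mem_box.2 ⟨hv, -1, ?_⟩)⟩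
      push_cast
      exact ⟨by linarith, by linarith [hθ.2]⟩
    by_cases h2 : r.a n ≤ θ
    · exact ⟨c, hc2, Or.inl (st.arc n θ ⟨h2, le_of_not_ge h1⟩)⟩
    have h3 : n = 1 := by
      by_contra h3
      rw [hL, if_neg h3] at hθ
      exact h2 hθ.1
    subst h3
    rw [hL, if_pos rfl] at hθ
    refine ⟨θ, lt_of_not_ge (by simpa using h2), Or.inr (E.mem_box_of hv ⟨?_, le_rfl⟩)⟩
    exact hc1.1.le.trans hθ.1
  have hfreeK : FreeSet h (pc (r.lab n) ∪ E.box r.top r.top L (c + 1)) := by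
    intro x hx hx'
    obtain ⟨c1, hc1, h1⟩ := hcov x hx
    obtain ⟨c2, hc2, h2⟩ := hcov _ hx'
    refine harc (max c1 c2) (max_lt hc1 hc2) x ?_ ?_
    · exact union_subset_union_right _ (E.box_mono le_rfl le_rfl le_rfl (le_max_left _ _)) h1
    · exact union_subset_union_right _ (E.box_mono le_rfl le_rfl le_rfl (le_max_right _ _)) h2
  obtain ⟨V', hV'o, hKV', hV'⟩ :=
    hfreeK.exists_isOpen ((st.compact _).union (E.isCompact_box _ _ _ _))
  obtain ⟨ε', hε', hε'0⟩ := ((E.eventually_box_subset hV'o le_rfl hLc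
    (subset_union_right.trans hKV')).and self_mem_nhdsWithin).exists
  replace hε'0 : 0 < ε' := hε'0
  obtain ⟨ξ, hξ0, hξ1⟩ := exists_between (show 0 < min (min ε ε') (min g (W - r.top)) from
    lt_min (lt_min hε0 hε'0) (lt_min hg0 (sub_pos.2 G.top_lt)))
  rw [lt_min_iff, lt_min_iff, lt_min_iff] at hξ1
  obtain ⟨⟨hξε, hξε'⟩, hξg, hξW⟩ := hξ1
  obtain ⟨r', H⟩ := exists_isDelete (r := r) (n := n) (T := ξ)
    (c := c) (ξ := ξ) hn (by omega) hξ0 hξ0 (fun i => hξg.trans (hg i)) hc1.1 hc2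
  have key := st.delete H
    (fun i j h1 h2 h3 h4 hij => G.inj.eq_of_period hij (by omega) (by omega))
    (Or.inr (Or.inr ⟨by simpa using hno 0, by
      have := hno (-1)
      rwa [hl0, union_comm] at this⟩)) (by
    intro i h0 h1
    by_cases hi : i + 1 = n
    · rw [hi]
      refine hV'.mono (union_subset (subset_union_left.trans hKV')
        ((E.box_mono ?_ ?_ ?_ ?_).trans hε'))
      · linarith
      · linarith
      · by_cases hi0 : i = 0
        · subst hi0
          rw [H.a_zero, hL, if_pos (by omega)]; linarith
        · rw [H.a_mid i (by omega) h1, hL, if_neg (by omega), hi]; linarith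
      · rw [H.a_last]; linarith
    · refine (hV (r.lab (i + 1))).1.mono (union_subset (hV _).2
        ((E.box_mono ?_ ?_ ?_ ?_).trans (hε (i + 1))))
      · linarith
      · linarith
      · by_cases hi0 : i = 0
        · subst hi0
          rw [H.a_zero, zero_add]; linarith
        · rw [H.a_mid i (by omega) h1]; linarith
      · rw [H.a_mid _ (by omega) (by omega)]; linarith)
  obtain ⟨ho, hI, st'⟩ := key
  refine ⟨r', _, old, ⟨G.reach.push ho, st', hI, G.finite_old, ?_, ?_⟩,
    Progress.of_subset ?_ ?_⟩
  · rw [H.top]; linarith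
  · rw [H.top]; linarith [G.le_top]
  · rintro l ⟨hl, hl'⟩
    refine ⟨?_, hl'⟩
    obtain ⟨j, hj0, hj1, rfl⟩ := Row.exists_reduce_lab r' hl
    rw [H.m] at hj1
    rw [H.lab j hj0 hj1]
    exact ⟨_, rfl⟩
  · rw [H.m, hn]; omega

/-- The first non-free set among the sets obtained by prolonging a free set along a strip. -/
theorem exists_critical [T2Space S] {K : Set S} (hK : IsCompact K) {u v lam β c₀ : ℝ}
    (huv : u ≤ v) (hlam : lam ≤ β)
    (hβ : FreeSet h (K ∪ E.box u v lam β)) (hc₀ : ¬ FreeSet h (K ∪ E.box u v lam c₀))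
    (hE : ∀ s, FreeSet h (E.box u v s s)) :
    ∃ s, β < s ∧ s ≤ c₀ ∧ (∀ s' < s, FreeSet h (K ∪ E.box u v lam s')) ∧
      ∃ e ∈ E.box u v s s, ∃ s₁ < s, ∃ p ∈ K ∪ E.box u v lam s₁, h e = p ∨ h p = e := by
  set A : ℝ → Set S := fun s => K ∪ E.box u v lam s with hA
  have hmono : ∀ {s t}, s ≤ t → A s ⊆ A t := fun hst =>
    union_subset_union_right _ (E.box_mono le_rfl le_rfl le_rfl hst)
  set B : Set ℝ := {s | ¬ FreeSet h (A s)} with hB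
  have hc₀B : c₀ ∈ B := hc₀
  have hup : ∀ s t, s ∈ B → s ≤ t → t ∈ B := fun s t hs hst hf => hs (hf.mono (hmono hst))
  have hbelow : ∀ s ∈ B, β < s := fun s hs => lt_of_not_ge fun hle => hup s β hs hle hβ
  have hbdd : BddBelow B := ⟨β, fun s hs => (hbelow s hs).le⟩
  have hlt : ∀ s' < sInf B, FreeSet h (A s') := by
    intro s' hs'
    by_contra hcon
    exact absurd (csInf_le hbdd hcon) (not_le.2 hs')
  -- If the set were free at the infimum, compactness would give a free open neighbourhood, and the
  -- prolongation would remain free slightly further.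
  have hmem : sInf B ∈ B := by
    intro hf
    have hle : lam ≤ sInf B :=
      hlam.trans (le_csInf ⟨c₀, hc₀B⟩ fun s hs => (hbelow s hs).le)
    obtain ⟨V, hV, hKV, hVf⟩ := hf.exists_isOpen (hK.union (E.isCompact_box _ _ _ _))
    obtain ⟨ε, hε, hε0⟩ := ((E.eventually_box_subset hV huv hle
      (subset_union_right.trans hKV)).and self_mem_nhdsWithin).exists
    replace hε0 : 0 < ε := hε0
    obtain ⟨s, hs, hs'⟩ := exists_lt_of_csInf_lt ⟨c₀, hc₀B⟩ (show sInf B < sInf B + ε by linarith)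
    refine hs (hVf.mono (union_subset (subset_union_left.trans hKV) ?_))
    exact (E.box_mono (by linarith) (by linarith) (by linarith) hs'.le).trans hε
  have hcov : ∀ x ∈ A (sInf B), x ∈ E.box u v (sInf B) (sInf B) ∨ ∃ s < sInf B, x ∈ A s := by
    rintro x (hx | ⟨⟨y, θ⟩, ⟨hy, hθ⟩, rfl⟩)
    · exact Or.inr ⟨β, hbelow _ hmem, Or.inl hx⟩
    · rcases hθ.2.eq_or_lt with h1 | h1
      · exact Or.inl (E.mem_box_of hy ⟨h1.ge, h1.le⟩)
      · exact Or.inr ⟨θ, h1, Or.inr (E.mem_box_of hy ⟨hθ.1, le_rfl⟩)⟩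
  refine ⟨sInf B, hbelow _ hmem, csInf_le hbdd hc₀B, hlt, ?_⟩
  -- At least one of the two points in conflict is on the final segment, since the shorter
  -- prolongations are free; not both are, since the segment itself is free.
  obtain ⟨x, hx, hx'⟩ := not_freeSet.1 hmem
  rcases hcov x hx with h1 | ⟨s, hs, h1⟩ <;> rcases hcov _ hx' with h2 | ⟨s', hs', h2⟩
  · exact (hE _ x h1 h2).elim
  · exact ⟨x, h1, s', hs', _, h2, Or.inl rfl⟩
  · exact ⟨_, h2, s, hs, x, h1, Or.inr rfl⟩
  · exact (hlt (max s s') (max_lt hs hs') x (hmono (le_max_left _ _) h1)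
      (hmono (le_max_right _ _) h2)).elim

/-- The last contact of a short vertical segment with an arc of its upper level. -/
theorem exists_contact [T2Space S] {u v P s : ℝ} (huv : u ≤ v) (hPs : P < s)
    (hE : FreeSet h (E.box u v s s)) :
    ∃ c, P ≤ c ∧ c < s ∧ (∀ θ ∈ Icc c s, ∀ e ∈ E.box u v s s,
        h e ≠ E.Φ (v, θ) ∧ h (E.Φ (v, θ)) ≠ e) ∧
      (c = P ∨ ∃ y, P ≤ y ∧ y < c ∧ ∃ x ∈ Icc u v,
        h (E.Φ (x, s)) = E.Φ (v, y) ∨ h (E.Φ (v, y)) = E.Φ (x, s)) := by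
  -- The angles of the points of the upper level which are images or preimages of points of the
  -- segment.
  set Y : Set ℝ := Icc P s ∩ (fun θ => E.Φ (v, θ)) ⁻¹'
    (h '' E.box u v s s ∪ h ⁻¹' E.box u v s s) with hY
  have hcont : Continuous fun θ => E.Φ (v, θ) := E.continuous.comp (by fun_prop)
  have hYc : IsCompact Y := by
    refine isCompact_Icc.inter_right (IsClosed.preimage hcont ?_)
    exact ((E.isCompact_box _ _ _ _).image h.continuous).isClosed.union
      ((E.isCompact_box _ _ _ _).isClosed.preimage h.continuous)
  have hnot : ∀ θ ∈ Icc P s, θ ∉ Y → ∀ e ∈ E.box u v s s,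
      h e ≠ E.Φ (v, θ) ∧ h (E.Φ (v, θ)) ≠ e := by
    refine fun θ hθ hθY e he => ⟨fun h' => hθY ⟨hθ, Or.inl ⟨e, he, h'⟩⟩, fun h' => ?_⟩
    refine hθY ⟨hθ, Or.inr ?_⟩
    change h (E.Φ (v, θ)) ∈ E.box u v s s
    rwa [h']
  rcases Y.eq_empty_or_nonempty with he | hne
  · refine ⟨P, le_rfl, hPs, fun θ hθ => hnot θ hθ (by simp [he]), Or.inl rfl⟩
  obtain ⟨y, hyY, hymax⟩ := hYc.exists_isGreatest hne
  have hys : y < s := by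
    refine lt_of_le_of_ne hyY.1.2 ?_
    -- The point at angle `s` of the upper level belongs to the segment, which is free; hence the
    -- last contact occurs strictly before `s`.
    rintro rfl
    have hin : E.Φ (v, y) ∈ E.box u v y y := E.mem_box_of ⟨huv, le_rfl⟩ ⟨le_rfl, le_rfl⟩
    rcases hyY.2 with ⟨e, he, h'⟩ | h'
    · refine hE e he ?_
      rw [h']; exact hin
    · exact hE _ hin h'
  -- Taking `c` strictly after the last contact leaves the arc from `c` to `s` without contact, and
  -- the contact `y` itself strictly before `c`.
  obtain ⟨c, hc1, hc2⟩ := exists_between hys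
  refine ⟨c, hyY.1.1.trans hc1.le, hc2, fun θ hθ => hnot θ ⟨?_, hθ.2⟩ fun hθY => ?_,
    Or.inr ⟨y, hyY.1.1, hc1, ?_⟩⟩
  · exact (hyY.1.1.trans hc1.le).trans hθ.1
  · exact absurd (hymax hθY) (not_le.2 (hc1.trans_le hθ.1))
  · rcases hyY.2 with ⟨_, ⟨⟨x, θ⟩, ⟨hx, hθ⟩, rfl⟩, h'⟩ | ⟨⟨x, θ⟩, ⟨hx, hθ⟩, h'⟩
    · obtain rfl : θ = s := le_antisymm hθ.2 hθ.1
      exact ⟨x, hx, Or.inl h'⟩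
    · obtain rfl : θ = s := le_antisymm hθ.2 hθ.1
      exact ⟨x, hx, Or.inr h'.symm⟩

/-- A contact of the critical segment with a point of the upper level is followed by contacts
above this level. -/
theorem exists_contact_above {K : Set S} {u v lam s c₂ c y x η : ℝ} (huv : u < v)
    (hlam : lam ≤ c₂) (hc₂ : c₂ < y) (hyc : y < c) (hcs : c < s)
    (hfree : ∀ s' < s, FreeSet h (K ∪ E.box u v lam s')) (hx : x ∈ Icc u v)
    (hlink : h (E.Φ (x, s)) = E.Φ (v, y) ∨ h (E.Φ (v, y)) = E.Φ (x, s)) (hη : 0 < η) :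
    ∃ s₂ < s, ∃ p ∈ K ∪ E.box u v lam s₂, ∃ q ∈ E.box v (v + η) c₂ c, h p = q ∨ h q = p := by
  set N : Set (ℝ × ℝ) := Ioo u (v + η) ×ˢ Ioo c₂ c with hN
  have hNo : IsOpen (E.Φ '' N) := E.isOpenMap _ (isOpen_Ioo.prod isOpen_Ioo)
  have hyN : E.Φ (v, y) ∈ E.Φ '' N := ⟨_, ⟨⟨huv, by linarith⟩, hc₂, hyc⟩, rfl⟩
  -- The contact may be realised by `h` or by its inverse; `g` is whichever sends the segment point
  -- to the point of the upper level.
  obtain ⟨g, hg, hgl⟩ : ∃ g : S → S, Continuous g ∧ g (E.Φ (x, s)) = E.Φ (v, y) ∧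
      ∀ a b, g a = b → h a = b ∨ h b = a := by
    rcases hlink with h' | h'
    · exact ⟨h, h.continuous, h', fun a b hab => Or.inl hab⟩
    · refine ⟨h.symm, h.symm.continuous, by rw [← h', h.symm_apply_apply], fun a b hab => ?_⟩
      right; rw [← hab, h.apply_symm_apply]
  have hcont : Continuous fun θ => g (E.Φ (x, θ)) :=
    hg.comp (E.continuous.comp (by fun_prop))
  have hev : ∀ᶠ θ in 𝓝[<] s, g (E.Φ (x, θ)) ∈ E.Φ '' N := by
    apply hcont.continuousAt.continuousWithinAt
    exact hNo.mem_nhds (by beta_reduce; rw [hgl.1]; exact hyN)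
  obtain ⟨s₂, ⟨⟨v', θ⟩, ⟨hv', hθ⟩, hs₂⟩, hs₂'⟩ := (hev.and (Ioo_mem_nhdsLT hcs)).exists
  have hp : E.Φ (x, s₂) ∈ K ∪ E.box u v lam s₂ :=
    Or.inr (E.mem_box_of hx ⟨by linarith [hs₂'.1], le_rfl⟩)
  have hl := hgl.2 _ _ hs₂.symm
  refine ⟨s₂, hs₂'.2, _, hp, E.Φ (v', θ), ?_, hl⟩
  refine E.mem_box_of ⟨?_, hv'.2.le⟩ ⟨hθ.1.le, hθ.2.le⟩
  -- The segment point is moved to a slightly smaller angle `s₂`, and its partner follows by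
  -- continuity. If the partner were below the level `v`, both would lie in the piece prolonged up
  -- to `s₂`, which is free. So it lies above, in any brick placed there.
  by_contra hcon
  have hq : E.Φ (v', θ) ∈ K ∪ E.box u v lam s₂ := by
    refine Or.inr (E.mem_box_of ⟨hv'.1.le, (not_le.1 hcon).le⟩ ⟨?_, ?_⟩)
    · linarith [hθ.1]
    · linarith [hθ.2, hs₂'.1]
  have hf := hfree s₂ hs₂'.2
  rcases hl with h' | h'
  · exact hf _ hp (by rw [h']; exact hq)
  · exact hf _ hq (by rw [h']; exact hp)

/-- Boxes of small size over a compact set of levels are free. -/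
theorem exists_small [T2Space S] (E : PolarEnd h w₀) {u₁ u₂ : ℝ} (hu : w₀ ≤ u₁) :
    ∃ δ > 0, ∀ u v a b, u₁ ≤ u → v ≤ u₂ → v - u ≤ δ → b - a ≤ δ →
      FreeSet h (E.box u v a b) := by
  have hK : IsCompact (Icc u₁ u₂ ×ˢ Icc (0 : ℝ) 1) := isCompact_Icc.prod isCompact_Icc
  have hloc : ∀ z ∈ Icc u₁ u₂ ×ˢ Icc (0 : ℝ) 1, ∃ N : Set (ℝ × ℝ), IsOpen N ∧ z ∈ N ∧
      FreeSet h (E.Φ '' N) := by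
    rintro ⟨u, θ⟩ ⟨hu', -⟩
    have hf : FreeSet h {E.Φ (u, θ)} := by
      intro x hx hx'
      rw [mem_singleton_iff] at hx hx'
      subst hx
      exact E.nofix u θ (hu.trans hu'.1) hx'
    obtain ⟨V, hV, hsub, hVf⟩ := hf.exists_isOpen isCompact_singleton
    exact ⟨E.Φ ⁻¹' V, hV.preimage E.continuous, hsub rfl, hVf.mono (image_preimage_subset _ _)⟩
  choose! N hNo hNm hNf using hloc
  -- A Lebesgue number for a cover of one period by open sets with free images; other boxes are
  -- translated into this period by `⌊a⌋`.
  obtain ⟨δ, hδ, hδ'⟩ := lebesgue_number_lemma_of_metric (c := fun z : (Icc u₁ u₂ ×ˢ Icc (0:ℝ) 1 :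
    Set (ℝ × ℝ)) => N z) hK (fun z => hNo z z.2) (fun z hz => mem_iUnion.2 ⟨⟨z, hz⟩, hNm z hz⟩)
  refine ⟨δ / 2, by positivity, fun u v a b hu' hv' huv hab => ?_⟩
  by_cases hle : u ≤ v ∧ a ≤ b
  · set k : ℤ := ⌊a⌋
    have e1 := Int.floor_le a
    have e2 := Int.lt_floor_add_one a
    obtain ⟨⟨z, hz⟩, hball⟩ := hδ' (u, a - k) ⟨⟨hu', hle.1.trans hv'⟩, by linarith, by linarith⟩
    refine (hNf z hz).mono ?_
    have := E.box_add_int u v (a - k) (b - k) k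
    rw [sub_add_cancel, sub_add_cancel] at this
    rw [this]
    refine image_mono fun q hq => hball ?_
    rw [Metric.mem_ball, Prod.dist_eq, max_lt_iff, Real.dist_eq, Real.dist_eq]
    obtain ⟨⟨h1, h2⟩, h3, h4⟩ := hq
    constructor
    · rw [abs_of_nonneg (by linarith)]; linarith
    · rw [abs_of_nonneg (by simp only; linarith)]; simp only; linarith
  · have : E.box u v a b = ∅ := by
      rw [box]
      rcases not_and_or.1 hle with h1 | h1
      · rw [Icc_eq_empty h1, empty_prod, image_empty]
      · rw [Icc_eq_empty h1, prod_empty, image_empty]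
    rw [this]
    exact freeSet_empty

end PolarEnd

end BrickDecomposition

/-! ### The construction of a barrier: burying an old brick. -/

namespace BrickDecomposition

open Set Topology

namespace PolarEnd

variable {S : Type*} [TopologicalSpace S] {h : S ≃ₜ S} {w₀ : ℝ} {E : PolarEnd h w₀}
  {w : ℝ} {bad : Set ℝ} {W : ℝ} {r : Row} {pc : ℕ → Set S} {old : Set ℕ}

theorem Game.exists_fresh (G : E.Game w bad W r pc old) (F : Set ℕ) (hF : F.Finite) :
    ∃ x, x ∉ F ∧ x ∉ old ∧ x ∉ Set.range r.lab ∧ pc x = ∅ := by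
  obtain ⟨b, hb⟩ := G.stack.fin
  obtain ⟨x, hx⟩ := ((hF.union G.finite_old).union
    ((finite_range_lab r).union (Set.finite_Iio b))).infinite_compl.nonempty
  simp only [mem_compl_iff, mem_union, not_or, mem_Iio, not_lt] at hx
  exact ⟨x, hx.1.1, hx.1.2, hx.2.1, hb x hx.2.2⟩

theorem not_freeSet_of_link {A : Set S} {x y : S} (hx : x ∈ A) (hy : y ∈ A)
    (hl : h x = y ∨ h y = x) : ¬ FreeSet h A := by
  rcases hl with rfl | rfl
  · exact fun hf => hf x hx hy
  · exact fun hf => hf y hy hx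

/-- An old brick over which a neighbour cannot be prolonged to the end of the next brick can be
surrounded by new bricks. -/
theorem Game.progress_of_run [T2Space S] (G : E.Game w bad W r pc old) (hm : 2 ≤ r.m)
    (hno : ∀ k, ¬ FreeSet h (pc (r.lab k) ∪ pc (r.lab (k + 1)))) (hold : r.lab 0 ∈ old)
    (hrun : ∃ c < r.a 2, ¬ FreeSet h (pc (r.lab 0) ∪ E.box r.top r.top (r.a 1) c)) :
    ∃ r' pc' old', E.Game w bad W r' pc' old' ∧ Progress r old r' old' := by
  obtain ⟨c₀, hc₀, hc₀f⟩ := hrun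
  have st := G.stack
  have h01 := r.a_lt 0
  rw [zero_add] at h01
  have h12 := r.a_lt 1
  norm_num at h12
  -- choice of the size of the first row
  obtain ⟨V, hV, hε⟩ := st.thin E
  obtain ⟨g, hg0, hg⟩ := r.exists_gap
  obtain ⟨ε, hε, hε0⟩ := (hε.and self_mem_nhdsWithin).exists
  replace hε0 : 0 < ε := hε0
  obtain ⟨δ, hδ0, hδ⟩ := exists_small E (u₂ := W) G.le_top
  obtain ⟨ξ, hξ0, hξ1⟩ := exists_between (show 0 < min (min (ε / 2) (r.a 2 - c₀))
    (min (min g δ) (W - r.top)) from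
    lt_min (lt_min (by linarith) (by linarith)) (lt_min (lt_min hg0 hδ0) (sub_pos.2 G.top_lt)))
  simp only [lt_min_iff] at hξ1
  obtain ⟨⟨hξε, hξc⟩, ⟨hξg, hξδ⟩, hξW⟩ := hξ1
  have hξ' : ∀ i, ξ < r.a (i + 1) - r.a i := fun i => hξg.trans (hg i)
  obtain ⟨v, hv⟩ : ∃ v, v = r.top + ξ := ⟨_, rfl⟩
  obtain ⟨lam, hlam⟩ : ∃ lam, lam = r.a 0 - ξ := ⟨_, rfl⟩
  have huv : r.top < v := by linarith
  have hboxV : ∀ i a b u' v', r.a i - ε ≤ a → b ≤ r.a (i + 1) + ε → r.top - ε ≤ u' →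
      v' ≤ r.top + ε → E.box u' v' a b ⊆ V (r.lab i) := fun i a b u' v' h1 h2 h3 h4 =>
    (E.box_mono h3 h4 h1 h2).trans (hε i)
  -- the critical segment
  have hAβ : FreeSet h (pc (r.lab 0) ∪ E.box r.top v lam (r.a 1)) := by
    refine (hV (r.lab 0)).1.mono (union_subset (hV _).2 (hboxV 0 _ _ _ _ ?_ ?_ ?_ ?_))
    all_goals first | linarith | (norm_num; linarith)
  have hAc₀ : ¬ FreeSet h (pc (r.lab 0) ∪ E.box r.top v lam c₀) := by
    refine fun hf => hc₀f (hf.mono (union_subset_union_right _ (E.box_mono le_rfl ?_ ?_ le_rfl)))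
      <;> linarith
  have hEf : ∀ s, FreeSet h (E.box r.top v s s) := fun s =>
    hδ _ _ _ _ le_rfl (by linarith) (by linarith) (by linarith)
  -- The angle `s` is the first one at which the prolongation of the old piece over the brick `1`
  -- stops being free. The conflict joins a point `e` of the segment over `s` to a point `p` of a
  -- shorter prolongation. A new brick containing that segment is therefore not mergeable with the
  -- old piece stopped just before `s`.
  obtain ⟨s, hs1, hs2, hsf, e, he, s₁, hs₁, p, hp, hep⟩ :=
    exists_critical (st.compact _) huv.le (by linarith) hAβ hAc₀ hEf
  -- room for the previous brick
  have hKC : FreeSet h (pc (r.lab (-1)) ∪ E.box r.top v (r.a (-1) - ξ) lam) := by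
    refine (hV (r.lab (-1))).1.mono (union_subset (hV _).2 (hboxV (-1) _ _ _ _ ?_ ?_ ?_ ?_))
    all_goals first | linarith | (norm_num; linarith)
  obtain ⟨VC, hVCo, hKVC, hVCf⟩ :=
    hKC.exists_isOpen ((st.compact _).union (E.isCompact_box _ _ _ _))
  have hm10 := r.a_lt (-1)
  norm_num at hm10
  obtain ⟨ζ', hζ', hζ'0⟩ := ((E.eventually_box_subset hVCo huv.le (by linarith)
    (subset_union_right.trans hKVC)).and self_mem_nhdsWithin).exists
  replace hζ'0 : 0 < ζ' := hζ'0
  obtain ⟨ζ, hζ0, hζ1⟩ := exists_between (show 0 < min ζ' (r.a 1 - lam) from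
    lt_min hζ'0 (by linarith))
  rw [lt_min_iff] at hζ1
  -- contacts
  obtain ⟨c, hPc, hcs, hnc, hcase⟩ := exists_contact (E := E) (P := lam + ζ) huv.le
    (show lam + ζ < s by linarith) (hEf s)
  -- The new brick may be continued leftwards along the upper level as far as `c`: the segment has
  -- no contact with this arc, and the part of the arc before `s` lies in free prolongations of the
  -- old piece.
  have hKX : FreeSet h (E.box r.top v s s ∪ E.box v v c s) := by
    have hsplit : ∀ x ∈ E.box v v c s, x ∈ E.box r.top v s s ∨
        ∃ s' < s, x ∈ pc (r.lab 0) ∪ E.box r.top v lam s' := by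
      rintro _ ⟨⟨y, θ⟩, ⟨hy, hθ⟩, rfl⟩
      obtain rfl : y = v := le_antisymm hy.2 hy.1
      rcases hθ.2.eq_or_lt with h1 | h1
      · exact Or.inl (E.mem_box_of ⟨huv.le, le_rfl⟩ ⟨h1.ge, h1.le⟩)
      · exact Or.inr ⟨θ, h1, Or.inr (E.mem_box_of ⟨huv.le, le_rfl⟩ ⟨by linarith [hθ.1], le_rfl⟩)⟩
    have hncE : ∀ x ∈ E.box v v c s, ∀ e ∈ E.box r.top v s s, h e ≠ x ∧ h x ≠ e := by
      rintro _ ⟨⟨y, θ⟩, ⟨hy, hθ⟩, rfl⟩ e he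
      obtain rfl : y = v := le_antisymm hy.2 hy.1
      exact hnc θ hθ e he
    rintro x (hx | hx) (hx' | hx')
    · exact hEf s x hx hx'
    · exact (hncE _ hx' x hx).1 rfl
    · exact (hncE _ hx _ hx').2 rfl
    · rcases hsplit x hx with h1 | ⟨s', hs', h1⟩
      · exact (hncE _ hx' x h1).1 rfl
      rcases hsplit _ hx' with h2 | ⟨s'', hs'', h2⟩
      · exact (hncE _ hx _ h2).2 rfl
      refine hsf (max s' s'') (max_lt hs' hs'') x ?_ ?_
      · exact union_subset_union_right _
          (E.box_mono le_rfl le_rfl le_rfl (le_max_left _ _)) h1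
      · exact union_subset_union_right _
          (E.box_mono le_rfl le_rfl le_rfl (le_max_right _ _)) h2
  obtain ⟨VX, hVXo, hKVX, hVXf⟩ :=
    hKX.exists_isOpen ((E.isCompact_box _ _ _ _).union (E.isCompact_box _ _ _ _))
  obtain ⟨εX, ⟨hεX, hεX'⟩, hεX0⟩ := (((E.eventually_box_subset hVXo huv.le le_rfl
    (subset_union_left.trans hKVX)).and (E.eventually_box_subset hVXo le_rfl hcs.le
    (subset_union_right.trans hKVX))).and self_mem_nhdsWithin).exists
  replace hεX0 : 0 < εX := hεX0
  -- the arc of the second new brick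
  obtain ⟨c₂, hc₂⟩ : ∃ c₂, c₂ = lam + ζ / 2 := ⟨_, rfl⟩
  have hKY : FreeSet h (E.box v v c₂ c) := (hsf c hcs).mono (subset_union_of_subset_right
    (E.box_mono huv.le le_rfl (by linarith) le_rfl) _)
  obtain ⟨VY, hVYo, hKVY, hVYf⟩ := hKY.exists_isOpen (E.isCompact_box _ _ _ _)
  obtain ⟨εY, hεY, hεY0⟩ := ((E.eventually_box_subset hVYo le_rfl (by linarith)
    hKVY).and self_mem_nhdsWithin).exists
  replace hεY0 : 0 < εY := hεY0
  -- size of the second row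
  obtain ⟨η, hη0, hη1⟩ := exists_between (show 0 < min (min (ε / 2) (W - v))
    (min (min ζ εX) εY) from lt_min (lt_min (by linarith) (by linarith))
    (lt_min (lt_min hζ0 hεX0) hεY0))
  simp only [lt_min_iff] at hη1
  obtain ⟨⟨hηε, hηW⟩, ⟨hηζ, hηX⟩, hηY⟩ := hη1
  -- position of the new brick
  obtain ⟨s₂, hs₂, hY⟩ : ∃ s₂ < s, (c = lam + ζ ∨ ∃ p ∈ pc (r.lab 0) ∪ E.box r.top v lam s₂,
      ∃ q ∈ E.box v (v + η) c₂ c, h p = q ∨ h q = p) := by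
    rcases hcase with h1 | ⟨y, hy1, hy2, x, hx, hxy⟩
    · exact ⟨c, hcs, Or.inl h1⟩
    · obtain ⟨s₂, hs₂, h2⟩ := exists_contact_above (K := pc (r.lab 0)) (lam := lam) (c₂ := c₂)
        huv (by linarith) (by linarith) hy2 hcs hsf hx hxy hη0
      exact ⟨s₂, hs₂, Or.inr h2⟩
  -- The old piece is stopped at `s₀`, beyond `s₁` and `s₂` so that it contains its points of
  -- conflict with both possible new bricks, and within `εX` of `s` so that the first new brick,
  -- which starts there, is free.
  obtain ⟨s₀, hs₀, hs₀s⟩ := exists_between (show max (max s₁ s₂) (max (max c (r.a 1)) (s - εX)) < s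
    from max_lt (max_lt hs₁ hs₂) (max_lt (max_lt hcs hs1) (by linarith)))
  simp only [max_lt_iff] at hs₀
  obtain ⟨⟨hs₁₀, hs₂₀⟩, ⟨hcs₀, has₀⟩, hXs₀⟩ := hs₀
  obtain ⟨t, hst, ht⟩ := exists_between (show s < min (r.a 2 - ξ) (s + εX) from
    lt_min (by linarith) (by linarith))
  rw [lt_min_iff] at ht
  obtain ⟨ht2, htX⟩ := ht
  -- the first row
  obtain ⟨x, -, hxold, hxlab, hpx⟩ := G.exists_fresh ∅ Set.finite_empty
  obtain ⟨rA, HA⟩ := exists_isInsert (T := ξ) x hm hξ0 hξ0 hξ' has₀ (hs₀s.trans hst) ht2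
  have hmz : (2 : ℤ) ≤ r.m := by exact_mod_cast hm
  have hlast : r.a r.m = r.a 0 + 1 := by simpa using r.a_add 0
  have hlastm : r.a (r.m - 1) = r.a (-1) + 1 := by
    rw [← r.a_add (-1), neg_add_eq_sub]
  have hllast : r.lab (r.m - 1) = r.lab (-1) := by
    rw [← r.lab_add (-1), neg_add_eq_sub]
  have hAlast : rA.a (r.m + 1) = r.a 0 + 1 - ξ := by
    rw [HA.a_mid _ (by omega) le_rfl, add_sub_cancel_right, hlast]
  have hboxC : E.box r.top v (r.a (r.m - 1) - ξ) (lam + 1) =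
      E.box r.top v (r.a (-1) - ξ) lam := by
    have := E.box_add_int r.top v (r.a (-1) - ξ) lam 1
    rw [← this, hlastm]; push_cast; congr 1; ring
  have keyA := st.insert HA G.inj hxlab hpx (by simpa using hno 0) (by
    rw [← hv]
    intro i h0 h1
    obtain rfl | rfl | rfl | hi : i = 0 ∨ i = 1 ∨ i = 2 ∨ 3 ≤ i := by omega
    · rw [HA.lab_zero, HA.a_zero, zero_add, HA.a_one, ← hlam]
      exact hsf s₀ hs₀s
    · rw [HA.lab_one, HA.a_one, hpx, empty_union, show (1 : ℤ) + 1 = 2 by rfl, HA.a_two]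
      exact hVXf.mono ((E.box_mono (by linarith) (by linarith) (by linarith)
        (by linarith)).trans hεX)
    · have e1 := HA.lab_mid 2 le_rfl hmz
      have e2 := HA.a_mid 3 le_rfl (by omega)
      norm_num at e1 e2
      rw [e1, HA.a_two, show (2 : ℤ) + 1 = 3 by rfl, e2]
      refine (hV (r.lab 1)).1.mono (union_subset (hV _).2 (hboxV 1 _ _ _ _ ?_ ?_ ?_ ?_))
      all_goals first | linarith | (norm_num; linarith)
    · rw [HA.lab_mid i (by omega) (by omega), HA.a_mid i hi (by omega),
        HA.a_mid (i + 1) (by omega) (by omega)]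
      refine (hV (r.lab (i - 1))).1.mono (union_subset (hV _).2 (hboxV (i - 1) _ _ _ _ ?_ ?_ ?_ ?_))
      · linarith
      · rw [show i + 1 - 1 = i - 1 + 1 by ring]; linarith
      · linarith
      · linarith)
  obtain ⟨hoA, hIA, stA⟩ := keyA
  obtain ⟨pcA, hpcA⟩ : ∃ pcA, pcA = fun l => pc l ∪ E.rowPiece rA l := ⟨_, rfl⟩
  have hreachA := G.reach.push hoA
  rw [← hpcA] at stA hreachA
  have hpcAsub : ∀ l, pc l ⊆ pcA l := fun l => by rw [hpcA]; exact subset_union_left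
  have hpcAeq : ∀ i, pcA (rA.lab i) = pc (rA.lab i) ∪ E.brick rA i := fun i => by
    rw [hpcA]; beta_reduce; rw [E.rowPiece_eq rA hIA]
  have hAtop : rA.top = v := by rw [HA.top, hv]
  have hbrickA : ∀ i, E.brick rA i = E.box r.top v (rA.a i) (rA.a (i + 1)) := fun i => by
    rw [brick, HA.bot, hAtop]
  have hpcA0 : pcA (r.lab 0) = pc (r.lab 0) ∪ E.box r.top v lam s₀ := by
    rw [← HA.lab_zero, hpcAeq, hbrickA, HA.a_zero, zero_add, HA.a_one, hlam]
  have hpcAx : pcA x = E.box r.top v s₀ t := by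
    have := hpcAeq 1
    rw [HA.lab_one, hpx, empty_union, hbrickA, HA.a_one, show (1 : ℤ) + 1 = 2 by rfl,
      HA.a_two] at this
    exact this
  have hlabAm : rA.lab r.m = r.lab (-1) := by
    rw [HA.lab_mid _ hmz le_rfl, hllast]
  have hArange : Set.range rA.lab ⊆ insert x (Set.range r.lab) := by
    intro l hl
    obtain ⟨j, hj0, hj1, rfl⟩ := Row.exists_reduce_lab rA hl
    rw [HA.m] at hj1
    push_cast at hj1
    obtain rfl | rfl | hj : j = 0 ∨ j = 1 ∨ 2 ≤ j := by omega
    · rw [HA.lab_zero]; exact Or.inr ⟨_, rfl⟩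
    · rw [HA.lab_one]; exact Or.inl rfl
    · rw [HA.lab_mid j hj (by omega)]; exact Or.inr ⟨_, rfl⟩
  -- the old brick cannot be merged any more
  have hdX : ¬ FreeSet h (pcA (r.lab 0) ∪ pcA x) := by
    refine not_freeSet_of_link (x := e) (y := p) (Or.inr ?_) (Or.inl ?_) hep
    · rw [hpcAx]; exact E.box_mono le_rfl le_rfl hs₀s.le hst.le he
    · rw [hpcA0]
      exact union_subset_union_right _ (E.box_mono le_rfl le_rfl le_rfl hs₁₀.le) hp
  have hdC : ¬ FreeSet h (pcA (r.lab 0) ∪ pcA (r.lab (-1))) := by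
    have := hno (-1)
    rw [neg_add_cancel, union_comm] at this
    exact fun hf => this (hf.mono (union_subset_union (hpcAsub _) (hpcAsub _)))
  -- the second row
  obtain ⟨gA, hgA0, hgA⟩ := rA.exists_gap
  obtain ⟨ξ₂, hξ₂0, hξ₂1⟩ := exists_between (show 0 < min gA η from lt_min hgA0 hη0)
  rw [lt_min_iff] at hξ₂1
  have hξ₂' : ∀ i, ξ₂ < rA.a (i + 1) - rA.a i := fun i => hξ₂1.1.trans (hgA i)
  -- The second row, apart from what may replace the old brick: the new brick `x` (`j = 1`) extends
  -- back to `c`, and the previous brick (`j = r.m`, one period further) extends up to `lam + ζ`.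
  have hfr : ∀ j : ℤ, 1 ≤ j → j ≤ r.m → FreeSet h (pcA (rA.lab j) ∪
      E.box v (v + η) (if j = 1 then c else rA.a j - ξ₂)
        (if j = r.m then lam + ζ + 1 else rA.a (j + 1) - ξ₂)) := by
    intro j h1 h2
    rw [hpcAeq, hbrickA]
    by_cases hj1 : j = 1
    · subst hj1
      rw [if_pos rfl, if_neg (by omega), HA.lab_one, hpx, empty_union, HA.a_one,
        show (1 : ℤ) + 1 = 2 by rfl, HA.a_two]
      exact hVXf.mono (union_subset ((E.box_mono (by linarith) (by linarith) (by linarith)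
        (by linarith)).trans hεX) ((E.box_mono (by linarith) (by linarith) (by linarith)
        (by linarith)).trans hεX'))
    rw [if_neg hj1, HA.lab_mid j (by omega) h2]
    have hleft : r.a (j - 1) - ξ ≤ rA.a j := by
      obtain rfl | hj : j = 2 ∨ 3 ≤ j := by omega
      · rw [HA.a_two, show (2 : ℤ) - 1 = 1 by rfl]; linarith
      · rw [HA.a_mid j hj (by omega)]
    have hright : rA.a (j + 1) = r.a j - ξ := by
      rw [HA.a_mid (j + 1) (by omega) (by omega), add_sub_cancel_right]
    rw [hright]
    by_cases hjm : j = r.m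
    · subst hjm
      rw [if_pos rfl, hllast, hlast, show r.a 0 + 1 - ξ = lam + 1 by rw [hlam]; ring]
      refine hVCf.mono (union_subset (union_subset (subset_union_left.trans hKVC) ?_) ?_)
      · refine subset_trans ?_ (subset_union_right.trans hKVC)
        rw [← hboxC]
        exact E.box_mono le_rfl le_rfl hleft le_rfl
      · refine subset_trans ?_ hζ'
        rw [← E.box_add_int _ _ (r.a (-1) - ξ - ζ') _ 1]
        push_cast
        rw [hlastm] at hleft
        exact E.box_mono (by linarith) (by linarith) (by linarith) (by linarith)
    · rw [if_neg hjm]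
      refine (hV (r.lab (j - 1))).1.mono (union_subset (union_subset (hV _).2
        (hboxV (j - 1) _ _ _ _ ?_ ?_ ?_ ?_)) (hboxV (j - 1) _ _ _ _ ?_ ?_ ?_ ?_))
      all_goals first | linarith | (rw [sub_add_cancel]; linarith)
  -- The labels introduced are fresh, hence not old, and the old label of the brick `0` leaves the
  -- row: the number of old labels drops strictly, even though the number of bricks may grow.
  have hfinal : ∀ r', rA.Over r' → r'.Inj → E.Stack r' (fun l => pcA l ∪ E.rowPiece r' l) →
      r'.top = v + η → (Set.range r'.lab ∩ old ⊆ Set.range r.lab) → r.lab 0 ∉ Set.range r'.lab →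
      ∃ r' pc' old', E.Game w bad W r' pc' old' ∧ Progress r old r' old' := by
    intro r' h1 h2 h3 h4 h5 h6
    refine ⟨r', _, old, ⟨hreachA.push h1, h3, h2, G.finite_old, by linarith,
      by linarith [G.le_top]⟩, Or.inl ?_⟩
    apply Set.ncard_lt_ncard _ ((finite_range_lab r).inter_of_left old)
    refine ⟨subset_inter h5 inter_subset_right, fun hsub => ?_⟩
    exact h6 (hsub ⟨⟨0, rfl⟩, hold⟩).1
  have hne0 : ∀ j : ℤ, 1 ≤ j → j ≤ r.m → rA.lab j ≠ r.lab 0 := by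
    intro j h1 h2 hj
    rw [← HA.lab_zero] at hj
    have hmA : (rA.m : ℤ) = r.m + 1 := by rw [HA.m]; push_cast; rfl
    have := hIA.eq_of_period hj (by omega) (by omega)
    omega
  have hinold : ∀ j, rA.lab j ∈ old → rA.lab j ∈ Set.range r.lab := by
    intro j hj
    rcases hArange ⟨j, rfl⟩ with h1 | h1
    · rw [h1] at hj; exact (hxold hj).elim
    · exact h1
  rcases hY with hcP | ⟨p₂, hp₂, q, hq, hpq⟩
  · obtain ⟨r', H⟩ := exists_isDelete (r := rA) (n := r.m) (T := η) (c := c) (ξ := ξ₂) HA.m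
      (by omega) hη0 hξ₂0 hξ₂' (by rw [HA.a_zero]; linarith) (by rw [HA.a_one]; linarith)
    have key := stA.delete H
      (fun i j h1 h2 h3 h4 hij => hIA.eq_of_period hij (by rw [HA.m]; push_cast; omega)
        (by rw [HA.m]; push_cast; omega))
      (Or.inr (Or.inr ⟨by rw [HA.lab_zero, HA.lab_one]; exact hdX,
        by rw [HA.lab_zero, hlabAm]; exact hdC⟩))
      (by
        intro i h0 h1
        refine (hfr (i + 1) (by omega) (by omega)).mono (union_subset_union_right _ ?_)
        rw [hAtop]
        refine E.box_mono le_rfl le_rfl ?_ ?_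
        · split_ifs with h2
          · obtain rfl : i = 0 := by omega
            rw [H.a_zero]
          · rw [H.a_mid i (by omega) h1]
        · split_ifs with h2
          · rw [h2, H.a_last, hcP]
          · rw [H.a_mid _ (by omega) (by omega)])
    refine hfinal r' key.1 key.2.1 key.2.2 (by rw [H.top, hAtop]) ?_ ?_
    · rintro l ⟨hl, hl'⟩
      obtain ⟨j, hj0, hj1, rfl⟩ := Row.exists_reduce_lab r' hl
      rw [H.m] at hj1
      rw [H.lab j hj0 hj1] at hl' ⊢
      exact hinold _ hl'
    · intro hl
      obtain ⟨j, hj0, hj1, hj⟩ := Row.exists_reduce_lab r' hl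
      rw [H.m] at hj1
      rw [H.lab j hj0 hj1] at hj
      exact hne0 _ (by omega) (by omega) hj
  · obtain ⟨y, hyx, hyold, hylab, hpy⟩ := G.exists_fresh {x} (Set.finite_singleton x)
    have hyA : y ∉ Set.range rA.lab := fun hy => by
      rcases hArange hy with h1 | h1
      · exact hyx h1
      · exact hylab h1
    obtain ⟨r', H⟩ := exists_isReplace (r := rA) (n := r.m) (T := η) (c₂ := c₂) (c := c)
      (ξ := ξ₂) y HA.m (by omega) hη0 hξ₂0 hξ₂' (by rw [HA.a_zero]; linarith) (by linarith)
      (by rw [HA.a_one]; linarith)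
    have key := stA.replace H hIA hyA (by rw [hpcA]; simp [hpy, E.rowPiece_eq_empty hyA])
      (by rw [HA.lab_zero, HA.lab_one]; exact hdX) (by rw [HA.lab_zero, hlabAm]; exact hdC)
      (by
        rw [HA.lab_zero, hAtop, hpcA0]
        refine not_freeSet_of_link (x := p₂) (y := q) (Or.inl ?_) (Or.inr hq) hpq
        exact union_subset_union_right _ (E.box_mono le_rfl le_rfl le_rfl hs₂₀.le) hp₂)
      (by
        intro i h0 h1
        rw [hAtop]
        by_cases hi : i = 0
        · subst hi
          rw [H.lab_zero, H.a_zero, zero_add, H.a_one, hpcA]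
          beta_reduce
          rw [hpy, E.rowPiece_eq_empty hyA, empty_union, empty_union]
          exact hVYf.mono ((E.box_mono (by linarith) (by linarith) (by linarith)
            (by linarith)).trans hεY)
        · rw [H.lab_mid i (by omega) (by omega)]
          refine (hfr i (by omega) (by omega)).mono (union_subset_union_right _ ?_)
          refine E.box_mono le_rfl le_rfl ?_ ?_
          · split_ifs with h2
            · rw [h2, H.a_one]
            · rw [H.a_mid i (by omega) (by omega)]
          · split_ifs with h2
            · rw [h2, H.a_last]; linarith
            · rw [H.a_mid _ (by omega) (by omega)])
    refine hfinal r' key.1 key.2.1 key.2.2 (by rw [H.top, hAtop]) ?_ ?_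
    · rintro l ⟨hl, hl'⟩
      obtain ⟨j, hj0, hj1, rfl⟩ := Row.exists_reduce_lab r' hl
      rw [H.m] at hj1
      by_cases hj : j = 0
      · subst hj; rw [H.lab_zero] at hl'; exact (hyold hl').elim
      · rw [H.lab_mid j (by omega) (by omega)] at hl' ⊢
        exact hinold _ hl'
    · intro hl
      obtain ⟨j, hj0, hj1, hj⟩ := Row.exists_reduce_lab r' hl
      rw [H.m] at hj1
      by_cases hj' : j = 0
      · subst hj'; rw [H.lab_zero] at hj; exact hylab ⟨0, hj.symm⟩
      · rw [H.lab_mid j (by omega) (by omega)] at hj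
        exact hne0 _ (by omega) (by omega) hj

end PolarEnd

end BrickDecomposition

/-! ### Termination of the construction, and existence of barriers. -/

namespace BrickDecomposition

open Set Topology

theorem Row.exists_cell (r : Row) (x : ℝ) : ∃ k, r.a k ≤ x ∧ x < r.a (k + 1) := by
  have h0 : r.a (⌊x - r.a 0⌋ * r.m) ≤ x := by
    have := r.a_add_mul 0 ⌊x - r.a 0⌋
    rw [zero_add] at this
    rw [this]
    linarith [Int.floor_le (x - r.a 0)]
  have h1 : x < r.a ((⌊x - r.a 0⌋ + 1) * r.m) := by
    have := r.a_add_mul 0 (⌊x - r.a 0⌋ + 1)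
    rw [zero_add] at this
    rw [this]
    push_cast
    linarith [Int.lt_floor_add_one (x - r.a 0)]
  obtain ⟨k, hk, hmax⟩ := Int.exists_greatest_of_bdd (P := fun z => r.a z ≤ x)
    ⟨_, fun z hz => (r.a_mono.lt_iff_lt.1 (lt_of_le_of_lt hz h1)).le⟩ ⟨_, h0⟩
  refine ⟨k, hk, lt_of_not_ge fun h2 => ?_⟩
  have := hmax _ h2
  omega

theorem Row.bot_zero_le {rows : ℕ → Row} {N : ℕ} (H : ∀ n < N, (rows n).Over (rows (n + 1)))
    {n n' : ℕ} (hn : n ≤ n') (hN : n' ≤ N) : (rows n).bot ≤ (rows n').bot := by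
  induction n', hn using Nat.le_induction with
  | base => exact le_rfl
  | succ k hk ih =>
    refine (ih (by omega)).trans ?_
    rw [(H k (by omega)).1]
    exact (rows k).bot_lt.le

theorem Row.top_le_bot {rows : ℕ → Row} {N : ℕ} (H : ∀ n < N, (rows n).Over (rows (n + 1)))
    {n n' : ℕ} (hn : n < n') (hN : n' ≤ N) : (rows n).top ≤ (rows n').bot := by
  rw [← (H n (by omega)).1]
  exact Row.bot_zero_le H hn hN

/-- The row with `m` bricks of the same width and consecutive labels starting from `b`. -/
noncomputable def Row.uniform (bot top : ℝ) (m : ℕ) (o : ℝ) (b : ℕ) (hbt : bot < top) (hm : 0 < m) : Row where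
  bot := bot
  top := top
  m := m
  a i := o + i / m
  lab i := b + (i % m).toNat
  bot_lt := hbt
  m_pos := hm
  a_mono i j hij := by
    have : (0 : ℝ) < m := by exact_mod_cast hm
    have : (i : ℝ) < j := by exact_mod_cast hij
    beta_reduce
    gcongr
  a_add i := by
    have : (m : ℝ) ≠ 0 := by exact_mod_cast hm.ne'
    push_cast
    field_simp
    ring
  lab_add i := by simp

theorem Row.uniform_inj {bot top : ℝ} {m : ℕ} {o : ℝ} {b : ℕ} {hbt : bot < top} {hm : 0 < m} :
    (Row.uniform bot top m o b hbt hm).Inj := by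
  apply Row.inj_of_period
  intro i j h0 h1 h2 h3 hij
  change i < (m : ℤ) at h1
  change j < (m : ℤ) at h3
  change b + (i % m).toNat = b + (j % m).toNat at hij
  rw [Int.emod_eq_of_lt h0 h1, Int.emod_eq_of_lt h2 h3] at hij
  omega

/-- The offsets `1 / (m (j + 2))` are pairwise distinct modulo `1 / m`, while the cuts of `r` take
only finitely many values modulo `1`. By pigeonhole some offset avoids all of them. Rational offsets
matter because the last row of a stack must have rational cuts. -/
theorem exists_rational_offset (r : Row) {m : ℕ} (hm : 0 < m) :
    ∃ o : ℚ, ∀ i k : ℤ, (o : ℝ) + i / m ≠ r.a k := by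
  by_contra! hcon
  have hm' : (0 : ℝ) < m := by exact_mod_cast hm
  have hred : ∀ o : ℚ, ∃ (k : Fin r.m) (i : ℤ), (o : ℝ) + i / m = r.a k := by
    intro o
    obtain ⟨i, k, hik⟩ := hcon o
    obtain ⟨j, p, h0, h1, rfl⟩ := r.exists_reduce k
    rw [r.a_add_mul] at hik
    refine ⟨⟨j.toNat, by omega⟩, i - p * m, ?_⟩
    simp only [Int.toNat_of_nonneg h0]
    push_cast
    rw [sub_div, mul_div_cancel_right₀ _ hm'.ne']
    linarith
  choose f g hfg using fun j : ℕ => hred (1 / (m * (j + 2)))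
  obtain ⟨x, y, hxy, hf⟩ := Finite.exists_ne_map_eq_of_infinite f
  have h1 := hfg x
  have h2 := hfg y
  rw [hf, ← h2] at h1
  push_cast at h1
  have hx0 : (0 : ℝ) < x + 2 := by positivity
  have hy0 : (0 : ℝ) < y + 2 := by positivity
  have e1 : 1 / ((x : ℝ) + 2) + g x = 1 / ((y : ℝ) + 2) + g y := by
    field_simp at h1 ⊢
    linarith
  have a1 : 1 / ((x : ℝ) + 2) ≤ 1 / 2 := one_div_le_one_div_of_le (by norm_num) (by
    have : (0 : ℝ) ≤ x := by positivity
    linarith)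
  have a2 : 1 / ((y : ℝ) + 2) ≤ 1 / 2 := one_div_le_one_div_of_le (by norm_num) (by
    have : (0 : ℝ) ≤ y := by positivity
    linarith)
  have b1 : 0 < 1 / ((x : ℝ) + 2) := by positivity
  have b2 : 0 < 1 / ((y : ℝ) + 2) := by positivity
  -- The two offsets, multiplied by `m`, lie in `(0, 1/2]`, so the integers differ by less than `1`.
  have hg : g x = g y := by
    have c1 : (g x : ℝ) - g y < 1 := by linarith
    have c2 : (g y : ℝ) - g x < 1 := by linarith
    have c1' : g x - g y < 1 := by exact_mod_cast c1
    have c2' : g y - g x < 1 := by exact_mod_cast c2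
    omega
  rw [hg] at e1
  have e2 : 1 / ((x : ℝ) + 2) = 1 / ((y : ℝ) + 2) := by linarith
  rw [one_div, one_div, inv_inj] at e2
  exact hxy (by exact_mod_cast (by linarith : (x : ℝ) = y))

namespace PolarEnd

variable {S : Type*} [TopologicalSpace S] {h : S ≃ₜ S} {w₀ : ℝ} {E : PolarEnd h w₀}
  {w : ℝ} {bad : Set ℝ} {W : ℝ} {r : Row} {pc : ℕ → Set S} {old : Set ℕ}

/-- An exhaustive alternative, up to renumbering the bricks: some neighbours can be merged; or an
old piece can be prolonged over the whole next brick, which is then deleted; or its prolongation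
meets a conflict, and the old piece is buried. -/
theorem Game.step [T2Space S] (G : E.Game w bad W r pc old) (hm : 2 ≤ r.m)
    (hold : (Set.range r.lab ∩ old).Nonempty) :
    ∃ r' pc' old', E.Game w bad W r' pc' old' ∧ Progress r old r' old' := by
  by_cases hno : ∀ k, ¬ FreeSet h (pc (r.lab k) ∪ pc (r.lab (k + 1)))
  · obtain ⟨_, ⟨i, rfl⟩, hi⟩ := hold
    by_cases harc : ∀ c < r.a (i + 2),
        FreeSet h (pc (r.lab i) ∪ E.box r.top r.top (r.a (i + 1)) c)
    · obtain ⟨r', pc', old', h1, h2⟩ := (G.shift (i + 1)).progress_of_arc hm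
        (fun k => by
          have := hno (k + (i + 1))
          rwa [show k + (i + 1) + 1 = k + 1 + (i + 1) by ring] at this)
        (by
          change ∀ c < r.a (1 + (i + 1)), FreeSet h (pc (r.lab (-1 + (i + 1))) ∪
            E.box r.top r.top (r.a (0 + (i + 1))) c)
          rw [show 1 + (i + 1) = i + 2 by ring, show -1 + (i + 1) = i by ring, zero_add]
          exact harc)
      exact ⟨r', pc', old', h1, h2.of_shift⟩
    · push Not at harc
      obtain ⟨r', pc', old', h1, h2⟩ := (G.shift i).progress_of_run hm
        (fun k => by
          have := hno (k + i)
          rwa [show k + i + 1 = k + 1 + i by ring] at this)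
        (by change r.lab (0 + i) ∈ old; rwa [zero_add])
        (by
          change ∃ c < r.a (2 + i), ¬ FreeSet h (pc (r.lab (0 + i)) ∪
            E.box r.top r.top (r.a (1 + i)) c)
          rw [add_comm 2 i, add_comm 1 i, zero_add]
          exact harc)
      exact ⟨r', pc', old', h1, h2.of_shift⟩
  · push Not at hno
    obtain ⟨k, hk⟩ := hno
    obtain ⟨r', pc', old', h1, h2⟩ := (G.shift (k + 1)).progress_of_free hm (by
      change FreeSet h (pc (r.lab (-1 + (k + 1))) ∪ pc (r.lab (0 + (k + 1))))
      rwa [show -1 + (k + 1) = k by ring, zero_add])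
    exact ⟨r', pc', old', h1, h2.of_shift⟩

/-- Well-founded induction on the lexicographic pair (number of old labels in the last row, number
of bricks of the last row). -/
theorem Game.exists_end [T2Space S] (G : E.Game w bad W r pc old) :
    ∃ r' pc' old', E.Game w bad W r' pc' old' ∧
      (r'.m = 1 ∨ Set.range r'.lab ∩ old' = ∅) := by
  induction hp : toLex ((Set.range r.lab ∩ old).ncard, r.m) using
    WellFoundedLT.induction generalizing r pc old with
  | ind p ih =>
    by_cases hm : r.m = 1
    · exact ⟨r, pc, old, G, Or.inl hm⟩
    rcases (Set.range r.lab ∩ old).eq_empty_or_nonempty with he | hne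
    · exact ⟨r, pc, old, G, Or.inr he⟩
    have := r.m_pos
    obtain ⟨r', pc', old', G', hP⟩ := G.step (by omega) hne
    refine ih _ ?_ G' rfl
    rw [← hp, Prod.Lex.toLex_lt_toLex]
    rcases hP with h1 | ⟨h1, h2⟩
    · exact Or.inl h1
    · rcases h1.lt_or_eq with h3 | h3
      · exact Or.inl h3
      · exact Or.inr ⟨h3, h2⟩

/-- A stack consisting of a single row. -/
theorem stack_single {r : Row} (hinj : r.Inj) (hfree : ∀ i, FreeSet h (E.brick r i)) :
    E.Stack r (E.rowPiece r) where
  fin := by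
    obtain ⟨b', hb'⟩ := (finite_range_lab r).bddAbove
    refine ⟨b' + 1, fun l hl => E.rowPiece_eq_empty fun hl' => ?_⟩
    have := hb' hl'
    omega
  compact l := by
    by_cases hl : l ∈ Set.range r.lab
    · obtain ⟨i, rfl⟩ := hl
      rw [E.rowPiece_eq r hinj]
      exact E.isCompact_box _ _ _ _
    · rw [E.rowPiece_eq_empty hl]; exact isCompact_empty
  range l := iUnion₂_subset fun i _ => image_subset_range _ _
  level l v θ hv := (E.mem_rowPiece.1 hv).1.2
  touch l θ hθ := (E.mem_rowPiece.1 hθ).2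
  arc i θ hθ := E.mem_rowPiece.2 ⟨⟨r.bot_lt.le, le_rfl⟩, i, rfl, hθ⟩
  free l := by
    by_cases hl : l ∈ Set.range r.lab
    · obtain ⟨i, rfl⟩ := hl
      rw [E.rowPiece_eq r hinj]; exact hfree i
    · rw [E.rowPiece_eq_empty hl]; exact freeSet_empty
  conn l := by
    by_cases hl : l ∈ Set.range r.lab
    · obtain ⟨i, rfl⟩ := hl
      rw [E.rowPiece_eq r hinj]; exact E.isPreconnected_box _ _ _ _
    · rw [E.rowPiece_eq_empty hl]; exact isPreconnected_empty
  sep l i hl := by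
    rintro ⟨x, hx, hx'⟩
    right
    obtain ⟨⟨v, θ⟩, rfl⟩ := iUnion₂_subset (fun j _ => image_subset_range _ _) hx
    obtain ⟨-, p, hp, hθ⟩ := E.mem_rowPiece.1 hx
    obtain ⟨-, q, hq, hθ'⟩ := E.mem_rowPiece.1 hx'
    rcases Row.cells_inter hθ hθ' with rfl | rfl | rfl
    · exact (hl (hp.symm.trans hq)).elim
    · exact ⟨p, Or.inl ⟨hp, hq⟩⟩
    · exact ⟨q, Or.inr ⟨hq, hp⟩⟩

/-- The labels split into two families whose pieces cannot be merged, or some piece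
is the only one at some level between `w` and `u`. -/
def Barrier (E : PolarEnd h w₀) (pc : ℕ → Set S) (first last : Set ℕ) (w u : ℝ) : Prop :=
  (∃ F : Set ℕ, Disjoint first F ∧ last ⊆ F ∧
    ∀ l ∉ F, ∀ l' ∈ F, (pc l ∩ pc l').Nonempty → ¬ FreeSet h (pc l ∪ pc l')) ∨
  ∃ l v, w < v ∧ v < u ∧ ∀ θ, E.Φ (v, θ) ∈ pc l ∧ ∀ l', E.Φ (v, θ) ∈ pc l' → l' = l

/-- A finite stack of rows containing a barrier. -/
structure Wall (E : PolarEnd h w₀) (w : ℝ) (bad : Set ℝ) (r : Row) (pc : ℕ → Set S)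
    (old : Set ℕ) : Prop where
  reach : E.Reach w bad r pc old
  finite_old : old.Finite
  fin : ∃ b, ∀ l, b ≤ l → pc l = ∅
  range : ∀ l, pc l ⊆ range E.Φ
  level : ∀ l v θ, E.Φ (v, θ) ∈ pc l → v ≤ r.top
  touch : ∀ l θ, E.Φ (r.top, θ) ∈ pc l → l ∈ Set.range r.lab
  free : ∀ l, FreeSet h (pc l)
  conn : ∀ l, IsPreconnected (pc l)
  barrier : E.Barrier pc old (Set.range r.lab) w r.top

/-- A row with a single brick contains circles. If no old label is left in the last row, the labels
of that row form the upper family: a piece outside this family cannot be a neighbour in the row, so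
the stack invariant leaves only the non-freeness of the union. -/
theorem Game.wall [T2Space S] (G : E.Game w bad W r pc old)
    (hend : r.m = 1 ∨ Set.range r.lab ∩ old = ∅) : E.Wall w bad r pc old where
  reach := G.reach
  finite_old := G.finite_old
  fin := G.stack.fin
  range := G.stack.range
  level := G.stack.level
  touch l θ hθ := by
    obtain ⟨i, hi, -⟩ := G.stack.touch l θ hθ
    exact ⟨i, hi⟩
  free := G.stack.free
  conn := G.stack.conn
  barrier := by
    rcases hend with h1 | h1
    · right
      obtain ⟨rows, N, rfl, -, h2, rfl, rfl, -⟩ := G.reach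
      have hlab : ∀ i, (rows N).lab i = (rows N).lab 0 := fun i => by
        have h2 := (rows N).lab_add_mul 0 i
        rwa [h1, zero_add, Nat.cast_one, mul_one] at h2
      have hlt := (rows N).bot_lt
      have hle := Row.bot_zero_le h2 N.zero_le le_rfl
      -- The level in the middle of the last row is met by no other row.
      refine ⟨(rows N).lab 0, ((rows N).bot + (rows N).top) / 2, by linarith, by linarith,
        fun θ => ⟨?_, fun l' hl' => ?_⟩⟩
      · obtain ⟨k, hk, hk'⟩ := (rows N).exists_cell θ
        exact mem_iUnion₂.2 ⟨N, le_rfl, E.mem_rowPiece.2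
          ⟨⟨by linarith, by linarith⟩, k, hlab k, hk, hk'.le⟩⟩
      · obtain ⟨n, hn, hmem⟩ := mem_iUnion₂.1 hl'
        obtain ⟨⟨-, hb⟩, i, rfl, -⟩ := E.mem_rowPiece.1 hmem
        rcases hn.lt_or_eq with hn | rfl
        · have := Row.top_le_bot h2 hn le_rfl
          linarith
        · exact hlab i
    · left
      refine ⟨Set.range r.lab, ?_, subset_rfl, ?_⟩
      · rw [disjoint_iff_inter_eq_empty, inter_comm]; exact h1
      · rintro l hl _ ⟨i, rfl⟩ hne
        have hl' : l ≠ r.lab i := fun h' => hl ⟨i, h'.symm⟩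
        refine (G.stack.sep l i hl' hne).resolve_right ?_
        rintro ⟨k, ⟨h', -⟩ | ⟨-, h'⟩⟩
        · exact hl ⟨_, h'⟩
        · exact hl ⟨_, h'⟩

/-- Once a barrier exists, rows can be added without any care for mergeability: their labels are
fresh and are put in the upper family, and below they meet only pieces that are already in this
family. This fills the space up to the prescribed level, and makes the cuts of the last row
rational. -/
theorem Wall.push (H : E.Wall w bad r pc old) {T δ : ℝ} (hT : 0 < T) (hδ0 : 0 < δ)
    (hδ : ∀ a b, b - a ≤ δ → FreeSet h (E.box r.top (r.top + T) a b)) :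
    ∃ r' pc' old', E.Wall w bad r' pc' old' ∧ r'.top = r.top + T ∧
      ∀ i, r'.a i ∈ Set.range ((↑) : ℚ → ℝ) := by
  obtain ⟨b₁, hb₁⟩ := H.fin
  obtain ⟨b₂, hb₂⟩ := (H.finite_old.union (finite_range_lab r)).bddAbove
  obtain ⟨n, hn⟩ := exists_nat_one_div_lt hδ0
  have hm : 0 < n + 1 := by omega
  obtain ⟨o, ho⟩ := exists_rational_offset r hm
  obtain ⟨b, hb⟩ : ∃ b, b = max b₁ (b₂ + 1) := ⟨_, rfl⟩
  obtain ⟨r', hr'⟩ : ∃ r', r' = Row.uniform r.top (r.top + T) (n + 1) o b (by linarith) hm :=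
    ⟨_, rfl⟩
  have hI : r'.Inj := by rw [hr']; exact Row.uniform_inj
  have ha : ∀ i, r'.a i = o + i / (n + 1 : ℕ) := fun i => by rw [hr']; rfl
  have hbot : r'.bot = r.top := by rw [hr']; rfl
  have htop : r'.top = r.top + T := by rw [hr']; rfl
  have hpc : ∀ l, b ≤ l → pc l = ∅ := fun l hl => hb₁ l (by omega)
  have hlab : ∀ i, b ≤ r'.lab i := fun i => by rw [hr']; exact Nat.le_add_right _ _
  have hrow : ∀ l, l < b → E.rowPiece r' l = ∅ := fun l hl =>
    E.rowPiece_eq_empty fun ⟨i, hi⟩ => by have := hlab i; omega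
  have hover : r.Over r' := by
    refine ⟨hbot, fun i => ?_⟩
    obtain ⟨k, hk, hk'⟩ := r.exists_cell (r'.a i)
    refine ⟨k, lt_of_le_of_ne hk fun h' => ?_, hk'⟩
    rw [ha] at h'
    exact ho i k h'.symm
  have hst : E.Stack r' (E.rowPiece r') := by
    refine stack_single hI fun i => ?_
    rw [brick, hbot, htop]
    apply hδ
    rw [ha, ha]
    push_cast
    have : (0 : ℝ) < n + 1 := by positivity
    field_simp at hn ⊢
    linarith
  have heq1 : ∀ l, l < b → pc l ∪ E.rowPiece r' l = pc l := fun l hl => by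
    rw [hrow l hl, union_empty]
  have heq2 : ∀ l, b ≤ l → pc l ∪ E.rowPiece r' l = E.rowPiece r' l := fun l hl => by
    rw [hpc l hl, empty_union]
  refine ⟨r', _, old, ⟨H.reach.push hover, H.finite_old, ?_, ?_, ?_, ?_, ?_, ?_, ?_⟩, htop, ?_⟩
  · obtain ⟨b', hb'⟩ := hst.fin
    refine ⟨max b b', fun l hl => ?_⟩
    rw [hpc l ((le_max_left _ _).trans hl), hb' l ((le_max_right _ _).trans hl), union_empty]
  · exact fun l => union_subset (H.range l) (hst.range l)
  · rintro l v θ (hv | hv)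
    · have := H.level l v θ hv; linarith
    · exact hst.level l v θ hv
  · rintro l θ (hv | hv)
    · have := H.level l _ θ hv; linarith
    · obtain ⟨i, hi, -⟩ := hst.touch l θ hv
      exact ⟨i, hi⟩
  · intro l
    rcases lt_or_ge l b with hl | hl
    · rw [heq1 l hl]; exact H.free l
    · rw [heq2 l hl]; exact hst.free l
  · intro l
    rcases lt_or_ge l b with hl | hl
    · rw [heq1 l hl]; exact H.conn l
    · rw [heq2 l hl]; exact hst.conn l
  · rcases H.barrier with ⟨F, hF1, hF2, hF3⟩ | ⟨l, v, hwv, hvt, hlv⟩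
    · left
      refine ⟨F ∪ Ici b, ?_, ?_, ?_⟩
      · rw [disjoint_union_right]
        refine ⟨hF1, Set.disjoint_left.2 fun l hl hl' => ?_⟩
        have := hb₂ (Or.inl hl)
        rw [mem_Ici] at hl'
        omega
      · rintro _ ⟨i, rfl⟩; exact Or.inr (hlab i)
      · intro l hl l' hl'
        simp only [mem_union, mem_Ici, not_or, not_le] at hl
        beta_reduce
        rw [heq1 l hl.2]
        rcases lt_or_ge l' b with h1 | h1
        · rw [heq1 l' h1]
          refine hF3 l hl.1 l' (hl'.resolve_right (by simpa using h1))
        · rw [heq2 l' h1]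
          rintro ⟨x, hx, hx'⟩
          -- An earlier piece touches the added row only on the level `r.top`, where its label
          -- belongs to the row `r`, hence to `F`.
          obtain ⟨⟨v, θ⟩, rfl⟩ := H.range l hx
          have h3 := (E.mem_rowPiece.1 hx').1.1
          rw [hbot] at h3
          obtain rfl : v = r.top := le_antisymm (H.level l v θ hx) h3
          exact (hl.1 (hF2 (H.touch l θ hx))).elim
    · refine Or.inr ⟨l, v, hwv, by linarith, fun θ => ⟨Or.inl (hlv θ).1, ?_⟩⟩
      rintro l' (hl' | hl')
      · exact (hlv θ).2 l' hl'
      · have := (E.mem_rowPiece.1 hl').1.1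
        linarith
  · intro i
    rw [ha]
    exact ⟨o + i / (n + 1 : ℕ), by push_cast; rfl⟩

theorem Wall.fill {δ : ℝ} (hδ0 : 0 < δ) (hδ : ∀ u v a b, w ≤ u → v ≤ W → v - u ≤ δ → b - a ≤ δ →
    FreeSet h (E.box u v a b)) (n : ℕ) (H : E.Wall w bad r pc old) (hw : w ≤ r.top)
    (hW : r.top < W) (hn : W - r.top ≤ (n + 1) * δ) :
    ∃ r' pc' old', E.Wall w bad r' pc' old' ∧ r'.top = W ∧
      ∀ i, r'.a i ∈ Set.range ((↑) : ℚ → ℝ) := by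
  have hlast : ∀ r pc old, E.Wall w bad r pc old → w ≤ r.top → r.top < W → W - r.top ≤ δ →
      ∃ r' pc' old', E.Wall w bad r' pc' old' ∧ r'.top = W ∧
        ∀ i, r'.a i ∈ Set.range ((↑) : ℚ → ℝ) := by
    intro r pc old H hw hW hle
    obtain ⟨r', pc', old', h1, h2, h3⟩ := H.push (sub_pos.2 hW) hδ0
      (fun a b hab => hδ _ _ _ _ hw (by linarith) (by linarith) hab)
    exact ⟨r', pc', old', h1, by linarith, h3⟩
  induction n generalizing r pc old with
  | zero => exact hlast r pc old H hw hW (by simpa using hn)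
  | succ n ih =>
    by_cases hle : W - r.top ≤ δ
    · exact hlast r pc old H hw hW hle
    · obtain ⟨r', pc', old', h1, h2, -⟩ := H.push hδ0 hδ0
        (fun a b hab => hδ _ _ _ _ hw (by linarith) (by linarith) hab)
      refine ih h1 (by linarith) (by linarith) ?_
      push_cast at hn
      rw [h2]; linarith

/-- Between the levels `w` and `w + 1` there is a stack of rows containing a barrier. -/
theorem exists_barrier [T2Space S] (E : PolarEnd h w₀) {w : ℝ} (hw : w₀ ≤ w) {bad : Set ℝ}
    (hbad : bad.Countable) :
    ∃ (rows : ℕ → Row) (N : ℕ), (rows 0).bot = w ∧ (rows N).top = w + 1 ∧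
      (∀ n < N, (rows n).Over (rows (n + 1))) ∧ (∀ i, (rows 0).a i ∉ bad) ∧
      (∀ i, (rows N).a i ∈ Set.range ((↑) : ℚ → ℝ)) ∧
      (∀ l, FreeSet h (E.pieces rows N l)) ∧ (∀ l, IsPreconnected (E.pieces rows N l)) ∧
      E.Barrier (E.pieces rows N) (Set.range (rows 0).lab) (Set.range (rows N).lab)
        w (w + 1) := by
  obtain ⟨δ, hδ0, hδ⟩ := exists_small E (u₂ := w + 1) hw
  obtain ⟨n, hn⟩ := exists_nat_one_div_lt hδ0
  obtain ⟨τ, hτ0, hτ1⟩ := exists_between (show 0 < min δ 1 from lt_min hδ0 one_pos)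
  rw [lt_min_iff] at hτ1
  have hm : 0 < n + 1 := by omega
  -- Each of the countably many cuts excludes countably many offsets.
  obtain ⟨o, ho⟩ : ∃ o : ℝ, ∀ i : ℤ, o + i / (n + 1 : ℕ) ∉ bad := by
    have hc : (⋃ i : ℤ, (fun x : ℝ => x - i / (n + 1 : ℕ)) '' bad).Countable :=
      countable_iUnion fun i => hbad.image _
    obtain ⟨o, ho⟩ := hc.dense_compl ℝ |>.nonempty
    refine ⟨o, fun i hi => ho (mem_iUnion.2 ⟨i, _, hi, by simp⟩)⟩
  obtain ⟨r, hr⟩ : ∃ r, r = Row.uniform w (w + τ) (n + 1) o 0 (by linarith) hm := ⟨_, rfl⟩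
  have hst : E.Stack r (E.rowPiece r) := by
    refine stack_single (by rw [hr]; exact Row.uniform_inj) fun i => ?_
    rw [brick, hr]
    refine hδ _ _ _ _ le_rfl ?_ ?_ ?_
    · change w + τ ≤ _; linarith
    · change w + τ - w ≤ _; linarith
    · change o + ((i + 1 : ℤ) : ℝ) / (n + 1 : ℕ) - (o + i / (n + 1 : ℕ)) ≤ δ
      push_cast
      have : (0 : ℝ) < n + 1 := by positivity
      field_simp at hn ⊢
      linarith
  -- At the start every label is old: the pieces that begin on the first row are those that must not
  -- reach the last one.
  have G : E.Game w bad (w + 1) r (E.rowPiece r) (Set.range r.lab) := by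
    refine ⟨⟨fun _ => r, 0, by rw [hr]; rfl, fun i => by rw [hr]; exact ho i,
      fun n hn => by omega, rfl, ?_, fun i => ⟨i, rfl⟩⟩, hst, by rw [hr]; exact Row.uniform_inj,
      finite_range_lab r, ?_, ?_⟩
    · funext l
      simp [pieces]
    · rw [hr]; change w + τ < _; linarith
    · rw [hr]; change _ ≤ w + τ; linarith
  obtain ⟨r₁, pc₁, old₁, G₁, hend⟩ := G.exists_end
  have hw₁ : w ≤ r₁.top := by
    obtain ⟨rows, N, h1, -, h2, rfl, -⟩ := G₁.reach
    rw [← h1]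
    exact (Row.bot_zero_le h2 N.zero_le le_rfl).trans (rows N).bot_lt.le
  obtain ⟨K, hK⟩ := exists_nat_ge ((w + 1 - r₁.top) / δ)
  obtain ⟨r', pc', old', H, htop, hrat⟩ := (G₁.wall hend).fill hδ0 hδ K hw₁ G₁.top_lt (by
    rw [div_le_iff₀ hδ0] at hK
    linarith)
  obtain ⟨rows, N, h0, h1, h2, rfl, rfl, h3⟩ := H.reach
  refine ⟨rows, N, h0, htop, h2, h1, hrat, H.free, H.conn, ?_⟩
  rcases H.barrier with ⟨F, hF1, hF2, hF3⟩ | hB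
  · refine Or.inl ⟨F, hF1.mono_left ?_, hF2, hF3⟩
    rintro _ ⟨i, rfl⟩
    exact h3 i
  · rw [htop] at hB
    exact Or.inr hB

end PolarEnd

end BrickDecomposition

/-! ### The T-shaped local model and its three sectors. -/

namespace BrickDecomposition

open Set Topology

/-- A straight line together with a half-line orthogonal to it. -/
def teeModel : Set ℂ := {z | z.re = 0 ∨ (z.im = 0 ∧ 0 ≤ z.re)}

/-- The three open sectors cut out by `teeModel`. -/
def sector : Fin 3 → Set ℂ
  | 0 => {z | z.re < 0}
  | 1 => {z | 0 < z.re ∧ 0 < z.im}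
  | 2 => {z | 0 < z.re ∧ z.im < 0}

/-- The closures of the three sectors cut out by `teeModel`. -/
def closedSector : Fin 3 → Set ℂ
  | 0 => {z | z.re ≤ 0}
  | 1 => {z | 0 ≤ z.re ∧ 0 ≤ z.im}
  | 2 => {z | 0 ≤ z.re ∧ z.im ≤ 0}

theorem isClosed_closedSector (σ : Fin 3) : IsClosed (closedSector σ) := by
  fin_cases σ
  · exact isClosed_le Complex.continuous_re continuous_const
  · exact (isClosed_le continuous_const Complex.continuous_re).inter
      (isClosed_le continuous_const Complex.continuous_im)
  · exact (isClosed_le continuous_const Complex.continuous_re).inter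
      (isClosed_le Complex.continuous_im continuous_const)

theorem convex_sector (σ : Fin 3) : Convex ℝ (sector σ) := by
  fin_cases σ
  · exact convex_halfSpace_re_lt 0
  · exact (convex_halfSpace_re_gt 0).inter (convex_halfSpace_im_gt 0)
  · exact (convex_halfSpace_re_gt 0).inter (convex_halfSpace_im_lt 0)

theorem sector_subset_closedSector (σ : Fin 3) : sector σ ⊆ closedSector σ := by
  intro z hz
  fin_cases σ
  · exact le_of_lt (show z.re < 0 from hz)
  · exact ⟨hz.1.le, hz.2.le⟩
  · exact ⟨hz.1.le, hz.2.le⟩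

theorem closedSector_subset_closure (σ : Fin 3) : closedSector σ ⊆ closure (sector σ) := by
  intro z hz
  set d : ℂ := match σ with
    | 0 => -1
    | 1 => 1 + Complex.I
    | 2 => 1 - Complex.I with hd
  have hmem : ∀ t : ℝ, 0 < t → z + t * d ∈ sector σ := by
    intro t ht
    fin_cases σ
    · have : z.re ≤ 0 := hz
      change (z + t * (-1)).re < 0
      simp; linarith
    · have h1 : 0 ≤ z.re := hz.1
      have h2 : 0 ≤ z.im := hz.2
      change 0 < (z + t * (1 + Complex.I)).re ∧ 0 < (z + t * (1 + Complex.I)).im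
      simp; constructor <;> linarith
    · have h1 : 0 ≤ z.re := hz.1
      have h2 : z.im ≤ 0 := hz.2
      change 0 < (z + t * (1 - Complex.I)).re ∧ (z + t * (1 - Complex.I)).im < 0
      simp; constructor <;> linarith
  have hlim : Filter.Tendsto (fun t : ℝ => z + t * d) (𝓝[>] 0) (𝓝 z) := by
    have hc : Continuous fun t : ℝ => z + t * d := by fun_prop
    have := (hc.tendsto 0).mono_left (nhdsWithin_le_nhds (s := Ioi 0))
    simpa using this
  exact mem_closure_of_tendsto hlim (by
    filter_upwards [self_mem_nhdsWithin] with t ht using hmem t ht)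

theorem zero_mem_closedSector (σ : Fin 3) : (0 : ℂ) ∈ closedSector σ := by
  fin_cases σ <;> simp [closedSector]

theorem exists_mem_sector_of_notMem {z : ℂ} (hz : z ∉ teeModel) : ∃ σ, z ∈ sector σ := by
  simp only [teeModel, mem_ofPred_eq, not_or, not_and, not_le] at hz
  rcases lt_trichotomy z.re 0 with h1 | h1 | h1
  · exact ⟨0, h1⟩
  · exact (hz.1 h1).elim
  · rcases lt_trichotomy z.im 0 with h2 | h2 | h2
    · exact ⟨2, h1, h2⟩
    · exact (lt_asymm h1 (hz.2 h2)).elim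
    · exact ⟨1, h1, h2⟩

theorem sector_notMem_tee {z : ℂ} {σ : Fin 3} (hz : z ∈ sector σ) : z ∉ teeModel := by
  rintro (h1 | ⟨h1, h2⟩) <;> fin_cases σ
  · have : z.re < 0 := hz
    linarith
  · have : 0 < z.re := hz.1
    linarith
  · have : 0 < z.re := hz.1
    linarith
  · have : z.re < 0 := hz
    linarith
  · have : 0 < z.im := hz.2
    linarith
  · have : z.im < 0 := hz.2
    linarith

theorem dense_compl_tee : Dense teeModelᶜ := by
  have hcover : ∀ z : ℂ, ∃ σ, z ∈ closedSector σ := by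
    intro z
    rcases le_total z.re 0 with h1 | h1
    · exact ⟨0, h1⟩
    · rcases le_total z.im 0 with h2 | h2
      · exact ⟨2, h1, h2⟩
      · exact ⟨1, h1, h2⟩
  intro z
  obtain ⟨σ, hσ⟩ := hcover z
  exact closure_mono (fun w hw => sector_notMem_tee hw) (closedSector_subset_closure σ hσ)

/-- Any two of the three sectors share an edge of the T, and a point in the interior of this edge
avoids the third closed sector. With four sectors at a point, opposite ones would meet at the origin
only. -/
theorem exists_mem_two_sectors {σ σ' : Fin 3} (hne : σ ≠ σ') {ε : ℝ} (hε : 0 < ε) :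
    ∃ z ∈ Metric.ball (0 : ℂ) ε, z ∈ closedSector σ ∧ z ∈ closedSector σ' ∧
      ∀ ρ, z ∈ closedSector ρ → ρ = σ ∨ ρ = σ' := by
  have key : ∀ z : ℂ, ‖z‖ = ε / 2 → z ∈ Metric.ball (0 : ℂ) ε := by
    intro z hz
    rw [mem_ball_zero_iff, hz]; linarith
  have e1 : ‖(⟨0, ε / 2⟩ : ℂ)‖ = ε / 2 := by
    rw [show (⟨0, ε / 2⟩ : ℂ) = (ε / 2 : ℝ) * Complex.I by apply Complex.ext <;> simp]
    rw [norm_mul, Complex.norm_I, mul_one, Complex.norm_real, Real.norm_of_nonneg (by linarith)]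
  have e2 : ‖(⟨0, -(ε / 2)⟩ : ℂ)‖ = ε / 2 := by
    rw [show (⟨0, -(ε / 2)⟩ : ℂ) = -⟨0, ε / 2⟩ by apply Complex.ext <;> simp, norm_neg, e1]
  have e3 : ‖(⟨ε / 2, 0⟩ : ℂ)‖ = ε / 2 := by
    rw [show (⟨ε / 2, 0⟩ : ℂ) = (ε / 2 : ℝ) by apply Complex.ext <;> simp, Complex.norm_real,
      Real.norm_of_nonneg (by linarith)]
  have hε2 : 0 < ε / 2 := by linarith
  fin_cases σ <;> fin_cases σ' <;> simp only [ne_eq, not_true_eq_false] at hne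
  · refine ⟨_, key _ e1, ?_, ?_, ?_⟩
    · simp [closedSector]
    · simp [closedSector]; linarith
    · intro ρ hρ; fin_cases ρ <;> simp [closedSector] at hρ ⊢; linarith
  · refine ⟨_, key _ e2, ?_, ?_, ?_⟩
    · simp [closedSector]
    · simp [closedSector]; linarith
    · intro ρ hρ; fin_cases ρ <;> simp [closedSector] at hρ ⊢; linarith
  · refine ⟨_, key _ e1, ?_, ?_, ?_⟩
    · simp [closedSector]; linarith
    · simp [closedSector]
    · intro ρ hρ; fin_cases ρ <;> simp [closedSector] at hρ ⊢; linarith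
  · refine ⟨_, key _ e3, ?_, ?_, ?_⟩
    · simp [closedSector]; linarith
    · simp [closedSector]; linarith
    · intro ρ hρ; fin_cases ρ <;> simp [closedSector] at hρ ⊢; linarith
  · refine ⟨_, key _ e2, ?_, ?_, ?_⟩
    · simp [closedSector]; linarith
    · simp [closedSector]
    · intro ρ hρ; fin_cases ρ <;> simp [closedSector] at hρ ⊢; linarith
  · refine ⟨_, key _ e3, ?_, ?_, ?_⟩
    · simp [closedSector]; linarith
    · simp [closedSector]; linarith
    · intro ρ hρ; fin_cases ρ <;> simp [closedSector] at hρ ⊢; linarith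

/-- The homeomorphism of the plane straightening a right angle. -/
noncomputable def bend : ℂ ≃ₜ ℂ where
  toFun z := ⟨z.re + z.im, z.re - z.im - |z.re + z.im|⟩
  invFun w := ⟨(w.re + (w.im + |w.re|)) / 2, (w.re - (w.im + |w.re|)) / 2⟩
  left_inv z := by apply Complex.ext <;> simp
  right_inv w := by
    have : (w.re + (w.im + |w.re|)) / 2 + (w.re - (w.im + |w.re|)) / 2 = w.re := by ring
    apply Complex.ext
    · simp only [this]
    · simp only [this]; ring
  continuous_toFun := by
    refine Complex.equivRealProdCLM.symm.continuous.comp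
      (f := fun z : ℂ => (z.re + z.im, z.re - z.im - |z.re + z.im|)) ?_
    fun_prop
  continuous_invFun := by
    refine Complex.equivRealProdCLM.symm.continuous.comp
      (f := fun w : ℂ => ((w.re + (w.im + |w.re|)) / 2, (w.re - (w.im + |w.re|)) / 2)) ?_
    fun_prop

theorem bend_zero : bend 0 = 0 := by
  apply Complex.ext
  · change (0 : ℝ) + 0 = 0; simp
  · change (0 : ℝ) - 0 - |0 + 0| = 0; simp

/-- The homeomorphism of the plane sending `teeModel` onto `triodModel`. -/
noncomputable def teeToTriod : ℂ ≃ₜ ℂ where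
  toFun z := ⟨z.re - |z.im| / √3, z.im⟩
  invFun w := ⟨w.re + |w.im| / √3, w.im⟩
  left_inv z := by apply Complex.ext <;> simp
  right_inv w := by apply Complex.ext <;> simp
  continuous_toFun := by
    refine Complex.equivRealProdCLM.symm.continuous.comp
      (f := fun z : ℂ => (z.re - |z.im| / √3, z.im)) ?_
    fun_prop
  continuous_invFun := by
    refine Complex.equivRealProdCLM.symm.continuous.comp
      (f := fun z : ℂ => (z.re + |z.im| / √3, z.im)) ?_
    fun_prop

theorem teeToTriod_re (z : ℂ) : (teeToTriod z).re = z.re - |z.im| / √3 := rfl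

theorem teeToTriod_im (z : ℂ) : (teeToTriod z).im = z.im := rfl

theorem teeToTriod_mem (z : ℂ) : teeToTriod z ∈ triodModel ↔ z ∈ teeModel := by
  have h3 : √3 * √3 = 3 := Real.mul_self_sqrt (by norm_num)
  have h30 : 0 < √3 := by positivity
  constructor
  · rintro ⟨r, ζ, hr, hζ, hz⟩
    have hre : z.re - |z.im| / √3 = r * ζ.re := by
      have := congrArg Complex.re hz
      rwa [teeToTriod_re, Complex.re_ofReal_mul] at this
    have him : z.im = r * ζ.im := by
      have := congrArg Complex.im hz
      rwa [teeToTriod_im, Complex.im_ofReal_mul] at this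
    have h1 : (ζ - 1) * (ζ ^ 2 + ζ + 1) = 0 := by linear_combination hζ
    rcases mul_eq_zero.1 h1 with h1 | h1
    · have : ζ = 1 := by linear_combination h1
      subst this
      simp at hre him
      rw [him] at hre
      simp at hre
      exact Or.inr ⟨him, by rw [hre]; exact hr⟩
    · left
      have ere := congrArg Complex.re h1
      have eim := congrArg Complex.im h1
      simp [pow_two] at ere eim
      have hi0 : ζ.im ≠ 0 := by
        intro h0
        rw [h0] at ere
        nlinarith [sq_nonneg (ζ.re + 1 / 2)]
      have hre2 : ζ.re = -1 / 2 := by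
        have : ζ.im * (2 * ζ.re + 1) = 0 := by linear_combination eim
        rcases mul_eq_zero.1 this with h | h
        · exact (hi0 h).elim
        · linarith
      have him2 : |ζ.im| = √3 / 2 := by
        rw [hre2] at ere
        have : ζ.im ^ 2 = (√3 / 2) ^ 2 := by nlinarith
        rw [← sq_abs] at this
        exact (pow_left_inj₀ (abs_nonneg _) (by positivity) two_ne_zero).1 this
      rw [him, abs_mul, him2, abs_of_nonneg hr, hre2] at hre
      have : r * (√3 / 2) / √3 = r / 2 := by field_simp
      rw [this] at hre
      linarith
  · have hcube : ∀ t : ℝ, t * t = 3 / 4 → (⟨-1 / 2, t⟩ : ℂ) ^ 3 = 1 := by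
      intro t ht
      apply Complex.ext
      · simp [pow_succ]; linear_combination (3 / 2) * ht
      · simp [pow_succ]; linear_combination (-t) * ht
    rintro (h1 | ⟨h1, h2⟩)
    · rcases le_total 0 z.im with h2 | h2
      · refine ⟨2 * z.im / √3, ⟨-1 / 2, √3 / 2⟩, by positivity, hcube _ (by linarith), ?_⟩
        apply Complex.ext
        · rw [teeToTriod_re, Complex.re_ofReal_mul, h1, abs_of_nonneg h2]; field_simp; ring
        · rw [teeToTriod_im, Complex.im_ofReal_mul]; field_simp
      · refine ⟨2 * (-z.im) / √3, ⟨-1 / 2, -(√3 / 2)⟩, ?_, hcube _ (by linarith), ?_⟩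
        · have : 0 ≤ -z.im := by linarith
          positivity
        apply Complex.ext
        · rw [teeToTriod_re, Complex.re_ofReal_mul, h1, abs_of_nonpos h2]; field_simp; ring
        · rw [teeToTriod_im, Complex.im_ofReal_mul]; field_simp
    · refine ⟨z.re, 1, h2, by simp, ?_⟩
      apply Complex.ext
      · rw [teeToTriod_re, h1]; simp
      · rw [teeToTriod_im, h1]; simp

end BrickDecomposition

/-! ### Tilings with T-shaped junctions, and the graphs of their coarsenings. -/

namespace BrickDecomposition

open Set Topology

theorem isOpen_domain {h : S2 ≃ₜ S2} : IsOpen (domain h) :=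
  (isClosed_fixedPoints h.continuous).isOpen_compl

/-- A family of disjoint connected open sets whose closures avoid the fixed points, and whose
complement is locally contained in a copy of `teeModel`. -/
structure IsTiling (h : S2 ≃ₜ S2) {ι : Type*} (V : ι → Set S2) : Prop where
  isOpen : ∀ i, IsOpen (V i)
  isPreconnected : ∀ i, IsPreconnected (V i)
  nonempty : ∀ i, (V i).Nonempty
  disjoint : ∀ i j, i ≠ j → Disjoint (V i) (V j)
  closure_subset : ∀ i, closure (V i) ⊆ domain h
  chart : ∀ x ∈ domain h, ∃ φ : OpenPartialHomeomorph S2 ℂ, x ∈ φ.source ∧ φ x = 0 ∧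
    ∀ y ∈ φ.source, y ∈ domain h → φ y ∉ teeModel → ∃ i, y ∈ V i

variable {h : S2 ≃ₜ S2} {ι : Type*} {V : ι → Set S2}

theorem IsTiling.eq_of_mem (H : IsTiling h V) {i j : ι} {x : S2} (hi : x ∈ V i) (hj : x ∈ V j) :
    i = j := by
  by_contra hne
  exact Set.disjoint_left.1 (H.disjoint i j hne) hi hj

/-- A chart in which every sector is contained in a tile. -/
structure SectorChart (h : S2 ≃ₜ S2) (V : ι → Set S2) (φ : OpenPartialHomeomorph S2 ℂ) (ε : ℝ)
    (τ : Fin 3 → ι) : Prop where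
  pos : 0 < ε
  source_subset : φ.source ⊆ domain h
  target : φ.target = Metric.ball 0 ε
  sector : ∀ σ, ∀ y ∈ φ.source, φ y ∈ sector σ → y ∈ V (τ σ)

/-- The chart is shrunk so that its image is a ball. A sector then meets the image in a convex,
hence connected, set covered by disjoint open tiles, so it lies in one of them. -/
theorem IsTiling.exists_sectorChart (H : IsTiling h V) {x : S2} (hx : x ∈ domain h) :
    ∃ φ ε τ, SectorChart h V φ ε τ ∧ x ∈ φ.source ∧ φ x = 0 := by
  obtain ⟨φ₀, hx₀, hφx₀, hφ₀⟩ := H.chart x hx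
  have hnhds : φ₀.target ∩ φ₀.symm ⁻¹' domain h ∈ 𝓝 (0 : ℂ) := by
    refine (φ₀.isOpen_inter_preimage_symm isOpen_domain).mem_nhds ⟨?_, ?_⟩
    · rw [← hφx₀]; exact φ₀.map_source hx₀
    · rw [mem_preimage, ← hφx₀, φ₀.left_inv hx₀]; exact hx
  obtain ⟨ε, hε, hball⟩ := Metric.mem_nhds_iff.1 hnhds
  have hopen : IsOpen (φ₀.source ∩ φ₀ ⁻¹' Metric.ball 0 ε) :=
    φ₀.isOpen_inter_preimage Metric.isOpen_ball
  set φ := φ₀.restrOpen _ hopen with hφ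
  have hsource : φ.source = φ₀.source ∩ φ₀ ⁻¹' Metric.ball 0 ε := by
    rw [hφ, φ₀.restrOpen_source, ← inter_assoc, inter_self]
  have hcoe : ∀ y, φ y = φ₀ y := fun y => rfl
  have htarget : φ.target = Metric.ball 0 ε := by
    rw [← φ.image_source_eq_target, hsource]
    ext z
    constructor
    · rintro ⟨y, hy, rfl⟩; exact hy.2
    · intro hz
      refine ⟨φ₀.symm z, ⟨φ₀.map_target (hball hz).1, ?_⟩, ?_⟩
      · rw [mem_preimage, φ₀.right_inv (hball hz).1]; exact hz
      · rw [hcoe, φ₀.right_inv (hball hz).1]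
  have hsub : φ.source ⊆ domain h := by
    intro y hy
    rw [hsource] at hy
    have := (hball hy.2).2
    rwa [mem_preimage, φ₀.left_inv hy.1] at this
  have hτ : ∀ σ, ∃ i, ∀ y ∈ φ.source, φ y ∈ BrickDecomposition.sector σ → y ∈ V i := by
    intro σ
    set A : Set S2 := φ.symm '' (BrickDecomposition.sector σ ∩ Metric.ball 0 ε) with hA
    have hAc : IsPreconnected A := by
      refine ((convex_sector σ).inter (convex_ball 0 ε)).isPreconnected.image _ ?_
      exact φ.continuousOn_symm.mono (by rw [htarget]; exact inter_subset_right)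
    have hAV : ∀ y ∈ A, ∃ i, y ∈ V i := by
      rintro _ ⟨z, ⟨hz, hzb⟩, rfl⟩
      have hz' : z ∈ φ.target := by rwa [htarget]
      have hs := φ.map_target hz'
      refine hφ₀ _ ?_ (hsub hs) ?_
      · rw [hsource] at hs; exact hs.1
      · rw [← hcoe, φ.right_inv hz']; exact sector_notMem_tee hz
    obtain ⟨z, hz, hzσ⟩ : (Metric.ball (0 : ℂ) ε ∩ BrickDecomposition.sector σ).Nonempty :=
      mem_closure_iff.1 (closedSector_subset_closure σ (zero_mem_closedSector σ)) _
        Metric.isOpen_ball (Metric.mem_ball_self hε)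
    have hzA : φ.symm z ∈ A := ⟨z, ⟨hzσ, hz⟩, rfl⟩
    obtain ⟨i, hi⟩ := hAV _ hzA
    refine ⟨i, fun y hy hyσ => ?_⟩
    have hsubA : A ⊆ V i := by
      refine hAc.subset_left_of_subset_union (H.isOpen i)
        (isOpen_iUnion fun j => isOpen_iUnion fun (_ : j ≠ i) => H.isOpen j) ?_ ?_ ⟨_, hzA, hi⟩
      · exact disjoint_iUnion₂_right.2 fun j hj => H.disjoint i j hj.symm
      · intro y hy
        obtain ⟨j, hj⟩ := hAV y hy
        by_cases hji : j = i
        · exact Or.inl (hji ▸ hj)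
        · exact Or.inr (mem_iUnion₂.2 ⟨j, hji, hj⟩)
    refine hsubA ⟨φ y, ⟨hyσ, ?_⟩, φ.left_inv hy⟩
    rw [← htarget]; exact φ.map_source hy
  choose τ hτ using hτ
  refine ⟨φ, ε, τ, ⟨hε, hsub, htarget, hτ⟩, ?_, hφx₀⟩
  rw [hsource]
  exact ⟨hx₀, by rw [mem_preimage, hφx₀]; exact Metric.mem_ball_self hε⟩

/-- The T has empty interior, so near a point of the chart a tile is seen through its traces on the
sectors, and each sector is contained in exactly one tile. Closures of tiles are thus read off the
closed sectors. As every closed sector contains `0`, every tile whose closure meets the chart has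
the centre in its closure, which yields local finiteness. -/
theorem SectorChart.mem_closure_iff (H : IsTiling h V) {φ : OpenPartialHomeomorph S2 ℂ} {ε : ℝ}
    {τ : Fin 3 → ι} (C : SectorChart h V φ ε τ) {y : S2} (hy : y ∈ φ.source) (i : ι) :
    y ∈ closure (V i) ↔ ∃ σ, φ y ∈ closedSector σ ∧ τ σ = i := by
  constructor
  · intro hyi
    have hdense : y ∈ closure (⋃ σ, V i ∩ (φ.source ∩ φ ⁻¹' BrickDecomposition.sector σ)) := by
      rw [_root_.mem_closure_iff]
      intro o ho hyo
      obtain ⟨z, ⟨hzo, hzs⟩, hzi⟩ := _root_.mem_closure_iff.1 hyi (o ∩ φ.source)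
        (ho.inter φ.open_source) ⟨hyo, hy⟩
      have hopen : IsOpen (φ.target ∩ φ.symm ⁻¹' (o ∩ V i)) :=
        φ.isOpen_inter_preimage_symm (ho.inter (H.isOpen i))
      obtain ⟨w, hw, hwt⟩ := dense_compl_tee.inter_open_nonempty _ hopen
        ⟨φ z, φ.map_source hzs, by rw [mem_preimage, φ.left_inv hzs]; exact ⟨hzo, hzi⟩⟩
      obtain ⟨σ, hσ⟩ := exists_mem_sector_of_notMem hwt
      refine ⟨φ.symm w, hw.2.1, mem_iUnion.2 ⟨σ, hw.2.2, φ.map_target hw.1, ?_⟩⟩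
      rw [mem_preimage, φ.right_inv hw.1]; exact hσ
    rw [closure_iUnion_of_finite, mem_iUnion] at hdense
    obtain ⟨σ, hσ⟩ := hdense
    refine ⟨σ, ?_, ?_⟩
    · have hc : ContinuousAt φ y := φ.continuousAt hy
      have := mem_closure_image hc hσ
      refine (isClosed_closedSector σ).closure_subset_iff.2 ?_ this
      rintro _ ⟨z, hz, rfl⟩
      exact sector_subset_closedSector σ hz.2.2
    · obtain ⟨z, hz⟩ := closure_nonempty_iff.1 ⟨y, hσ⟩
      exact H.eq_of_mem (C.sector σ z hz.2.1 hz.2.2) hz.1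
  · rintro ⟨σ, hσ, rfl⟩
    rw [_root_.mem_closure_iff]
    intro o ho hyo
    have hopen : IsOpen (φ.target ∩ φ.symm ⁻¹' o) := φ.isOpen_inter_preimage_symm ho
    obtain ⟨w, hw, hwσ⟩ := _root_.mem_closure_iff.1 (closedSector_subset_closure σ hσ) _ hopen
      ⟨φ.map_source hy, by rwa [mem_preimage, φ.left_inv hy]⟩
    refine ⟨φ.symm w, hw.2, C.sector σ _ (φ.map_target hw.1) ?_⟩
    rwa [φ.right_inv hw.1]

namespace IsTiling

variable (H : IsTiling h V)
include H

theorem exists_mem_closure {x : S2} (hx : x ∈ domain h) : ∃ i, x ∈ closure (V i) := by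
  obtain ⟨φ, ε, τ, C, hxs, hx0⟩ := H.exists_sectorChart hx
  exact ⟨τ 0, (C.mem_closure_iff H hxs _).2 ⟨0, by rw [hx0]; exact zero_mem_closedSector 0, rfl⟩⟩

/-- The union of the closures of any family of tiles is closed in the domain. -/
theorem closure_biUnion (J : Set ι) :
    closure (⋃ i ∈ J, closure (V i)) ∩ domain h ⊆ ⋃ i ∈ J, closure (V i) := by
  rintro x ⟨hx, hxU⟩
  obtain ⟨φ, ε, τ, C, hxs, hx0⟩ := H.exists_sectorChart hxU
  obtain ⟨y, hys, hy⟩ := mem_closure_iff.1 hx _ φ.open_source hxs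
  obtain ⟨i, hi, hyi⟩ := mem_iUnion₂.1 hy
  obtain ⟨σ, -, rfl⟩ := (C.mem_closure_iff H hys i).1 hyi
  exact mem_iUnion₂.2 ⟨_, hi, (C.mem_closure_iff H hxs _).2
    ⟨σ, by rw [hx0]; exact zero_mem_closedSector σ, rfl⟩⟩

end IsTiling

/-- The union of the closures of the tiles equivalent to the tile `i`. -/
def brickOf (V : ι → Set S2) (r : Setoid ι) (i : ι) : Set S2 := ⋃ j ∈ {j | r i j}, closure (V j)

/-- The interior of `brickOf V r i`. -/
def openBrickOf (h : S2 ≃ₜ S2) (V : ι → Set S2) (r : Setoid ι) (i : ι) : Set S2 :=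
  {x | x ∈ domain h ∧ ∀ j, x ∈ closure (V j) → r i j}

/-- The points common to the closures of two inequivalent tiles. -/
def graphOf (V : ι → Set S2) (r : Setoid ι) : Set S2 :=
  {x | ∃ i j, ¬ r i j ∧ x ∈ closure (V i) ∧ x ∈ closure (V j)}

section Graph

variable {r : Setoid ι}

theorem mem_brickOf {i : ι} {x : S2} : x ∈ brickOf V r i ↔ ∃ j, r i j ∧ x ∈ closure (V j) := by
  simp [brickOf]

theorem brickOf_congr {i j : ι} (hij : r i j) : brickOf V r i = brickOf V r j := by
  ext x
  simp only [mem_brickOf]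
  exact ⟨fun ⟨k, hk, hx⟩ => ⟨k, r.trans' (r.symm' hij) hk, hx⟩,
    fun ⟨k, hk, hx⟩ => ⟨k, r.trans' hij hk, hx⟩⟩

theorem brickOf_subset (H : IsTiling h V) (i : ι) : brickOf V r i ⊆ domain h :=
  iUnion₂_subset fun j _ => H.closure_subset j

theorem isOpen_openBrickOf (H : IsTiling h V) (i : ι) : IsOpen (openBrickOf h V r i) := by
  rw [isOpen_iff_mem_nhds]
  rintro x ⟨hxU, hx⟩
  obtain ⟨φ, ε, τ, C, hxs, hx0⟩ := H.exists_sectorChart hxU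
  refine Filter.mem_of_superset (φ.open_source.mem_nhds hxs) fun y hy =>
    ⟨C.source_subset hy, fun j hj => ?_⟩
  obtain ⟨σ, -, rfl⟩ := (C.mem_closure_iff H hy j).1 hj
  exact hx _ ((C.mem_closure_iff H hxs _).2 ⟨σ, by rw [hx0]; exact zero_mem_closedSector σ, rfl⟩)

theorem subset_openBrickOf (H : IsTiling h V) (i : ι) : V i ⊆ openBrickOf h V r i := by
  refine fun y hy => ⟨H.closure_subset i (subset_closure hy), fun j hj => ?_⟩
  obtain ⟨z, hz, hz'⟩ := mem_closure_iff.1 hj _ (H.isOpen i) hy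
  rw [H.eq_of_mem hz hz']

theorem openBrickOf_congr {i j : ι} (hij : r i j) :
    openBrickOf h V r i = openBrickOf h V r j := by
  ext x
  exact ⟨fun ⟨h1, h2⟩ => ⟨h1, fun k hk => r.trans' (r.symm' hij) (h2 k hk)⟩,
    fun ⟨h1, h2⟩ => ⟨h1, fun k hk => r.trans' hij (h2 k hk)⟩⟩

theorem openBrickOf_subset (H : IsTiling h V) (i : ι) :
    openBrickOf h V r i ⊆ brickOf V r i := by
  rintro x ⟨hx, hx'⟩
  obtain ⟨j, hj⟩ := H.exists_mem_closure hx
  exact mem_brickOf.2 ⟨j, hx' j hj, hj⟩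

/-- Passing to the interior does not disconnect a class: if the closures of two of its tiles meet at
a point, the tiles share an edge ending there or passing through there, and the edge points that
belong to no other tile are interior to the class. -/
theorem isPreconnected_openBrickOf (H : IsTiling h V) {i : ι} (hc : IsClosed (brickOf V r i))
    (hB : IsPreconnected (brickOf V r i)) : IsPreconnected (openBrickOf h V r i) := by
  intro u v hu hv hcov hWu hWv
  by_contra hcon
  rw [not_nonempty_iff_eq_empty] at hcon
  have hV : ∀ j, r i j → V j ⊆ openBrickOf h V r i := fun j hj => by
    rw [openBrickOf_congr hj]; exact subset_openBrickOf H j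
  have hside : ∀ j, r i j → V j ⊆ u ∨ V j ⊆ v := fun j hj =>
    isPreconnected_iff_subset_of_disjoint.1 (H.isPreconnected j) u v hu hv
      ((hV j hj).trans hcov) (subset_empty_iff.1
        ((inter_subset_inter_left _ (hV j hj)).trans hcon.subset))
  have hnot : ∀ j, r i j → ∀ y ∈ V j, y ∈ u → y ∈ v → False := fun j hj y hy hyu hyv => by
    have : y ∈ openBrickOf h V r i ∩ (u ∩ v) := ⟨hV j hj hy, hyu, hyv⟩
    rw [hcon] at this
    exact this
  have hclosed : ∀ J : Set ι, (∀ j ∈ J, r i j) → IsClosed (⋃ j ∈ J, closure (V j)) := by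
    intro J hJ
    refine isClosed_of_closure_subset fun x hx => H.closure_biUnion J ⟨hx, ?_⟩
    have : (⋃ j ∈ J, closure (V j)) ⊆ brickOf V r i :=
      iUnion₂_subset fun j hj x hx => mem_brickOf.2 ⟨j, hJ j hj, hx⟩
    exact brickOf_subset H i (hc.closure_subset_iff.2 this hx)
  have hne : ∀ w : Set S2, IsOpen w → (openBrickOf h V r i ∩ w).Nonempty →
      ∃ j, r i j ∧ ∃ y ∈ V j, y ∈ w := by
    rintro w hw ⟨x, ⟨hxU, hx⟩, hxw⟩
    obtain ⟨j, hj⟩ := H.exists_mem_closure hxU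
    obtain ⟨y, hy, hy'⟩ := mem_closure_iff.1 hj _ hw hxw
    exact ⟨j, hx j hj, y, hy', hy⟩
  -- The tiles of the class are divided between `u` and `v`. The unions of their closures are closed
  -- and cover the connected class, so a tile on one side touches a tile on the other.
  obtain ⟨x, hxB, hx1, hx2⟩ := isPreconnected_closed_iff.1 hB _ _
    (hclosed {j | r i j ∧ V j ⊆ u} fun j hj => hj.1)
    (hclosed {j | r i j ∧ V j ⊆ v} fun j hj => hj.1)
    (by
      intro x hx
      obtain ⟨j, hj, hxj⟩ := mem_brickOf.1 hx
      rcases hside j hj with h1 | h1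
      · exact Or.inl (mem_iUnion₂.2 ⟨j, ⟨hj, h1⟩, hxj⟩)
      · exact Or.inr (mem_iUnion₂.2 ⟨j, ⟨hj, h1⟩, hxj⟩))
    (by
      obtain ⟨j, hj, y, hy, hyu⟩ := hne u hu hWu
      have hju : V j ⊆ u := (hside j hj).resolve_right fun h1 => hnot j hj y hy hyu (h1 hy)
      have := subset_closure hy
      exact ⟨y, mem_brickOf.2 ⟨j, hj, this⟩, mem_iUnion₂.2 ⟨j, ⟨hj, hju⟩, this⟩⟩)
    (by
      obtain ⟨j, hj, y, hy, hyv⟩ := hne v hv hWv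
      have hjv : V j ⊆ v := (hside j hj).resolve_left fun h1 => hnot j hj y hy (h1 hy) hyv
      have := subset_closure hy
      exact ⟨y, mem_brickOf.2 ⟨j, hj, this⟩, mem_iUnion₂.2 ⟨j, ⟨hj, hjv⟩, this⟩⟩)
  obtain ⟨j, ⟨hj, hju⟩, hxj⟩ := mem_iUnion₂.1 hx1
  obtain ⟨k, ⟨hk, hkv⟩, hxk⟩ := mem_iUnion₂.1 hx2
  obtain ⟨φ, ε, τ, C, hxs, hx0⟩ := H.exists_sectorChart (brickOf_subset H i hxB)
  obtain ⟨σ, -, rfl⟩ := (C.mem_closure_iff H hxs j).1 hxj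
  obtain ⟨σ', -, rfl⟩ := (C.mem_closure_iff H hxs k).1 hxk
  have hσ : σ ≠ σ' := by
    rintro rfl
    obtain ⟨y, hy⟩ := H.nonempty (τ σ)
    exact hnot _ hj y hy (hju hy) (hkv hy)
  -- A point of the edge common to the two sectors: it is interior to the class, so it is in `u` or
  -- in `v`, although it is adherent to tiles on both sides.
  obtain ⟨z, hz, hzσ, hzσ', hzρ⟩ := exists_mem_two_sectors hσ C.pos
  rw [← C.target] at hz
  have hys := φ.map_target hz
  have hzy := φ.right_inv hz
  have hyj : φ.symm z ∈ closure (V (τ σ)) :=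
    (C.mem_closure_iff H hys _).2 ⟨σ, by rwa [hzy], rfl⟩
  have hyk : φ.symm z ∈ closure (V (τ σ')) :=
    (C.mem_closure_iff H hys _).2 ⟨σ', by rwa [hzy], rfl⟩
  have hyW : φ.symm z ∈ openBrickOf h V r i := by
    refine ⟨C.source_subset hys, fun l hl => ?_⟩
    obtain ⟨ρ, hρ, rfl⟩ := (C.mem_closure_iff H hys l).1 hl
    rw [hzy] at hρ
    rcases hzρ ρ hρ with rfl | rfl
    · exact hj
    · exact hk
  rcases hcov hyW with hyu | hyv
  · obtain ⟨y, hy, hy'⟩ := mem_closure_iff.1 hyk _ hu hyu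
    exact hnot _ hk y hy' hy (hkv hy')
  · obtain ⟨y, hy, hy'⟩ := mem_closure_iff.1 hyj _ hv hyv
    exact hnot _ hj y hy' (hju hy') hy

theorem domain_diff_graphOf (H : IsTiling h V) :
    domain h \ graphOf V r = ⋃ i, openBrickOf h V r i := by
  ext x
  simp only [mem_iUnion]
  constructor
  · rintro ⟨hxU, hx⟩
    obtain ⟨j, hj⟩ := H.exists_mem_closure hxU
    refine ⟨j, hxU, fun k hk => ?_⟩
    by_contra hcon
    exact hx ⟨j, k, hcon, hj, hk⟩
  · rintro ⟨i, hxU, hx⟩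
    refine ⟨hxU, fun ⟨j, k, hjk, hj, hk⟩ => hjk (r.trans' (r.symm' (hx j hj)) (hx k hk))⟩

/-- The interiors of distinct classes are disjoint open sets covering the complement of the graph,
and each is connected, so they are its components. The closure of such an interior is the whole
class because it contains the tiles. -/
theorem isBrick_graphOf (H : IsTiling h V) (hc : ∀ i, IsClosed (brickOf V r i))
    (hB : ∀ i, IsPreconnected (brickOf V r i)) {B : Set S2} (hBr : IsBrick h (graphOf V r) B) :
    ∃ i, B = brickOf V r i := by
  obtain ⟨x, hx, rfl⟩ := hBr
  have hx' := hx
  rw [domain_diff_graphOf H] at hx ⊢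
  obtain ⟨i, hi⟩ := mem_iUnion.1 hx
  refine ⟨i, ?_⟩
  have hcomp : connectedComponentIn (⋃ i, openBrickOf h V r i) x = openBrickOf h V r i := by
    apply subset_antisymm
    · refine isPreconnected_connectedComponentIn.subset_left_of_subset_union
        (isOpen_openBrickOf H i) (isOpen_iUnion fun j => isOpen_iUnion fun (_ : ¬ r i j) =>
          isOpen_openBrickOf (r := r) H j) ?_ ?_ ⟨x, mem_connectedComponentIn hx, hi⟩
      · refine disjoint_iUnion₂_right.2 fun j hj => Set.disjoint_left.2 fun y hy hy' => hj ?_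
        obtain ⟨k, hk⟩ := H.exists_mem_closure hy.1
        exact r.trans' (hy.2 k hk) (r.symm' (hy'.2 k hk))
      · intro y hy
        obtain ⟨j, hj⟩ := mem_iUnion.1 (connectedComponentIn_subset _ _ hy)
        by_cases hij : r i j
        · left; rwa [openBrickOf_congr hij]
        · exact Or.inr (mem_iUnion₂.2 ⟨j, hij, hj⟩)
    · exact (isPreconnected_openBrickOf H (hc i) (hB i)).subset_connectedComponentIn hi
        (subset_iUnion _ i)
  rw [hcomp]
  apply subset_antisymm
  · exact inter_subset_left.trans ((hc i).closure_subset_iff.2 (openBrickOf_subset H i))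
  · refine subset_inter ?_ (brickOf_subset H i)
    intro y hy
    obtain ⟨j, hj, hyj⟩ := mem_brickOf.1 hy
    rw [openBrickOf_congr hj]
    exact closure_mono (subset_openBrickOf H j) hyj

theorem looksLike_of_homeomorph {F : Set S2} {x : S2} {M : Set ℂ}
    {φ : OpenPartialHomeomorph S2 ℂ} (hx : x ∈ φ.source) (hx0 : φ x = 0) (ψ : ℂ ≃ₜ ℂ)
    (hψ : ψ 0 = 0) (hF : ∀ y ∈ φ.source, ψ (φ y) ∈ M ↔ y ∈ F) : LooksLike F x M := by
  refine ⟨φ.transHomeomorph ψ, hx, ?_, fun y hy => ?_⟩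
  · simp [hx0, hψ]
  · exact hF y hy

/-- An edge of the T belongs to the graph exactly when the two sectors it bounds are in different
classes. For a point of the graph, either two of the three sectors are equivalent and two edges
remain, forming a line after straightening, or all three edges remain and form a triod. -/
theorem isTriadicGraph_graphOf (H : IsTiling h V) : IsTriadicGraph h (graphOf V r) where
  subset_domain := fun x ⟨i, _, _, hi, _⟩ => H.closure_subset i hi
  closed_in_domain := by
    rintro x ⟨hx, hxU⟩
    obtain ⟨φ, ε, τ, C, hxs, hx0⟩ := H.exists_sectorChart hxU
    obtain ⟨y, hys, i, j, hij, hyi, hyj⟩ := mem_closure_iff.1 hx _ φ.open_source hxs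
    obtain ⟨σ, -, rfl⟩ := (C.mem_closure_iff H hys i).1 hyi
    obtain ⟨σ', -, rfl⟩ := (C.mem_closure_iff H hys j).1 hyj
    exact ⟨_, _, hij, (C.mem_closure_iff H hxs _).2
      ⟨σ, by rw [hx0]; exact zero_mem_closedSector σ, rfl⟩, (C.mem_closure_iff H hxs _).2
      ⟨σ', by rw [hx0]; exact zero_mem_closedSector σ', rfl⟩⟩
  local_model := by
    rintro x ⟨i, j, hij, hxi, hxj⟩
    obtain ⟨φ, ε, τ, C, hxs, hx0⟩ := H.exists_sectorChart (H.closure_subset i hxi)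
    obtain ⟨ρ, -, rfl⟩ := (C.mem_closure_iff H hxs i).1 hxi
    obtain ⟨ρ', -, rfl⟩ := (C.mem_closure_iff H hxs j).1 hxj
    have hmem : ∀ y ∈ φ.source, y ∈ graphOf V r ↔
        (¬ r (τ 0) (τ 1) ∧ (φ y).re = 0 ∧ 0 ≤ (φ y).im) ∨
        (¬ r (τ 0) (τ 2) ∧ (φ y).re = 0 ∧ (φ y).im ≤ 0) ∨
        (¬ r (τ 1) (τ 2) ∧ (φ y).im = 0 ∧ 0 ≤ (φ y).re) := by
      intro y hy
      constructor
      · rintro ⟨i, j, hij, hyi, hyj⟩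
        obtain ⟨σ, hσ, rfl⟩ := (C.mem_closure_iff H hy i).1 hyi
        obtain ⟨σ', hσ', rfl⟩ := (C.mem_closure_iff H hy j).1 hyj
        have hne : σ ≠ σ' := by rintro rfl; exact hij (r.refl' _)
        have hij' : ¬ r (τ σ') (τ σ) := fun h' => hij (r.symm' h')
        fin_cases σ <;> fin_cases σ' <;> simp [closedSector] at hσ hσ' hij hij' hne
        · exact Or.inl ⟨hij, le_antisymm hσ hσ'.1, hσ'.2⟩
        · exact Or.inr (Or.inl ⟨hij, le_antisymm hσ hσ'.1, hσ'.2⟩)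
        · exact Or.inl ⟨hij', le_antisymm hσ' hσ.1, hσ.2⟩
        · exact Or.inr (Or.inr ⟨hij, le_antisymm hσ'.2 hσ.2, hσ.1⟩)
        · exact Or.inr (Or.inl ⟨hij', le_antisymm hσ' hσ.1, hσ.2⟩)
        · exact Or.inr (Or.inr ⟨hij', le_antisymm hσ.2 hσ'.2, hσ.1⟩)
      · have hcl : ∀ σ, φ y ∈ closedSector σ → y ∈ closure (V (τ σ)) := fun σ hσ =>
          (C.mem_closure_iff H hy _).2 ⟨σ, hσ, rfl⟩
        rintro (⟨h1, h2, h3⟩ | ⟨h1, h2, h3⟩ | ⟨h1, h2, h3⟩)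
        · exact ⟨_, _, h1, hcl 0 h2.le, hcl 1 ⟨h2.ge, h3⟩⟩
        · exact ⟨_, _, h1, hcl 0 h2.le, hcl 2 ⟨h2.ge, h3⟩⟩
        · exact ⟨_, _, h1, hcl 1 ⟨h3, h2.ge⟩, hcl 2 ⟨h3, h2.le⟩⟩
    by_cases h01 : r (τ 0) (τ 1)
    · left
      by_cases h02 : r (τ 0) (τ 2)
      · exfalso
        apply hij
        have hall : ∀ σ, r (τ 0) (τ σ) := by
          intro σ
          fin_cases σ
          exacts [r.refl' _, h01, h02]
        exact r.trans' (r.symm' (hall ρ)) (hall ρ')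
      · have h12 : ¬ r (τ 1) (τ 2) := fun h' => h02 (r.trans' h01 h')
        refine looksLike_of_homeomorph hxs hx0 bend bend_zero ?_
        intro y hy
        rw [hmem y hy]
        change (φ y).re - (φ y).im - |(φ y).re + (φ y).im| = 0 ↔ _
        simp only [h01, h02, h12, not_true_eq_false, false_and, false_or, not_false_eq_true,
          true_and]
        constructor
        · intro h'
          rcases abs_cases ((φ y).re + (φ y).im) with ⟨h1, h2⟩ | ⟨h1, h2⟩ <;> rw [h1] at h'
          · right; constructor <;> linarith
          · left; constructor <;> linarith
        · rintro (⟨h1, h2⟩ | ⟨h1, h2⟩)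
          · rw [h1, zero_add, abs_of_nonpos h2]; ring
          · rw [h1, add_zero, abs_of_nonneg h2]; ring
    · by_cases h02 : r (τ 0) (τ 2)
      · left
        have h12 : ¬ r (τ 1) (τ 2) := fun h' => h01 (r.trans' h02 (r.symm' h'))
        refine looksLike_of_homeomorph hxs hx0
          (Complex.conjCLE.toHomeomorph.trans bend)
          (by simp [bend_zero]) ?_
        intro y hy
        rw [hmem y hy]
        change (φ y).re - (-(φ y).im) - |(φ y).re + (-(φ y).im)| = 0 ↔ _
        simp only [h01, h02, h12, not_true_eq_false, false_and, false_or, not_false_eq_true,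
          true_and]
        constructor
        · intro h'
          rcases abs_cases ((φ y).re + (-(φ y).im)) with ⟨h1, h2⟩ | ⟨h1, h2⟩ <;> rw [h1] at h'
          · right; constructor <;> linarith
          · left; constructor <;> linarith
        · rintro (⟨h1, h2⟩ | ⟨h1, h2⟩)
          · rw [h1, zero_add, abs_of_nonpos (by linarith)]; ring
          · rw [h1, neg_zero, add_zero, abs_of_nonneg h2]; ring
      · by_cases h12 : r (τ 1) (τ 2)
        · left
          refine looksLike_of_homeomorph hxs hx0
            -- Only the vertical line remains here; a quarter turn makes it horizontal.
            (Homeomorph.mulLeft₀ Complex.I Complex.I_ne_zero) (by simp) ?_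
          intro y hy
          rw [hmem y hy]
          simp only [h01, h02, h12, not_true_eq_false, false_and, or_false, not_false_eq_true,
            true_and, lineModel, mem_ofPred_eq, Homeomorph.coe_mulLeft₀, Complex.mul_im,
            Complex.I_re, Complex.I_im, zero_mul, one_mul, zero_add]
          constructor
          · exact fun h' => (le_total 0 (φ y).im).imp (fun h'' => ⟨h', h''⟩) fun h'' => ⟨h', h''⟩
          · rintro (h' | h') <;> exact h'.1
        · right
          refine looksLike_of_homeomorph hxs hx0 teeToTriod
            (by apply Complex.ext <;> simp [teeToTriod_re, teeToTriod_im]) ?_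
          intro y hy
          rw [hmem y hy, teeToTriod_mem]
          simp only [h01, h02, h12, not_false_eq_true, true_and, teeModel, mem_ofPred_eq]
          constructor
          · rintro (h' | h')
            · rcases le_total 0 (φ y).im with h'' | h''
              · exact Or.inl ⟨h', h''⟩
              · exact Or.inr (Or.inl ⟨h', h''⟩)
            · exact Or.inr (Or.inr h')
          · rintro (h' | h' | h')
            · exact Or.inl h'.1
            · exact Or.inl h'.1
            · exact Or.inr h'

end Graph

end BrickDecomposition

/-! ### The maximal coarsening. -/

namespace BrickDecomposition

open Set Topology

variable {h : S2 ≃ₜ S2} {ι : Type*} {V : ι → Set S2}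

/-- The setoid obtained from `r` by identifying the classes of `i` and `j`. -/
def joinClasses (r : Setoid ι) (i j : ι) : Setoid ι where
  r k l := r k l ∨ ((r i k ∨ r j k) ∧ (r i l ∨ r j l))
  iseqv := by
    refine ⟨fun k => Or.inl (r.refl' k), ?_, ?_⟩
    · rintro k l (hkl | ⟨h1, h2⟩)
      · exact Or.inl (r.symm' hkl)
      · exact Or.inr ⟨h2, h1⟩
    · rintro k l m (hkl | ⟨h1, h2⟩) (hlm | ⟨h3, h4⟩)
      · exact Or.inl (r.trans' hkl hlm)
      · exact Or.inr ⟨h3.imp (fun h' => r.trans' h' (r.symm' hkl))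
          (fun h' => r.trans' h' (r.symm' hkl)), h4⟩
      · exact Or.inr ⟨h1, h2.imp (fun h' => r.trans' h' hlm) (fun h' => r.trans' h' hlm)⟩
      · exact Or.inr ⟨h1, h4⟩

/-- The union of a chain of setoids. -/
def chainUnion (c : Set (Setoid ι)) (hc : IsChain (· ≤ ·) c) (hne : c.Nonempty) : Setoid ι where
  r k l := ∃ r ∈ c, r k l
  iseqv := by
    refine ⟨fun k => ?_, ?_, ?_⟩
    · obtain ⟨r, hr⟩ := hne
      exact ⟨r, hr, r.refl' k⟩
    · rintro k l ⟨r, hr, hkl⟩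
      exact ⟨r, hr, r.symm' hkl⟩
    · rintro k l m ⟨r, hr, hkl⟩ ⟨r', hr', hlm⟩
      rcases hc.total hr hr' with hle | hle
      · exact ⟨r', hr', r'.trans' (hle hkl) hlm⟩
      · exact ⟨r, hr, r.trans' hkl (hle hlm)⟩

/-- A tiling can be coarsened into a brick decomposition, provided the tiles with the same key
form connected free sets, and the free connected unions of such sets stay away from the
fixed points. -/
theorem IsTiling.exists_isBrickDecomposition (H : IsTiling h V) (r₀ : Setoid ι)
    (h₀ : ∀ i, IsPreconnected (brickOf V r₀ i) ∧ FreeSet h (brickOf V r₀ i))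
    (hcompact : ∀ J : Set ι, (∀ i ∈ J, ∀ j, r₀ i j → j ∈ J) →
      IsPreconnected (⋃ j ∈ J, closure (V j)) → FreeSet h (⋃ j ∈ J, closure (V j)) →
      Disjoint (closure (⋃ j ∈ J, closure (V j))) (Function.fixedPoints h)) :
    ∃ F, IsBrickDecomposition h F := by
  set P : Set (Setoid ι) := {r | r₀ ≤ r ∧
    ∀ i, IsPreconnected (brickOf V r i) ∧ FreeSet h (brickOf V r i)} with hP
  -- Connectedness and freeness both pass to increasing unions of classes. Keeping away from the
  -- fixed points would not pass to the limit by itself; it is not part of `P` and is deduced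
  -- afterwards from `hcompact`.
  obtain ⟨r, -, hr⟩ := zorn_le_nonempty₀ P (by
    intro c hcP hc r₁ hr₁
    refine ⟨chainUnion c hc ⟨r₁, hr₁⟩, ⟨?_, fun i => ⟨?_, ?_⟩⟩, ?_⟩
    · exact fun k l hkl => ⟨r₁, hr₁, (hcP hr₁).1 hkl⟩
    · have : brickOf V (chainUnion c hc ⟨r₁, hr₁⟩) i = ⋃₀ ((fun r => brickOf V r i) '' c) := by
        ext x
        simp only [mem_brickOf, sUnion_image, mem_iUnion, exists_prop]
        constructor
        · rintro ⟨j, ⟨r, hrc, hij⟩, hx⟩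
          exact ⟨r, hrc, j, hij, hx⟩
        · rintro ⟨r, hrc, j, hij, hx⟩
          exact ⟨j, ⟨r, hrc, hij⟩, hx⟩
      rw [this]
      obtain ⟨y, hy⟩ := H.nonempty i
      refine isPreconnected_sUnion y _ ?_ ?_
      · rintro _ ⟨r, -, rfl⟩
        exact mem_brickOf.2 ⟨i, r.refl' i, subset_closure hy⟩
      · rintro _ ⟨r, hrc, rfl⟩
        exact ((hcP hrc).2 i).1
    · intro x hx hx'
      obtain ⟨j, ⟨r, hrc, hij⟩, hxj⟩ := mem_brickOf.1 hx
      obtain ⟨k, ⟨r', hrc', hik⟩, hxk⟩ := mem_brickOf.1 hx'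
      rcases hc.total hrc hrc' with hle | hle
      · exact ((hcP hrc').2 i).2 x (mem_brickOf.2 ⟨j, hle hij, hxj⟩)
          (mem_brickOf.2 ⟨k, hik, hxk⟩)
      · exact ((hcP hrc).2 i).2 x (mem_brickOf.2 ⟨j, hij, hxj⟩)
          (mem_brickOf.2 ⟨k, hle hik, hxk⟩)
    · exact fun s hs k l hkl => ⟨s, hs, hkl⟩) r₀ ⟨le_rfl, h₀⟩
  have hrP : r ∈ P := hr.prop
  have hdisj : ∀ i, Disjoint (closure (brickOf V r i)) (Function.fixedPoints h) := fun i =>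
    hcompact {j | r i j} (fun k hk l hkl => r.trans' hk (hrP.1 hkl)) (hrP.2 i).1 (hrP.2 i).2
  -- By local finiteness a class is closed in the domain; as its closure contains no fixed point, it
  -- is closed in the sphere.
  have hclosed : ∀ i, IsClosed (brickOf V r i) := fun i =>
    isClosed_of_closure_subset fun x hx =>
      H.closure_biUnion _ ⟨hx, fun hx' => Set.disjoint_left.1 (hdisj i) hx hx'⟩
  have hbrick : ∀ B, IsBrick h (graphOf V r) B → ∃ i, B = brickOf V r i := fun B hB =>
    isBrick_graphOf H hclosed (fun i => (hrP.2 i).1) hB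
  have hfree : ∀ B, IsFree h B ↔ FreeSet h B := by
    intro B
    rw [IsFree, Set.disjoint_left]
    constructor
    · exact fun h1 x hx hx' => h1 hx' ⟨x, hx, rfl⟩
    · rintro h1 _ hx ⟨y, hy, rfl⟩
      exact h1 y hy hx
  refine ⟨graphOf V r, isTriadicGraph_graphOf H, ?_, ?_, ?_⟩
  · intro B hB
    obtain ⟨i, rfl⟩ := hbrick B hB
    exact hdisj i
  · intro B hB
    obtain ⟨i, rfl⟩ := hbrick B hB
    exact (hfree _).2 (hrP.2 i).2
  · rintro B B' hB hB' ⟨hne, x, hx, hx'⟩ hf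
    obtain ⟨i, rfl⟩ := hbrick B hB
    obtain ⟨j, rfl⟩ := hbrick B' hB'
    rw [hfree] at hf
    have hij : ¬ r i j := fun hij => hne (brickOf_congr hij)
    have hle : r ≤ joinClasses r i j := fun k l hkl => Or.inl hkl
    have hmem : joinClasses r i j ∈ P := by
      refine ⟨hrP.1.trans hle, fun k => ?_⟩
      by_cases hk : r i k ∨ r j k
      · have : brickOf V (joinClasses r i j) k = brickOf V r i ∪ brickOf V r j := by
          ext y
          simp only [mem_union, mem_brickOf]
          constructor
          · rintro ⟨l, hl | ⟨-, hl⟩, hy⟩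
            · rcases hk with hk | hk
              · exact Or.inl ⟨l, r.trans' hk hl, hy⟩
              · exact Or.inr ⟨l, r.trans' hk hl, hy⟩
            · exact hl.imp (fun hl => ⟨l, hl, hy⟩) (fun hl => ⟨l, hl, hy⟩)
          · rintro (⟨l, hl, hy⟩ | ⟨l, hl, hy⟩)
            · exact ⟨l, Or.inr ⟨hk, Or.inl hl⟩, hy⟩
            · exact ⟨l, Or.inr ⟨hk, Or.inr hl⟩, hy⟩
        rw [this]
        exact ⟨(hrP.2 i).1.union x hx hx' (hrP.2 j).1, hf⟩
      · have : brickOf V (joinClasses r i j) k = brickOf V r k := by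
          ext y
          simp only [mem_brickOf]
          constructor
          · rintro ⟨l, hl | ⟨hl, -⟩, hy⟩
            · exact ⟨l, hl, hy⟩
            · exact (hk hl).elim
          · rintro ⟨l, hl, hy⟩
            exact ⟨l, Or.inl hl, hy⟩
        rw [this]
        exact hrP.2 k
    -- Joining the classes of two adjacent bricks with free union would stay in `P`, so by
    -- maximality these classes are already equal.
    exact hij (hr.le_of_ge hmem hle (Or.inr ⟨Or.inl (r.refl' i), Or.inr (r.refl' j)⟩))

end BrickDecomposition

/-! ### Height functions as local coordinates on the sphere. -/

namespace BrickDecomposition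

open Set Topology

open scoped RealInnerProductSpace

/-- The Euclidean space containing the sphere. -/
abbrev E3 : Type := EuclideanSpace ℝ (Fin 3)

/-- Only the zero vector is orthogonal to `a`, `b` and `c`. -/
def Spans (a b c : E3) : Prop := ∀ v : E3, ⟪v, a⟫ = 0 → ⟪v, b⟫ = 0 → ⟪v, c⟫ = 0 → v = 0

theorem spans_of_det {a b c : E3}
    (hd : a 0 * (b 1 * c 2 - b 2 * c 1) - a 1 * (b 0 * c 2 - b 2 * c 0) +
      a 2 * (b 0 * c 1 - b 1 * c 0) ≠ 0) : Spans a b c := by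
  intro v h1 h2 h3
  simp only [PiLp.inner_apply, Fin.sum_univ_three, RCLike.inner_apply, conj_trivial] at *
  ext i
  refine (mul_eq_zero.1 ?_).resolve_left hd
  fin_cases i
  · change _ * v 0 = 0
    linear_combination (b 1 * c 2 - b 2 * c 1) * h1 + (c 1 * a 2 - c 2 * a 1) * h2 +
        (a 1 * b 2 - a 2 * b 1) * h3
  · change _ * v 1 = 0
    linear_combination (b 2 * c 0 - b 0 * c 2) * h1 + (c 2 * a 0 - c 0 * a 2) * h2 +
        (a 2 * b 0 - a 0 * b 2) * h3
  · change _ * v 2 = 0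
    linear_combination (b 0 * c 1 - b 1 * c 0) * h1 + (c 0 * a 1 - c 1 * a 0) * h2 +
        (a 0 * b 1 - a 1 * b 0) * h3

/-- The square of the determinant is the Gram determinant, which for unit vectors depends on the
three mutual inner products only. For fixed centres and one fixed height, it is thus a quadratic
polynomial in the other height. -/
theorem spans_of_gram {a b c : E3} (ha : ⟪a, a⟫ = 1) (hb : ⟪b, b⟫ = 1) (hc : ⟪c, c⟫ = 1)
    (hne : 1 - ⟪b, c⟫ ^ 2 - ⟪a, b⟫ ^ 2 - ⟪a, c⟫ ^ 2 + 2 * ⟪b, c⟫ * ⟪a, b⟫ * ⟪a, c⟫ ≠ 0) :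
    Spans a b c := by
  apply spans_of_det
  simp only [PiLp.inner_apply, Fin.sum_univ_three, RCLike.inner_apply, conj_trivial] at *
  intro h0
  apply hne
  rw [← mul_self_eq_zero] at h0
  linear_combination h0 - (b 0 * b 0 + b 1 * b 1 + b 2 * b 2) *
    (c 0 * c 0 + c 1 * c 1 + c 2 * c 2) * ha - (c 0 * c 0 + c 1 * c 1 + c 2 * c 2) * hb - hc +
    (c 0 * b 0 + c 1 * b 1 + c 2 * b 2) ^ 2 * ha + (c 0 * a 0 + c 1 * a 1 + c 2 * a 2) ^ 2 * hb +
    (b 0 * a 0 + b 1 * a 1 + b 2 * a 2) ^ 2 * hc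

theorem exists_spans {a b : E3} (ha : ⟪a, a⟫ = 1) (hb : ⟪b, b⟫ = 1) (hab : ⟪a, b⟫ ^ 2 ≠ 1) :
    ∃ c, Spans a b c := by
  refine ⟨WithLp.toLp 2 ![a 1 * b 2 - a 2 * b 1, a 2 * b 0 - a 0 * b 2, a 0 * b 1 - a 1 * b 0],
    spans_of_det ?_⟩
  simp only [PiLp.inner_apply, Fin.sum_univ_three, RCLike.inner_apply, conj_trivial] at *
  intro h0
  apply hab
  simp at h0
  linear_combination (b 0 * b 0 + b 1 * b 1 + b 2 * b 2) * ha + hb - h0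

theorem Spans.neg {a b c : E3} (H : Spans a b c) : Spans a (-b) c := fun v h1 h2 h3 =>
  H v h1 (by rwa [inner_neg_right, neg_eq_zero] at h2) h3

theorem norm_coe (x : S2) : ‖(x : E3)‖ = 1 := by simp

theorem inner_self_coe (x : S2) : ⟪(x : E3), x⟫ = 1 := by
  rw [real_inner_self_eq_norm_sq, norm_coe, one_pow]

/-- Two heights are coordinates of the sphere near a point where their directions are independent
from the normal direction. -/
theorem exists_chart {x : S2} {c₁ c₂ : E3} (hs : Spans x c₁ c₂) :
    ∃ φ : OpenPartialHomeomorph S2 ℂ, x ∈ φ.source ∧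
      ∀ y ∈ φ.source, φ y = ⟨⟪(y : E3), c₁⟫ - ⟪(x : E3), c₁⟫, ⟪(y : E3), c₂⟫ - ⟪(x : E3), c₂⟫⟩ := by
  have hv := norm_eq_of_mem_sphere (-x)
  have hvdef : ((-x : S2) : E3) = -x := rfl
  have hx0 : stereographic hv x = 0 := stereographic_neg_apply x
  generalize ((-x : S2) : E3) = v at *
  have : Fact (Module.finrank ℝ E3 = 2 + 1) := ⟨by simp⟩
  have hv0 : v ≠ 0 := by rw [← norm_ne_zero_iff, hv]; exact one_ne_zero
  have hfin : Module.finrank ℝ (ℝ ∙ v)ᗮ = 2 := Submodule.finrank_orthogonal_span_singleton hv0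
  let L : E3 →L[ℝ] ℂ := (innerSL ℝ c₁).smulRight (1 : ℂ) + (innerSL ℝ c₂).smulRight Complex.I
  have hL : ∀ y, L y = ⟨⟪y, c₁⟫, ⟪y, c₂⟫⟩ := by
    intro y
    apply Complex.ext <;> simp [L, real_inner_comm]
  let f : (ℝ ∙ v)ᗮ → ℂ := fun w => L (stereoInvFunAux v w) - L x
  -- Independence from the normal direction says exactly that the two heights have independent
  -- differentials on the tangent plane.
  have hinj : Function.Injective (L ∘L (ℝ ∙ v)ᗮ.subtypeL) := by
    rw [injective_iff_map_eq_zero]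
    intro w hw
    have hw' : L w = 0 := hw
    rw [hL, Complex.ext_iff] at hw'
    have h1 : ⟪(w : E3), x⟫ = 0 := by
      have := Submodule.mem_orthogonal_singleton_iff_inner_left.1 w.2
      have h2 : ⟪(w : E3), v⟫ = -⟪(w : E3), x⟫ := by rw [← inner_neg_right]; exact congrArg _ hvdef
      linarith
    exact Subtype.ext (hs w h1 hw'.1 hw'.2)
  let e : (ℝ ∙ v)ᗮ ≃L[ℝ] ℂ := (LinearEquiv.ofInjectiveOfFinrankEq
    ((L ∘L (ℝ ∙ v)ᗮ.subtypeL : (ℝ ∙ v)ᗮ →L[ℝ] ℂ) : (ℝ ∙ v)ᗮ →ₗ[ℝ] ℂ) hinj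
    (by rw [hfin, Complex.finrank_real_complex])).toContinuousLinearEquiv
  -- The inverse stereographic projection has the inclusion of the plane as its derivative at `0`,
  -- so the heights read in this projection are invertible there and the inverse function theorem
  -- applies.
  have hder : HasFDerivAt f (e : (ℝ ∙ v)ᗮ →L[ℝ] ℂ) 0 :=
    ((L.hasFDerivAt).comp (0 : (ℝ ∙ v)ᗮ) (hasFDerivAt_stereoInvFunAux_comp_coe v)).sub_const _
  have hcd : ContDiffAt ℝ 1 f 0 := by
    have h1 : ContDiff ℝ 1 (stereoInvFunAux v ∘ ((↑) : (ℝ ∙ v)ᗮ → E3)) :=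
      contDiff_stereoInvFunAux.comp (ℝ ∙ v)ᗮ.subtypeL.contDiff
    exact ((L.contDiff.comp h1).sub contDiff_const).contDiffAt
  let ψ := hcd.toOpenPartialHomeomorph f hder one_ne_zero
  refine ⟨(stereographic hv).trans ψ, ?_, ?_⟩
  · rw [OpenPartialHomeomorph.trans_source]
    refine ⟨?_, ?_⟩
    · rw [stereographic_source]
      intro h
      have h2 := congrArg Subtype.val (Set.mem_singleton_iff.1 h)
      change (x : E3) = v at h2
      have h3 := inner_self_coe x
      nth_rw 2 [h2] at h3
      rw [hvdef, inner_neg_right, inner_self_coe] at h3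
      norm_num at h3
    · rw [mem_preimage, hx0]
      exact hcd.mem_toOpenPartialHomeomorph_source hder one_ne_zero
  · intro y hy
    rw [OpenPartialHomeomorph.trans_source] at hy
    have h1 : f (stereographic hv y) = L y - L x := by
      have := (stereographic hv).left_inv hy.1
      have h2 := congrArg Subtype.val this
      change L (stereoInvFunAux v (stereographic hv y)) - L x = _
      congr 2
    change f (stereographic hv y) = _
    rw [h1, hL, hL]
    rfl

end BrickDecomposition

/-! ### Polar coordinates on the sphere. -/

namespace BrickDecomposition

open Set Topology

open scoped RealInnerProductSpace

/-- The height above the equator of the points of `polar p` on the level `u`. -/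
noncomputable def hgt (u : ℝ) : ℝ := (4 - Real.exp (-u) ^ 2) / (Real.exp (-u) ^ 2 + 4)

theorem hgt_eq (u : ℝ) : hgt u = 8 / (Real.exp (-u) ^ 2 + 4) - 1 := by
  have : 0 < Real.exp (-u) ^ 2 + 4 := by positivity
  rw [hgt]
  field_simp
  ring

theorem strictMono_hgt : StrictMono hgt := by
  intro u v huv
  rw [hgt_eq, hgt_eq]
  gcongr

theorem hgt_lt_one (u : ℝ) : hgt u < 1 := by
  have : 0 < Real.exp (-u) ^ 2 := by positivity
  rw [hgt, div_lt_one (by positivity)]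
  linarith

theorem tendsto_hgt : Filter.Tendsto hgt Filter.atTop (𝓝 1) := by
  have h1 : Filter.Tendsto (fun u : ℝ => Real.exp (-u)) Filter.atTop (𝓝 0) :=
    Real.tendsto_exp_neg_atTop_nhds_zero
  have h2 : Filter.Tendsto (fun u : ℝ => (4 - Real.exp (-u) ^ 2) / (Real.exp (-u) ^ 2 + 4))
      Filter.atTop (𝓝 ((4 - 0 ^ 2) / (0 ^ 2 + 4))) :=
    (tendsto_const_nhds.sub (h1.pow 2)).div ((h1.pow 2).add tendsto_const_nhds) (by norm_num)
  norm_num at h2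
  exact h2

/-- Affine coordinates on the complex plane. -/
noncomputable def skewPlane : ℝ × ℝ ≃ₜ ℂ :=
  ((Homeomorph.neg ℝ).prodCongr (Homeomorph.mulLeft₀ (2 * Real.pi) (by positivity))).trans
    Complex.equivRealProdCLM.symm.toHomeomorph

theorem skewPlane_re (z : ℝ × ℝ) : (skewPlane z).re = -z.1 := rfl

theorem skewPlane_im (z : ℝ × ℝ) : (skewPlane z).im = 2 * Real.pi * z.2 := rfl

theorem coe_neg_ne_zero (p : S2) : ((-p : S2) : E3) ≠ 0 := by
  rw [← norm_ne_zero_iff, norm_coe]; exact one_ne_zero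

/-- The complex plane as the tangent plane of the sphere at `p`. -/
noncomputable def tangent (p : S2) : ℂ ≃ₗᵢ[ℝ] (ℝ ∙ ((-p : S2) : E3))ᗮ :=
  haveI : Fact (Module.finrank ℝ E3 = 2 + 1) := ⟨by simp⟩
  Complex.orthonormalBasisOneI.equiv
    (OrthonormalBasis.fromOrthogonalSpanSingleton 2 (coe_neg_ne_zero p)) (Equiv.refl _)

/-- Polar coordinates centred at the point `p` of the sphere. -/
noncomputable def polar (p : S2) (z : ℝ × ℝ) : S2 :=
  (stereographic (norm_eq_of_mem_sphere (-p))).symm (tangent p (Complex.exp (skewPlane z)))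

theorem continuous_polar (p : S2) : Continuous (polar p) :=
  (isOpenEmbedding_stereographic_symm (norm_eq_of_mem_sphere (-p))).continuous.comp
    ((tangent p).continuous.comp (Complex.continuous_exp.comp skewPlane.continuous))

theorem isOpenMap_polar (p : S2) : IsOpenMap (polar p) :=
  (isOpenEmbedding_stereographic_symm (norm_eq_of_mem_sphere (-p))).isOpenMap.comp
    ((tangent p).toHomeomorph.isOpenMap.comp (Complex.isOpenMap_exp.comp skewPlane.isOpenMap))

theorem polar_per (p : S2) (u θ : ℝ) : polar p (u, θ + 1) = polar p (u, θ) := by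
  have : skewPlane (u, θ + 1) = skewPlane (u, θ) + 2 * Real.pi * Complex.I := by
    apply Complex.ext
    · simp [skewPlane_re]
    · simp [skewPlane_im]; ring
  rw [polar, polar, this, Complex.exp_periodic]

theorem polar_inj (p : S2) (u θ u' θ' : ℝ) (H : polar p (u, θ) = polar p (u', θ')) :
    u = u' ∧ ∃ k : ℤ, θ' = θ + k := by
  have h1 := (tangent p).injective
    ((isOpenEmbedding_stereographic_symm (norm_eq_of_mem_sphere (-p))).injective H)
  obtain ⟨n, hn⟩ := Complex.exp_eq_exp_iff_exists_int.1 h1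
  have h2 := congrArg Complex.re hn
  have h3 := congrArg Complex.im hn
  simp [skewPlane_re, skewPlane_im] at h2 h3
  refine ⟨h2, -n, ?_⟩
  have := Real.pi_pos
  push_cast
  have h4 : 2 * Real.pi * (θ' + n - θ) = 0 := by linarith
  have h5 := (mul_eq_zero.1 h4).resolve_left (by positivity)
  linarith

theorem inner_neg_self (p : S2) : ⟪((-p : S2) : E3), p⟫ = -1 := by
  have : ⟪((-p : S2) : E3), p⟫ = -⟪(p : E3), p⟫ := by rw [← inner_neg_left]; rfl
  rw [this, inner_self_coe]

theorem inner_polar (p : S2) (u θ : ℝ) : ⟪(polar p (u, θ) : E3), p⟫ = hgt u := by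
  set w := tangent p (Complex.exp (skewPlane (u, θ))) with hw
  have h1 : ‖(w : E3)‖ = Real.exp (-u) := by
    have : ‖(w : E3)‖ = ‖Complex.exp (skewPlane (u, θ))‖ := (tangent p).norm_map _
    rw [this, Complex.norm_exp, skewPlane_re]
  have h2 : ⟪(w : E3), p⟫ = 0 := by
    have := Submodule.mem_orthogonal_singleton_iff_inner_left.1 w.2
    have h3 : ⟪(w : E3), ((-p : S2) : E3)⟫ = -⟪(w : E3), p⟫ := by rw [← inner_neg_right]; rfl
    linarith
  have h4 : (polar p (u, θ) : E3) = stereoInvFunAux ((-p : S2) : E3) w := rfl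
  have h5 := inner_neg_self p
  rw [h4, stereoInvFunAux_apply, inner_smul_left, inner_add_left, inner_smul_left, inner_smul_left,
    h2, h5, h1, hgt]
  simp
  ring

theorem exists_polar {p y : S2} (h1 : y ≠ p) (h2 : y ≠ -p) : ∃ u θ, polar p (u, θ) = y := by
  set σ := stereographic (norm_eq_of_mem_sphere (-p)) with hσ
  have hy : y ∈ σ.source := by
    rw [hσ, stereographic_source]
    exact h2
  have hp : p ∈ σ.source := by
    rw [hσ, stereographic_source]
    intro h
    exact ne_neg_of_mem_unit_sphere ℝ p h
  have hw : σ y ≠ 0 := fun h0 => h1 (σ.injOn hy hp (h0.trans (stereographic_neg_apply p).symm))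
  have hz : (tangent p).symm (σ y) ≠ 0 := fun h0 => hw ((tangent p).symm.injective (by rw [h0, map_zero]))
  refine ⟨(skewPlane.symm (Complex.log ((tangent p).symm (σ y)))).1,
    (skewPlane.symm (Complex.log ((tangent p).symm (σ y)))).2, ?_⟩
  rw [polar, Homeomorph.apply_symm_apply, Complex.exp_log hz, LinearIsometryEquiv.apply_symm_apply]
  exact σ.left_inv hy

theorem neg_one_lt_hgt (u : ℝ) : -1 < hgt u := by
  have : 0 < 8 / (Real.exp (-u) ^ 2 + 4) := by positivity
  rw [hgt_eq]
  linarith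

theorem exists_polar_of_le {p y : S2} {v : ℝ} (hy : y ≠ p) (hv : hgt v ≤ ⟪(y : E3), p⟫) :
    ∃ u θ, v ≤ u ∧ polar p (u, θ) = y := by
  obtain ⟨u, θ, rfl⟩ := exists_polar hy (by
    rintro rfl
    have := neg_one_lt_hgt v
    rw [inner_neg_self] at hv
    linarith)
  rw [inner_polar] at hv
  exact ⟨u, θ, strictMono_hgt.le_iff_le.1 hv, rfl⟩

theorem inner_eq_one {x y : S2} (H : ⟪(x : E3), y⟫ = 1) : x = y := by
  have := (inner_eq_one_iff_of_norm_eq_one (𝕜 := ℝ) (norm_coe x) (norm_coe y)).1 H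
  exact Subtype.ext this

/-- Polar coordinates around a point of the sphere, isolated from the other fixed points. -/
noncomputable def polarEnd {h : S2 ≃ₜ S2} {w₀ : ℝ} (p : S2)
    (H : ∀ u θ, w₀ ≤ u → h (polar p (u, θ)) ≠ polar p (u, θ)) : PolarEnd h w₀ where
  Φ := polar p
  continuous := continuous_polar p
  isOpenMap := isOpenMap_polar p
  per := polar_per p
  inj := polar_inj p
  nofix := H

end BrickDecomposition

/-! ### Charts around the points of the rows. -/

namespace BrickDecomposition

open Set Topology

theorem Row.eventually_notMem_range (r : Row) (θ₀ : ℝ) :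
    ∀ᶠ ε in 𝓝[>] (0 : ℝ), ∀ θ, |θ - θ₀| < ε → θ ≠ θ₀ → θ ∉ range r.a := by
  obtain ⟨k, h1, h2⟩ := r.exists_cell θ₀
  obtain ⟨k', h3, h4⟩ : ∃ k', r.a k' < θ₀ ∧ ∀ j, r.a k' < r.a j → r.a j < r.a (k + 1) →
      r.a j = θ₀ := by
    rcases h1.lt_or_eq with h1 | h1
    · refine ⟨k, h1, fun j hj hj' => ?_⟩
      have e1 := r.a_mono.lt_iff_lt.1 hj
      have e2 := r.a_mono.lt_iff_lt.1 hj'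
      omega
    · refine ⟨k - 1, by rw [← h1]; exact r.a_mono (by omega), fun j hj hj' => ?_⟩
      have e1 := r.a_mono.lt_iff_lt.1 hj
      have e2 := r.a_mono.lt_iff_lt.1 hj'
      rw [← h1, show j = k by omega]
  filter_upwards [Ioo_mem_nhdsGT (sub_pos.2 h2), Ioo_mem_nhdsGT (sub_pos.2 h3)] with ε he he' θ hθ hne
  rintro ⟨j, rfl⟩
  rw [abs_lt] at hθ
  exact hne (h4 j (by linarith [he'.2]) (by linarith [he.2]))

namespace PolarEnd

variable {S : Type*} [TopologicalSpace S] {h : S ≃ₜ S} {w₀ : ℝ} (E : PolarEnd h w₀)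

/-- In the sup metric, two points of a ball of radius at most `1/2` have angles differing by less
than `1`, so `E.Φ` is injective on it. -/
theorem exists_chart (g : ℝ × ℝ ≃ₜ ℂ) (z₀ : ℝ × ℝ) {ε : ℝ} (hε : ε ≤ 1 / 2) :
    ∃ φ : OpenPartialHomeomorph S ℂ, φ.source = E.Φ '' Metric.ball z₀ ε ∧
      ∀ z ∈ Metric.ball z₀ ε, φ (E.Φ z) = g z := by
  have hinj : InjOn E.Φ (Metric.ball z₀ ε) := by
    rintro ⟨u, θ⟩ hz ⟨u', θ'⟩ hz' heq
    obtain ⟨rfl, k, rfl⟩ := E.inj _ _ _ _ heq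
    rw [Metric.mem_ball, Prod.dist_eq, max_lt_iff, Real.dist_eq, Real.dist_eq, abs_lt, abs_lt]
      at hz hz'
    dsimp only at hz hz'
    have h1 : ((-1 : ℤ) : ℝ) < k := by push_cast; linarith [hz.2.2, hz'.2.1]
    have h2 : (k : ℝ) < (1 : ℤ) := by push_cast; linarith [hz.2.1, hz'.2.2]
    have h3 : k = 0 := by
      have := Int.cast_lt.1 h1
      have := Int.cast_lt.1 h2
      omega
    rw [h3, Int.cast_zero, add_zero]
  let e := OpenPartialHomeomorph.ofContinuousOpen (hinj.toPartialEquiv E.Φ _)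
    E.continuous.continuousOn E.isOpenMap Metric.isOpen_ball
  refine ⟨e.symm.trans g.toOpenPartialHomeomorph, ?_, fun z hz => ?_⟩
  · rw [OpenPartialHomeomorph.trans_source]
    simp only [Homeomorph.toOpenPartialHomeomorph_source, preimage_univ, inter_univ]
    rfl
  · exact congrArg g (e.left_inv hz)

/-- The complement of the cuts in the open strip of a row. -/
def ring (r : Row) : Set S := E.Φ '' (Ioo r.bot r.top ×ˢ (range r.a)ᶜ)

/-- Inside a row the only possible boundary near the point is one cut. The coordinates are exchanged
so that it falls on the full line of the T; the half-line plays no role. -/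
theorem exists_chart_interior (r : Row) {u₀ θ₀ : ℝ} (hu : u₀ ∈ Ioo r.bot r.top) :
    ∃ φ : OpenPartialHomeomorph S ℂ, E.Φ (u₀, θ₀) ∈ φ.source ∧ φ (E.Φ (u₀, θ₀)) = 0 ∧
      ∀ y ∈ φ.source, φ y ∉ teeModel → y ∈ E.ring r := by
  obtain ⟨ε, ⟨⟨hε, h1⟩, h2⟩, h3⟩ := (((r.eventually_notMem_range θ₀).and
    (Ioo_mem_nhdsGT (sub_pos.2 hu.1))).and (Ioo_mem_nhdsGT (sub_pos.2 hu.2)) |>.and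
    (Ioo_mem_nhdsGT (show (0 : ℝ) < 1 / 2 by norm_num))).exists
  obtain ⟨φ, hs, hφ⟩ := E.exists_chart (((Homeomorph.subRight (u₀, θ₀)).trans
    (Homeomorph.prodComm ℝ ℝ)).trans Complex.equivRealProdCLM.symm.toHomeomorph) (u₀, θ₀) h3.2.le
  have hval : ∀ u θ, (u, θ) ∈ Metric.ball (u₀, θ₀) ε → φ (E.Φ (u, θ)) = ⟨θ - θ₀, u - u₀⟩ :=
    fun u θ hz => hφ _ hz
  refine ⟨φ, ?_, ?_, ?_⟩
  · rw [hs]; exact mem_image_of_mem _ (Metric.mem_ball_self h3.1)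
  · rw [hval _ _ (Metric.mem_ball_self h3.1), sub_self, sub_self]; rfl
  · intro y hy hy'
    rw [hs] at hy
    obtain ⟨⟨u, θ⟩, hz, rfl⟩ := hy
    rw [hval _ _ hz] at hy'
    rw [Metric.mem_ball, Prod.dist_eq, max_lt_iff, Real.dist_eq, Real.dist_eq] at hz
    obtain ⟨hz1, hz2⟩ := hz
    rw [abs_lt] at hz1
    dsimp only at hz1 hz2
    refine mem_image_of_mem _ ⟨⟨by linarith [h1.2], by linarith [h2.2]⟩, hε θ hz2 ?_⟩
    rintro rfl
    exact hy' (Or.inl (sub_self _))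

/-- The bottom level is the full line of the T, and a possible cut of the row at `θ₀` is its
half-line. -/
theorem exists_chart_base (r : Row) (θ₀ : ℝ) :
    ∃ φ : OpenPartialHomeomorph S ℂ, E.Φ (r.bot, θ₀) ∈ φ.source ∧ φ (E.Φ (r.bot, θ₀)) = 0 ∧
      ∀ y ∈ φ.source, φ y ∉ teeModel → y ∈ E.ring r ∨ ∃ u θ, u < r.bot ∧ E.Φ (u, θ) = y := by
  obtain ⟨ε, ⟨hε, h2⟩, h3⟩ := ((r.eventually_notMem_range θ₀).and
    (Ioo_mem_nhdsGT (sub_pos.2 r.bot_lt)) |>.and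
    (Ioo_mem_nhdsGT (show (0 : ℝ) < 1 / 2 by norm_num))).exists
  obtain ⟨φ, hs, hφ⟩ := E.exists_chart ((Homeomorph.subRight (r.bot, θ₀)).trans
    Complex.equivRealProdCLM.symm.toHomeomorph) (r.bot, θ₀) h3.2.le
  have hval : ∀ u θ, (u, θ) ∈ Metric.ball (r.bot, θ₀) ε → φ (E.Φ (u, θ)) = ⟨u - r.bot, θ - θ₀⟩ :=
    fun u θ hz => hφ _ hz
  refine ⟨φ, ?_, ?_, ?_⟩
  · rw [hs]; exact mem_image_of_mem _ (Metric.mem_ball_self h3.1)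
  · rw [hval _ _ (Metric.mem_ball_self h3.1), sub_self, sub_self]; rfl
  · intro y hy hy'
    rw [hs] at hy
    obtain ⟨⟨u, θ⟩, hz, rfl⟩ := hy
    rw [hval _ _ hz] at hy'
    simp only [teeModel, mem_ofPred_eq, not_or, not_and, not_le] at hy'
    rw [Metric.mem_ball, Prod.dist_eq, max_lt_iff, Real.dist_eq, Real.dist_eq] at hz
    obtain ⟨hz1, hz2⟩ := hz
    rw [abs_lt] at hz1
    dsimp only at hz1 hz2
    rcases lt_or_gt_of_ne hy'.1 with h5 | h5
    · exact Or.inr ⟨u, θ, by linarith, rfl⟩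
    · refine Or.inl (mem_image_of_mem _ ⟨⟨by linarith, by linarith [h2.2]⟩, hε θ hz2 ?_⟩)
      rintro rfl
      linarith [hy'.2 (sub_self _)]

/-- The common level is the full line of the T. As the cuts are not aligned, at most one of the two
rows has a cut at `θ₀`, which is the half-line; the level coordinate is reversed if this cut is in
the lower row. -/
theorem exists_chart_junction {r r' : Row} (hr : r'.bot = r.top)
    (hd : Disjoint (range r.a) (range r'.a)) (θ₀ : ℝ) :
    ∃ φ : OpenPartialHomeomorph S ℂ, E.Φ (r'.bot, θ₀) ∈ φ.source ∧ φ (E.Φ (r'.bot, θ₀)) = 0 ∧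
      ∀ y ∈ φ.source, φ y ∉ teeModel → y ∈ E.ring r ∨ y ∈ E.ring r' := by
  obtain ⟨ε, ⟨⟨⟨hε, h1⟩, hε'⟩, h2⟩, h3⟩ := ((((r.eventually_notMem_range θ₀).and
    (Ioo_mem_nhdsGT (sub_pos.2 r.bot_lt))).and (r'.eventually_notMem_range θ₀)).and
    (Ioo_mem_nhdsGT (sub_pos.2 r'.bot_lt)) |>.and
    (Ioo_mem_nhdsGT (show (0 : ℝ) < 1 / 2 by norm_num))).exists
  rw [← hr] at h1
  by_cases hθ₀ : θ₀ ∈ range r.a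
  · have hθ₀' : θ₀ ∉ range r'.a := Set.disjoint_left.1 hd hθ₀
    obtain ⟨φ, hs, hφ⟩ := E.exists_chart (((Homeomorph.subRight (r'.bot, θ₀)).trans
      ((Homeomorph.neg ℝ).prodCongr (Homeomorph.refl ℝ))).trans
      Complex.equivRealProdCLM.symm.toHomeomorph) (r'.bot, θ₀) h3.2.le
    have hval : ∀ u θ, (u, θ) ∈ Metric.ball (r'.bot, θ₀) ε →
        φ (E.Φ (u, θ)) = ⟨-(u - r'.bot), θ - θ₀⟩ := fun u θ hz => hφ _ hz
    refine ⟨φ, ?_, ?_, ?_⟩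
    · rw [hs]; exact mem_image_of_mem _ (Metric.mem_ball_self h3.1)
    · rw [hval _ _ (Metric.mem_ball_self h3.1), sub_self, sub_self, neg_zero]; rfl
    · intro y hy hy'
      rw [hs] at hy
      obtain ⟨⟨u, θ⟩, hz, rfl⟩ := hy
      rw [hval _ _ hz] at hy'
      simp only [teeModel, mem_ofPred_eq, not_or, not_and, not_le] at hy'
      rw [Metric.mem_ball, Prod.dist_eq, max_lt_iff, Real.dist_eq, Real.dist_eq] at hz
      obtain ⟨hz1, hz2⟩ := hz
      rw [abs_lt] at hz1
      dsimp only at hz1 hz2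
      rcases lt_or_gt_of_ne hy'.1 with h5 | h5
      · refine Or.inr (mem_image_of_mem _ ⟨⟨by linarith, by linarith [h2.2]⟩, ?_⟩)
        by_cases h6 : θ = θ₀
        · rw [h6]; exact hθ₀'
        · exact hε' θ hz2 h6
      · refine Or.inl (mem_image_of_mem _ ⟨⟨by linarith [h1.2], by linarith⟩, hε θ hz2 ?_⟩)
        rintro rfl
        linarith [hy'.2 (sub_self _)]
  · obtain ⟨φ, hs, hφ⟩ := E.exists_chart ((Homeomorph.subRight (r'.bot, θ₀)).trans
      Complex.equivRealProdCLM.symm.toHomeomorph) (r'.bot, θ₀) h3.2.le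
    have hval : ∀ u θ, (u, θ) ∈ Metric.ball (r'.bot, θ₀) ε →
        φ (E.Φ (u, θ)) = ⟨u - r'.bot, θ - θ₀⟩ := fun u θ hz => hφ _ hz
    refine ⟨φ, ?_, ?_, ?_⟩
    · rw [hs]; exact mem_image_of_mem _ (Metric.mem_ball_self h3.1)
    · rw [hval _ _ (Metric.mem_ball_self h3.1), sub_self, sub_self]; rfl
    · intro y hy hy'
      rw [hs] at hy
      obtain ⟨⟨u, θ⟩, hz, rfl⟩ := hy
      rw [hval _ _ hz] at hy'
      simp only [teeModel, mem_ofPred_eq, not_or, not_and, not_le] at hy'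
      rw [Metric.mem_ball, Prod.dist_eq, max_lt_iff, Real.dist_eq, Real.dist_eq] at hz
      obtain ⟨hz1, hz2⟩ := hz
      rw [abs_lt] at hz1
      dsimp only at hz1 hz2
      rcases lt_or_gt_of_ne hy'.1 with h5 | h5
      · refine Or.inl (mem_image_of_mem _ ⟨⟨by linarith [h1.2], by linarith⟩, ?_⟩)
        by_cases h6 : θ = θ₀
        · rw [h6]; exact hθ₀
        · exact hε θ hz2 h6
      · refine Or.inr (mem_image_of_mem _ ⟨⟨by linarith, by linarith [h2.2]⟩, hε' θ hz2 ?_⟩)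
        rintro rfl
        linarith [hy'.2 (sub_self _)]

end PolarEnd

end BrickDecomposition

/-! ### Towers: an infinite sequence of barriers going to the end. -/

namespace BrickDecomposition

open Set Topology

namespace PolarEnd

variable {S : Type*} [TopologicalSpace S] {h : S ≃ₜ S} {w₀ : ℝ} (E : PolarEnd h w₀)

/-- The interior of the `i`-th brick of a row. -/
def openBrick (r : Row) (i : ℤ) : Set S := E.Φ '' (Ioo r.bot r.top ×ˢ Ioo (r.a i) (r.a (i + 1)))

theorem isOpen_openBrick (r : Row) (i : ℤ) : IsOpen (E.openBrick r i) :=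
  E.isOpenMap _ (isOpen_Ioo.prod isOpen_Ioo)

theorem isPreconnected_openBrick (r : Row) (i : ℤ) : IsPreconnected (E.openBrick r i) :=
  (isPreconnected_Ioo.prod isPreconnected_Ioo).image _ E.continuous.continuousOn

theorem nonempty_openBrick (r : Row) (i : ℤ) : (E.openBrick r i).Nonempty :=
  ((nonempty_Ioo.2 r.bot_lt).prod (nonempty_Ioo.2 (r.a_lt i))).image _

theorem closure_openBrick [T2Space S] (r : Row) (i : ℤ) :
    closure (E.openBrick r i) = E.brick r i := by
  apply subset_antisymm
  · refine closure_minimal ?_ (E.isCompact_box _ _ _ _).isClosed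
    exact image_mono (prod_mono Ioo_subset_Icc_self Ioo_subset_Icc_self)
  · have : closure (Ioo r.bot r.top ×ˢ Ioo (r.a i) (r.a (i + 1))) =
        Icc r.bot r.top ×ˢ Icc (r.a i) (r.a (i + 1)) := by
      rw [closure_prod_eq, closure_Ioo r.bot_lt.ne, closure_Ioo (r.a_lt i).ne]
    rw [brick, box, ← this]
    exact image_closure_subset_closure_image E.continuous

theorem exists_openBrick_of_mem_ring {r : Row} {x : S} (hx : x ∈ E.ring r) :
    ∃ i : ℤ, 0 ≤ i ∧ i < r.m ∧ x ∈ E.openBrick r i := by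
  obtain ⟨⟨u, θ⟩, ⟨hu, hθ⟩, rfl⟩ := hx
  obtain ⟨k, hk, hk'⟩ := r.exists_cell θ
  have hk1 : r.a k < θ := lt_of_le_of_ne hk fun h' => hθ ⟨k, h'⟩
  obtain ⟨j, q, h0, h1, rfl⟩ := r.exists_reduce k
  refine ⟨j, h0, h1, (u, θ - q), ⟨hu, ?_⟩, ?_⟩
  · rw [show j + q * r.m + 1 = j + 1 + q * r.m by ring, r.a_add_mul] at hk'
    rw [r.a_add_mul] at hk1
    constructor <;> dsimp only <;> linarith
  · rw [← E.per_int u (θ - q) q, sub_add_cancel]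

/-- A sequence of finite stacks of rows going to the end, each of them containing a barrier. -/
structure IsTower (bad : Set ℝ) (rows : ℕ → ℕ → Row) (N : ℕ → ℕ) : Prop where
  bot : ∀ k, (rows k 0).bot = w₀ + k
  top : ∀ k, (rows k (N k)).top = w₀ + k + 1
  overlap : ∀ k, ∀ n < N k, (rows k n).Over (rows k (n + 1))
  cuts : ∀ i, (rows 0 0).a i ∉ bad
  rational : ∀ k i, (rows k (N k)).a i ∈ Set.range ((↑) : ℚ → ℝ)
  irrational : ∀ k i, (rows (k + 1) 0).a i ∉ Set.range ((↑) : ℚ → ℝ)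
  free : ∀ k l, FreeSet h (E.pieces (rows k) (N k) l)
  conn : ∀ k l, IsPreconnected (E.pieces (rows k) (N k) l)
  barrier : ∀ k, E.Barrier (E.pieces (rows k) (N k)) (Set.range (rows k 0).lab)
    (Set.range (rows k (N k)).lab) (w₀ + k) (w₀ + k + 1)

/-- The stacks are built independently of each other. They fit together because the last row of each
has rational cuts while the first row of the next avoids the rationals, so no cuts are aligned. The
set `bad` matters for the very first row. -/
theorem exists_tower [T2Space S] {bad : Set ℝ} (hbad : bad.Countable) :
    ∃ rows N, E.IsTower bad rows N := by
  have : ∀ k : ℕ, w₀ ≤ w₀ + k := fun k => by simp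
  choose rows N h1 h2 h3 h4 h5 h6 h7 h8 using fun k : ℕ => E.exists_barrier (this k)
    (hbad.union (countable_range ((↑) : ℚ → ℝ)))
  exact ⟨rows, N, h1, h2, h3, fun i hi => h4 0 i (Or.inl hi), h5,
    fun k i hi => h4 (k + 1) i (Or.inr hi), h6, h7, h8⟩

variable {E} {bad : Set ℝ} {rows : ℕ → ℕ → Row} {N : ℕ → ℕ}

namespace IsTower

theorem le_bot (H : E.IsTower bad rows N) {k n : ℕ} (hn : n ≤ N k) :
    w₀ + k ≤ (rows k n).bot := by
  rw [← H.bot k]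
  exact Row.bot_zero_le (H.overlap k) n.zero_le hn

theorem top_le (H : E.IsTower bad rows N) {k n : ℕ} (hn : n ≤ N k) :
    (rows k n).top ≤ w₀ + k + 1 := by
  rw [← H.top k]
  rcases hn.lt_or_eq with hn | rfl
  · exact (Row.top_le_bot (H.overlap k) hn le_rfl).trans (rows k (N k)).bot_lt.le
  · exact le_rfl

/-- The interiors of distinct bricks are disjoint. -/
theorem eq_of_mem (H : E.IsTower bad rows N) {k n k' n' : ℕ} {i i' : ℤ} (hn : n ≤ N k)
    (hn' : n' ≤ N k') (h0 : 0 ≤ i) (h1 : i < (rows k n).m) (h0' : 0 ≤ i')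
    (h1' : i' < (rows k' n').m) {x : S} (hx : x ∈ E.openBrick (rows k n) i)
    (hx' : x ∈ E.openBrick (rows k' n') i') : k = k' ∧ n = n' ∧ i = i' := by
  obtain ⟨⟨u, θ⟩, ⟨hu, hθ⟩, rfl⟩ := hx
  obtain ⟨⟨u', θ'⟩, ⟨hu', hθ'⟩, heq⟩ := hx'
  obtain ⟨rfl, q, rfl⟩ := E.inj _ _ _ _ heq
  dsimp only at hu hu' hθ hθ'
  have b1 := H.le_bot hn
  have b2 := H.le_bot hn'
  have t1 := H.top_le hn
  have t2 := H.top_le hn'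
  have e1 : (k : ℝ) < k' + 1 := by linarith [hu.1, hu.2, hu'.1, hu'.2]
  have e2 : (k' : ℝ) < k + 1 := by linarith [hu.1, hu.2, hu'.1, hu'.2]
  obtain rfl : k = k' := by
    have e1' : k < k' + 1 := by exact_mod_cast e1
    have e2' : k' < k + 1 := by exact_mod_cast e2
    omega
  obtain rfl : n = n' := by
    rcases lt_trichotomy n n' with hlt | heq | hlt
    · have := Row.top_le_bot (H.overlap k) hlt hn'
      linarith [hu.1, hu.2, hu'.1, hu'.2]
    · exact heq
    · have := Row.top_le_bot (H.overlap k) hlt hn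
      linarith [hu.1, hu.2, hu'.1, hu'.2]
  refine ⟨rfl, rfl, ?_⟩
  have c1 : (rows k n).a i < (rows k n).a (i' + 1 + q * (rows k n).m) := by
    rw [Row.a_add_mul]; linarith [hθ.1, hθ'.2]
  have c2 : (rows k n).a (i' + q * (rows k n).m) < (rows k n).a (i + 1) := by
    rw [Row.a_add_mul]; linarith [hθ.2, hθ'.1]
  rw [(rows k n).a_mono.lt_iff_lt] at c1 c2
  have : i = i' + q * (rows k n).m := by omega
  obtain rfl : q = 0 := by
    have hm : (0 : ℤ) < (rows k n).m := by exact_mod_cast (rows k n).m_pos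
    rcases lt_trichotomy q 0 with hq | hq | hq
    · nlinarith
    · exact hq
    · nlinarith
  omega

/-- A level is interior to a row or is the junction of two successive rows, in the same stack or in
consecutive ones; in both cases the cuts are disjoint. -/
theorem exists_row (H : E.IsTower bad rows N) {u : ℝ} (hu : w₀ < u) :
    (∃ k, ∃ n ≤ N k, u ∈ Ioo (rows k n).bot (rows k n).top) ∨
    ∃ k, ∃ n ≤ N k, ∃ k', ∃ n' ≤ N k', (rows k' n').bot = u ∧ (rows k' n').bot = (rows k n).top ∧
      Disjoint (range (rows k n).a) (range (rows k' n').a) := by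
  have hk1 := Nat.floor_le (sub_pos.2 hu).le
  have hk2 := Nat.lt_floor_add_one (u - w₀)
  set k := ⌊u - w₀⌋₊
  obtain ⟨n, hn, hb, ht⟩ : ∃ n ≤ N k, (rows k n).bot ≤ u ∧ u < (rows k n).top := by
    have : ∀ n ≤ N k, u < (rows k n).top → ∃ n ≤ N k, (rows k n).bot ≤ u ∧ u < (rows k n).top := by
      intro n
      induction n with
      | zero => exact fun h1 h2 => ⟨0, h1, by rw [H.bot]; linarith, h2⟩
      | succ n ih =>
        intro h1 h2
        by_cases h3 : u < (rows k n).top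
        · exact ih (by omega) h3
        · exact ⟨n + 1, h1, by rw [(H.overlap k n h1).1]; linarith, h2⟩
    exact this (N k) le_rfl (by rw [H.top]; linarith)
  rcases hb.lt_or_eq with hb | hb
  · exact Or.inl ⟨k, n, hn, hb, ht⟩
  · right
    rcases n with - | n
    · obtain ⟨j, hj⟩ : ∃ j, k = j + 1 := by
        refine Nat.exists_eq_succ_of_ne_zero fun hk => ?_
        rw [H.bot, hk, Nat.cast_zero, add_zero] at hb
        exact hu.ne hb
      rw [hj] at hb
      refine ⟨j, N j, le_rfl, j + 1, 0, Nat.zero_le _, hb, ?_, ?_⟩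
      · rw [H.bot, H.top]; push_cast; ring
      · rw [Set.disjoint_left]
        rintro _ ⟨i, rfl⟩ ⟨i', hi'⟩
        refine H.irrational j i' ?_
        rw [hi']
        exact H.rational j i
    · refine ⟨k, n, by omega, k, n + 1, hn, hb, (H.overlap k n hn).1, ?_⟩
      rw [Set.disjoint_left]
      rintro _ ⟨i, rfl⟩ ⟨i', hi'⟩
      obtain ⟨q, h1, h2⟩ := (H.overlap k n hn).2 i'
      rw [hi'] at h1 h2
      rw [(rows k n).a_mono.lt_iff_lt] at h1 h2
      omega

theorem exists_chart (H : E.IsTower bad rows N) {u : ℝ} (hu : w₀ < u) (θ : ℝ) :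
    ∃ φ : OpenPartialHomeomorph S ℂ, E.Φ (u, θ) ∈ φ.source ∧ φ (E.Φ (u, θ)) = 0 ∧
      ∀ y ∈ φ.source, φ y ∉ teeModel → ∃ k, ∃ n ≤ N k, y ∈ E.ring (rows k n) := by
  rcases H.exists_row hu with ⟨k, n, hn, hu⟩ | ⟨k, n, hn, k', n', hn', rfl, h2, h3⟩
  · obtain ⟨φ, h1, h2, h3⟩ := E.exists_chart_interior (rows k n) (θ₀ := θ) hu
    exact ⟨φ, h1, h2, fun y hy hy' => ⟨k, n, hn, h3 y hy hy'⟩⟩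
  · obtain ⟨φ, h4, h5, h6⟩ := E.exists_chart_junction h2 h3 θ
    refine ⟨φ, h4, h5, fun y hy hy' => ?_⟩
    rcases h6 y hy hy' with h7 | h7
    · exact ⟨k, n, hn, h7⟩
    · exact ⟨k', n', hn', h7⟩

end IsTower

end PolarEnd

end BrickDecomposition

/-! ### Circles in general position on the sphere. -/

namespace BrickDecomposition

open Set Topology

open scoped RealInnerProductSpace

/-- The first `n` circles `{x | ⟪x, c i⟫ = t i}` are in general position. -/
structure IsArrangement (c : ℕ → S2) (t : ℕ → ℝ) (n : ℕ) : Prop where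
  spans : ∀ i j, i < j → j < n → ∀ x : S2, ⟪(x : E3), c i⟫ = t i → ⟪(x : E3), c j⟫ = t j →
    Spans x (c i) (c j)
  triple : ∀ i j k, i < j → j < k → k < n → ∀ x : S2, ⟪(x : E3), c i⟫ = t i →
    ⟪(x : E3), c j⟫ = t j → ⟪(x : E3), c k⟫ ≠ t k

theorem continuous_inner_coe (c : S2) : Continuous fun x : S2 => ⟪(x : E3), c⟫ :=
  continuous_subtype_val.inner continuous_const

/-- At a transverse intersection the two heights are local coordinates, so the intersection is
discrete; being compact, it is finite. -/
theorem finite_inter_circles {c c' : S2} {t t' : ℝ}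
    (H : ∀ x : S2, ⟪(x : E3), c⟫ = t → ⟪(x : E3), c'⟫ = t' → Spans x c c') :
    {x : S2 | ⟪(x : E3), c⟫ = t ∧ ⟪(x : E3), c'⟫ = t'}.Finite := by
  by_contra hinf
  obtain ⟨x, hx⟩ := Set.Infinite.exists_accPt_principal hinf
  have hclosed : IsClosed {x : S2 | ⟪(x : E3), c⟫ = t ∧ ⟪(x : E3), c'⟫ = t'} :=
    (isClosed_eq (continuous_inner_coe c) continuous_const).inter
      (isClosed_eq (continuous_inner_coe c') continuous_const)
  obtain ⟨h1, h2⟩ := hclosed.closure_subset (mem_closure_iff_clusterPt.2 hx.clusterPt)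
  obtain ⟨φ, hxφ, hφ⟩ := exists_chart (H x h1 h2)
  obtain ⟨y, ⟨hyφ, h3, h4⟩, hne⟩ := accPt_iff_nhds.1 hx _ (φ.open_source.mem_nhds hxφ)
  refine hne (φ.injOn hyφ hxφ ?_)
  rw [hφ y hyφ, hφ x hxφ, h1, h2, h3, h4]

theorem finite_quadratic (α β : ℝ) : {s : ℝ | α + β * s - s ^ 2 = 0}.Finite := by
  rcases {s : ℝ | α + β * s - s ^ 2 = 0}.eq_empty_or_nonempty with he | ⟨s₀, hs₀⟩
  · rw [he]; exact finite_empty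
  · refine (Set.toFinite {s₀, β - s₀}).subset fun s hs => ?_
    have h1 : α + β * s - s ^ 2 = 0 := hs
    have h2 : α + β * s₀ - s₀ ^ 2 = 0 := hs₀
    have h3 : (s - s₀) * (β - s₀ - s) = 0 := by linear_combination h1 - h2
    rcases mul_eq_zero.1 h3 with h | h
    · exact Or.inl (sub_eq_zero.1 h)
    · exact Or.inr (sub_eq_zero.1 h).symm

/-- The heights are chosen one at a time. A new height must avoid finitely many values: those for
which the Gram determinant with an earlier circle vanishes, and those for which the circle passes
through an intersection of two earlier ones. -/
theorem exists_arrangement {c : ℕ → S2} {t₀ lo hi : ℕ → ℝ} {m n : ℕ} (hmn : m ≤ n)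
    (hlt : ∀ i, lo i < hi i) (H : IsArrangement c t₀ m) :
    ∃ t, IsArrangement c t n ∧ (∀ i < m, t i = t₀ i) ∧
      ∀ i, m ≤ i → i < n → t i ∈ Ioo (lo i) (hi i) := by
  induction n, hmn using Nat.le_induction with
  | base => exact ⟨t₀, H, fun _ _ => rfl, fun i h1 h2 => by omega⟩
  | succ n hn ih =>
    obtain ⟨t, ht, ht1, ht2⟩ := ih
    have hf1 : (⋃ i ∈ Iio n, {s : ℝ | (1 - ⟪(c i : E3), c n⟫ ^ 2 - t i ^ 2) +
        (2 * ⟪(c i : E3), c n⟫ * t i) * s - s ^ 2 = 0}).Finite :=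
      (finite_Iio n).biUnion fun i _ => finite_quadratic _ _
    have hf2 : (⋃ j ∈ Iio n, ⋃ i ∈ Iio j, (fun x : S2 => ⟪(x : E3), c n⟫) ''
        {x : S2 | ⟪(x : E3), c i⟫ = t i ∧ ⟪(x : E3), c j⟫ = t j}).Finite :=
      (finite_Iio n).biUnion fun j hj => (finite_Iio j).biUnion fun i hi =>
        (finite_inter_circles fun x h1 h2 => ht.spans i j hi hj x h1 h2).image _
    obtain ⟨s, hs, hs'⟩ := ((Ioo_infinite (hlt n)).sdiff (hf1.union hf2)).nonempty
    simp only [mem_union, mem_iUnion, mem_image, not_or, not_exists, mem_Iio] at hs'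
    obtain ⟨hs1, hs2⟩ := hs'
    have hup : ∀ i < n, Function.update t n s i = t i := fun i hi =>
      Function.update_of_ne hi.ne _ _
    refine ⟨Function.update t n s, ⟨?_, ?_⟩, ?_, ?_⟩
    · intro i j hij hj x h1 h2
      rw [hup i (by omega)] at h1
      rcases Nat.lt_succ_iff_lt_or_eq.1 hj with hj | rfl
      · rw [hup j hj] at h2
        exact ht.spans i j hij hj x h1 h2
      · rw [Function.update_self] at h2
        refine spans_of_gram (inner_self_coe _) (inner_self_coe _) (inner_self_coe _) ?_
        rw [h1, h2]
        intro h0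
        refine hs1 i hij ?_
        rw [mem_ofPred_eq]
        linarith
    · intro i j k hij hjk hk x h1 h2
      rw [hup i (by omega)] at h1
      rw [hup j (by omega)] at h2
      rcases Nat.lt_succ_iff_lt_or_eq.1 hk with hk | rfl
      · rw [hup k hk]
        exact ht.triple i j k hij hjk hk x h1 h2
      · rw [Function.update_self]
        exact fun h3 => hs2 j hjk i hij x ⟨⟨h1, h2⟩, h3⟩
    · intro i hi
      rw [hup i (by omega), ht1 i hi]
    · intro i h1 h2
      rcases Nat.lt_succ_iff_lt_or_eq.1 h2 with h2 | rfl
      · rw [hup i h2]; exact ht2 i h1 h2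
      · rw [Function.update_self]; exact hs

/-- The points of the `k`-th cap which are outside the previous closed caps. -/
def region (c : ℕ → S2) (t : ℕ → ℝ) (k : ℕ) : Set S2 :=
  {y | t k < ⟪(y : E3), c k⟫ ∧ ∀ l < k, ⟪(y : E3), c l⟫ < t l}

variable {c : ℕ → S2} {t : ℕ → ℝ} {n : ℕ}

theorem isOpen_region (k : ℕ) : IsOpen (region c t k) := by
  have : region c t k = {y : S2 | t k < ⟪(y : E3), c k⟫} ∩
      ⋂ l ∈ Iio k, {y : S2 | ⟪(y : E3), c l⟫ < t l} := by
    ext y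
    simp [region]
  rw [this]
  exact (isOpen_lt continuous_const (continuous_inner_coe _)).inter
    ((finite_Iio k).isOpen_biInter fun l _ => isOpen_lt (continuous_inner_coe _) continuous_const)

theorem eq_of_mem_region {k k' : ℕ} {y : S2} (hk : y ∈ region c t k) (hk' : y ∈ region c t k') :
    k = k' := by
  rcases lt_trichotomy k k' with h | h | h
  · exact absurd (hk'.2 k h) hk.1.not_gt
  · exact h
  · exact absurd (hk.2 k' h) hk'.1.not_gt

/-- The region is that of the first cap strictly containing the point; the hypothesis `H` keeps the
point off the circles of the earlier caps. -/
theorem exists_mem_region {y : S2} (hcov : ∃ i < n, t i < ⟪(y : E3), c i⟫)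
    (H : ∀ k, (∀ l < k, ⟪(y : E3), c l⟫ ≤ t l) → ∀ l < k, l < n → ⟪(y : E3), c l⟫ ≠ t l) :
    ∃ k < n, y ∈ region c t k := by
  classical
  obtain ⟨h1, h2⟩ := Nat.find_spec hcov
  have hmin : ∀ l < Nat.find hcov, ⟪(y : E3), c l⟫ ≤ t l := fun l hl =>
    not_lt.1 fun hlt => Nat.find_min hcov hl ⟨hl.trans h1, hlt⟩
  exact ⟨Nat.find hcov, h1, h2, fun l hl => lt_of_le_of_ne (hmin l hl) (H _ hmin l hl (hl.trans h1))⟩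

theorem eventually_inner_ne (c : ℕ → S2) (t : ℕ → ℝ) (n : ℕ) (x : S2) :
    ∃ W, IsOpen W ∧ x ∈ W ∧ ∀ y ∈ W, ∀ l < n, ⟪(x : E3), c l⟫ ≠ t l → ⟪(y : E3), c l⟫ ≠ t l := by
  refine ⟨⋂ l ∈ {l | l < n ∧ ⟪(x : E3), c l⟫ ≠ t l}, {y : S2 | ⟪(y : E3), c l⟫ ≠ t l},
    ((finite_Iio n).subset fun l hl => hl.1).isOpen_biInter fun l _ =>
      isOpen_ne_fun (continuous_inner_coe _) continuous_const, ?_, ?_⟩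
  · exact mem_iInter₂.2 fun l hl => hl.2
  · exact fun y hy l hl hne => mem_iInter₂.1 hy l ⟨hl, hne⟩

/-- Near any point, the regions of an arrangement look like the sectors of `teeModel`. -/
theorem IsArrangement.exists_chart (H : IsArrangement c t n) (ht : ∀ i < n, t i ^ 2 ≠ 1)
    (hcov : ∀ y : S2, ∃ i < n, t i < ⟪(y : E3), c i⟫) (x : S2) :
    ∃ φ : OpenPartialHomeomorph S2 ℂ, x ∈ φ.source ∧ φ x = 0 ∧
      ∀ y ∈ φ.source, φ y ∉ teeModel → ∃ k < n, y ∈ region c t k := by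
  classical
  obtain ⟨W, hW, hxW, hWne⟩ := eventually_inner_ne c t n x
  suffices ∃ a b : E3, Spans x a b ∧ ∀ y ∈ W,
      (⟨⟪(y : E3), a⟫ - ⟪(x : E3), a⟫, ⟪(y : E3), b⟫ - ⟪(x : E3), b⟫⟩ : ℂ) ∉ teeModel →
      ∀ k, (∀ l < k, ⟪(y : E3), c l⟫ ≤ t l) → ∀ l < k, l < n → ⟪(x : E3), c l⟫ = t l →
        ⟪(y : E3), c l⟫ ≠ t l by
    obtain ⟨a, b, hs, hab⟩ := this
    obtain ⟨φ, hxφ, hφ⟩ := BrickDecomposition.exists_chart hs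
    refine ⟨φ.restrOpen W hW, ⟨hxφ, hxW⟩, ?_, ?_⟩
    · change φ x = 0
      rw [hφ x hxφ, sub_self, sub_self]; rfl
    · rintro y ⟨hyφ, hyW⟩ hy
      change φ y ∉ teeModel at hy
      rw [hφ y hyφ] at hy
      refine exists_mem_region (hcov y) fun k hk l hl hln => ?_
      by_cases hxl : ⟪(x : E3), c l⟫ = t l
      · exact hab y hyW hy k hk l hl hln hxl
      · exact hWne y hyW l hln hxl
  by_cases h1 : ∃ i < n, ⟪(x : E3), c i⟫ = t i
  · obtain ⟨hi, hxi⟩ := Nat.find_spec h1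
    have hmin : ∀ l < n, ⟪(x : E3), c l⟫ = t l → Nat.find h1 ≤ l := fun l hl hxl =>
      Nat.find_min' h1 ⟨hl, hxl⟩
    generalize Nat.find h1 = i at *
    by_cases h2 : ∃ j, i < j ∧ j < n ∧ ⟪(x : E3), c j⟫ = t j
    · obtain ⟨j, hij, hj, hxj⟩ := h2
      -- Since `i < j`, the circle `i` separates regions on its whole length, whereas the circle `j`
      -- is hidden inside the cap `i`. The sign makes the outside of this cap the side `0 ≤ re`
      -- carrying the half-line.
      refine ⟨-c i, c j, (H.spans i j hij hj x hxi hxj).neg, ?_⟩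
      intro y _ hy k hk l hl hln hxl
      simp only [teeModel, mem_ofPred_eq, not_or, not_and, not_le, inner_neg_right, hxi, hxj] at hy
      obtain rfl | rfl : l = i ∨ l = j := by
        have := hmin l hln hxl
        by_contra hne
        rcases lt_trichotomy l j with h | h | h
        · exact H.triple i l j (by omega) h hj x hxi hxl hxj
        · omega
        · exact H.triple i j l hij h hln x hxi hxj hxl
      · intro h0
        exact hy.1 (by rw [h0]; ring)
      · intro h0
        have := hk i (by omega)
        have := hy.2 (by rw [h0]; ring)
        linarith
    · obtain ⟨b, hb⟩ := exists_spans (inner_self_coe x) (inner_self_coe (c i))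
        (by rw [hxi]; exact ht i hi)
      refine ⟨-c i, b, hb.neg, ?_⟩
      intro y _ hy k hk l hl hln hxl h0
      obtain rfl : l = i := by
        have := hmin l hln hxl
        by_contra hne
        exact h2 ⟨l, by omega, hln, hxl⟩
      simp only [teeModel, mem_ofPred_eq, not_or, not_and, not_le, inner_neg_right, hxi] at hy
      exact hy.1 (by rw [h0]; ring)
  -- No circle passes through `x`, so any chart will do; a direction independent from `x` is
  -- supplied by another point of the sphere.
  · have h3 : ⟪(x : E3), polar x (0, 0)⟫ ^ 2 ≠ 1 := by
      rw [real_inner_comm, inner_polar]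
      have := hgt_lt_one 0
      have := neg_one_lt_hgt 0
      nlinarith
    obtain ⟨b, hb⟩ := exists_spans (inner_self_coe x) (inner_self_coe _) h3
    exact ⟨_, b, hb, fun y _ _ k _ l _ hln hxl => (h1 ⟨l, hln, hxl⟩).elim⟩

end BrickDecomposition

/-! ### Caps around the fixed points and free caps covering the rest. -/

namespace BrickDecomposition

open Set Topology

open scoped RealInnerProductSpace

theorem inner_le_one (x y : S2) : ⟪(x : E3), y⟫ ≤ 1 := by
  have := real_inner_le_norm (x : E3) y
  rwa [norm_coe, norm_coe, one_mul] at this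

theorem inner_lt_one {x y : S2} (hxy : x ≠ y) : ⟪(x : E3), y⟫ < 1 :=
  lt_of_le_of_ne (inner_le_one x y) fun h => hxy (inner_eq_one h)

theorem norm_sub_sq_coe (x y : S2) : ‖(x : E3) - y‖ ^ 2 = 2 - 2 * ⟪(x : E3), y⟫ := by
  rw [norm_sub_sq_real, norm_coe, norm_coe]; ring

/-- Two caps are disjoint if they are small enough. -/
theorem inner_add_inner_le (x y z : S2) :
    ⟪(z : E3), x⟫ + ⟪(z : E3), y⟫ ≤ (3 + ⟪(x : E3), y⟫) / 2 := by
  have h1 : 0 ≤ ⟪(x : E3) + y - (2 : ℝ) • z, (x : E3) + y - (2 : ℝ) • z⟫ := real_inner_self_nonneg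
  simp only [inner_sub_left, inner_sub_right, inner_add_left, inner_add_right, inner_smul_left,
    inner_smul_right, inner_self_coe, conj_trivial] at h1
  rw [real_inner_comm (x : E3) y, real_inner_comm (x : E3) z, real_inner_comm (y : E3) z] at h1
  rw [real_inner_comm (x : E3) z, real_inner_comm (y : E3) z]
  linarith

theorem exists_free_cap {h : S2 ≃ₜ S2} {x : S2} (hx : h x ≠ x) :
    ∃ s, 0 ≤ s ∧ s < 1 ∧ FreeSet h {y : S2 | s ≤ ⟪(y : E3), x⟫} := by
  obtain ⟨W, hW, hxW, hf⟩ := FreeSet.exists_isOpen (h := h) (isCompact_singleton (x := x))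
    (by rintro _ rfl; exact hx)
  obtain ⟨ε, hε, hball⟩ := Metric.isOpen_iff.1 hW x (hxW rfl)
  refine ⟨max 0 (1 - ε ^ 2 / 4), le_max_left _ _, max_lt one_pos (by nlinarith), hf.mono ?_⟩
  intro y hy
  apply hball
  have h1 : 1 - ε ^ 2 / 4 ≤ ⟪(y : E3), x⟫ := (le_max_right _ _).trans hy
  rw [Metric.mem_ball, Subtype.dist_eq, dist_eq_norm]
  have := norm_sub_sq_coe y x
  by_contra hle
  push Not at hle
  have : ε ^ 2 ≤ ‖(y : E3) - x‖ ^ 2 := by gcongr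
  nlinarith

theorem exists_enumeration {α : Type*} [Inhabited α] (A B : Finset α) :
    ∃ (c : ℕ → α) (m n : ℕ), m ≤ n ∧ InjOn c (Iio m) ∧ (∀ y, y ∈ A ↔ ∃ i < m, c i = y) ∧
      ∀ y, y ∈ B ↔ ∃ i, m ≤ i ∧ i < n ∧ c i = y := by
  have key : ∀ A : Finset α, ∃ (c : ℕ → α) (m : ℕ), InjOn c (Iio m) ∧
      ∀ y, y ∈ A ↔ ∃ i < m, c i = y := by
    intro A
    refine ⟨fun i => A.toList.getD i default, A.toList.length, ?_, fun y => ?_⟩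
    · intro i hi j hj hij
      rw [mem_Iio] at hi hj
      beta_reduce at hij
      rw [List.getD_eq_getElem _ _ hi, List.getD_eq_getElem _ _ hj] at hij
      exact (A.nodup_toList.getElem_inj_iff).1 hij
    · rw [← Finset.mem_toList, List.mem_iff_getElem]
      constructor
      · rintro ⟨i, hi, rfl⟩; exact ⟨i, hi, List.getD_eq_getElem _ _ hi⟩
      · rintro ⟨i, hi, rfl⟩; exact ⟨i, hi, (List.getD_eq_getElem _ _ hi).symm⟩
  obtain ⟨a, m, ha, hA⟩ := key A
  obtain ⟨b, k, -, hB⟩ := key B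
  have h1 : ∀ i < m, (fun i => if i < m then a i else b (i - m)) i = a i := fun i hi => if_pos hi
  have h2 : ∀ i, m ≤ i → (fun i => if i < m then a i else b (i - m)) i = b (i - m) :=
    fun i hi => if_neg (not_lt.2 hi)
  refine ⟨fun i => if i < m then a i else b (i - m), m, m + k, by omega, ?_, fun y => ?_,
    fun y => ?_⟩
  · intro i hi j hj hij
    rw [h1 i hi, h1 j hj] at hij
    exact ha hi hj hij
  · rw [hA]
    constructor
    · rintro ⟨i, hi, rfl⟩; exact ⟨i, hi, h1 i hi⟩
    · rintro ⟨i, hi, rfl⟩; exact ⟨i, hi, (h1 i hi).symm⟩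
  · rw [hB]
    constructor
    · rintro ⟨i, hi, rfl⟩
      exact ⟨m + i, by omega, by omega, by rw [h2 _ (by omega), Nat.add_sub_cancel_left]⟩
    · rintro ⟨i, hi, hi', rfl⟩; exact ⟨i - m, by omega, (h2 i hi).symm⟩

/-- A family of caps in general position covering the sphere: the first `m` are centred at the
fixed points, the other ones are free. -/
structure IsScaffold (h : S2 ≃ₜ S2) (w₀ : ℝ) (c : ℕ → S2) (t : ℕ → ℝ) (m n : ℕ) : Prop where
  le : m ≤ n
  arrangement : IsArrangement c t n
  sq_ne : ∀ i < n, t i ^ 2 ≠ 1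
  cover : ∀ y : S2, ∃ i < n, t i < ⟪(y : E3), c i⟫
  ends : ∀ i < m, t i = hgt w₀
  fixed : ∀ y, h y = y ↔ ∃ i < m, c i = y
  separated : ∀ i < m, ∀ j < m, i ≠ j → ∀ y : S2, hgt w₀ ≤ ⟪(y : E3), c i⟫ →
    ⟪(y : E3), c j⟫ < hgt w₀
  far : ∀ i < m, ∃ y : S2, ⟪(y : E3), c i⟫ < hgt w₀ ∧ ⟪(h y : E3), c i⟫ < hgt w₀
  free : ∀ i, m ≤ i → i < n → FreeSet h {y : S2 | t i ≤ ⟪(y : E3), c i⟫}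

noncomputable instance : Inhabited S2 := ⟨⟨EuclideanSpace.single 0 1, by simp⟩⟩

theorem exists_ne_point (p : S2) : ∃ y : S2, y ≠ p :=
  ⟨-p, (ne_neg_of_mem_unit_sphere ℝ p).symm⟩

theorem eventually_lt_hgt {s : ℝ} (hs : s < 1) : ∀ᶠ w in Filter.atTop, s < hgt w :=
  tendsto_hgt.eventually (lt_mem_nhds hs)

/-- The level `w₀` is taken so high that the caps around the fixed points are disjoint and each of
them misses some point together with its image. The complement of the open caps is compact without
fixed points, so finitely many free caps cover it, and their heights are perturbed into general
position. -/
theorem exists_isScaffold {h : S2 ≃ₜ S2} (hfin : (Function.fixedPoints h).Finite) :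
    ∃ w₀ c t m n, IsScaffold h w₀ c t m n := by
  have hw : ∀ᶠ w in Filter.atTop, (∀ p ∈ Function.fixedPoints h, ∀ q ∈ Function.fixedPoints h,
      p ≠ q → (3 + ⟪(p : E3), q⟫) / 4 < hgt w) ∧ ∀ p ∈ Function.fixedPoints h,
      ∃ y : S2, ⟪(y : E3), p⟫ < hgt w ∧ ⟪(h y : E3), p⟫ < hgt w := by
    refine Filter.Eventually.and ?_ ?_
    · rw [Filter.eventually_all_finite hfin]
      intro p _
      rw [Filter.eventually_all_finite hfin]
      intro q _
      by_cases hpq : p = q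
      · exact Filter.Eventually.of_forall fun w hne => (hne hpq).elim
      · have := inner_lt_one hpq
        filter_upwards [eventually_lt_hgt (show (3 + ⟪(p : E3), q⟫) / 4 < 1 by linarith)]
          with w hw _ using hw
    · rw [Filter.eventually_all_finite hfin]
      intro p hp
      obtain ⟨y, hy⟩ := exists_ne_point p
      have hy' : h y ≠ p := fun h' => hy (h.injective (h'.trans (show h p = p from hp).symm))
      filter_upwards [eventually_lt_hgt (inner_lt_one hy), eventually_lt_hgt (inner_lt_one hy')]
        with w h1 h2 using ⟨y, h1, h2⟩
  obtain ⟨w₀, hw1, hw2⟩ := hw.exists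
  have hsep : ∀ p ∈ Function.fixedPoints h, ∀ q ∈ Function.fixedPoints h, p ≠ q → ∀ y : S2,
      hgt w₀ ≤ ⟪(y : E3), p⟫ → ⟪(y : E3), q⟫ < hgt w₀ := by
    intro p hp q hq hpq y hy
    have h1 := hw1 p hp q hq hpq
    have h2 := inner_add_inner_le p q y
    linarith
  set K : Set S2 := ⋂ p ∈ Function.fixedPoints h, {y : S2 | ⟪(y : E3), p⟫ ≤ hgt w₀} with hK
  have hKc : IsCompact K :=
    (isClosed_biInter fun p _ => isClosed_le (continuous_inner_coe p) continuous_const).isCompact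
  have hKne : ∀ x ∈ K, h x ≠ x := by
    intro x hx hfix
    have h1 : ⟪(x : E3), x⟫ ≤ hgt w₀ := mem_iInter₂.1 hx x hfix
    rw [inner_self_coe] at h1
    exact h1.not_gt (hgt_lt_one w₀)
  have hcap : ∀ x : S2, ∃ s, 0 ≤ s ∧ s < 1 ∧
      (x ∈ K → FreeSet h {y : S2 | s ≤ ⟪(y : E3), x⟫}) := by
    intro x
    by_cases hx : x ∈ K
    · obtain ⟨s, h1, h2, h3⟩ := exists_free_cap (hKne x hx)
      exact ⟨s, h1, h2, fun _ => h3⟩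
    · exact ⟨0, le_rfl, one_pos, fun h' => (hx h').elim⟩
  choose s hs0 hs1 hsf using hcap
  -- The cover uses the height `(s x + 1) / 2`, while freeness holds from `s x` on: any height in
  -- between still gives free caps that cover, which leaves room for general position.
  obtain ⟨B, hBK, hB⟩ := hKc.elim_nhds_subcover
    (fun x => {y : S2 | (s x + 1) / 2 < ⟪(y : E3), x⟫}) (fun x _ =>
      (isOpen_lt continuous_const (continuous_inner_coe x)).mem_nhds (by
        rw [mem_ofPred_eq, inner_self_coe]; linarith [hs1 x]))
  obtain ⟨c, m, n, hmn, hinj, hA, hcB⟩ := exists_enumeration hfin.toFinset B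
  have hfix : ∀ i < m, c i ∈ Function.fixedPoints h := fun i hi =>
    hfin.mem_toFinset.1 ((hA _).2 ⟨i, hi, rfl⟩)
  have hsep' : ∀ i < m, ∀ j < m, i ≠ j → ∀ y : S2, hgt w₀ ≤ ⟪(y : E3), c i⟫ →
      ⟪(y : E3), c j⟫ < hgt w₀ := fun i hi j hj hij =>
    hsep _ (hfix i hi) _ (hfix j hj) fun h' => hij (hinj hi hj h')
  -- The circles around the fixed points are disjoint, so they are in general position with their
  -- prescribed heights.
  have harr : IsArrangement c (fun _ => hgt w₀) m := by
    refine ⟨fun i j hij hj x h1 h2 => ?_, fun i j k hij hjk hk x h1 h2 => ?_⟩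
    · exact absurd h2 (hsep' i (by omega) j hj hij.ne x h1.ge).ne
    · exact absurd h2 (hsep' i (by omega) j (by omega) hij.ne x h1.ge).ne
  obtain ⟨t, ht, ht1, ht2⟩ := exists_arrangement (lo := fun i => s (c i))
    (hi := fun i => (s (c i) + 1) / 2) hmn (fun i => by linarith [hs1 (c i)]) harr
  refine ⟨w₀, c, t, m, n, hmn, ht, ?_, ?_, ht1, ?_, hsep', fun i hi => hw2 _ (hfix i hi), ?_⟩
  · intro i hi
    rcases lt_or_ge i m with h1 | h1
    · rw [ht1 i h1]
      have := hgt_lt_one w₀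
      have := neg_one_lt_hgt w₀
      nlinarith
    · have := ht2 i h1 hi
      have h2 := hs0 (c i)
      have h3 := hs1 (c i)
      have h4 : t i < 1 := by linarith [this.2]
      have h5 : 0 < t i := by linarith [this.1]
      nlinarith
  · intro y
    by_cases hy : y ∈ K
    · obtain ⟨x, hx, hyx⟩ := mem_iUnion₂.1 (hB hy)
      obtain ⟨i, h1, h2, rfl⟩ := (hcB x).1 hx
      exact ⟨i, h2, (ht2 i h1 h2).2.trans hyx⟩
    · simp only [hK, mem_iInter, not_forall, mem_ofPred_eq, not_le] at hy
      obtain ⟨p, hp, hlt⟩ := hy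
      obtain ⟨i, hi, rfl⟩ := (hA p).1 (hfin.mem_toFinset.2 hp)
      exact ⟨i, by omega, by rwa [ht1 i hi]⟩
  · intro y
    rw [← hA, hfin.mem_toFinset]
    rfl
  · intro i h1 h2
    refine (hsf (c i) (hBK _ ((hcB _).2 ⟨i, h1, h2, rfl⟩))).mono fun y hy => ?_
    exact (ht2 i h1 h2).1.le.trans hy

end BrickDecomposition

/-! ### The tiling of the complement of the fixed points. -/

namespace BrickDecomposition

open Set Topology

open scoped RealInnerProductSpace

instance : LocallyConnectedSpace S2 :=
  haveI : Fact (Module.finrank ℝ E3 = 2 + 1) := ⟨by simp⟩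
  ChartedSpace.locallyConnectedSpace (EuclideanSpace ℝ (Fin 2)) S2

/-- The angles of the points of the level `w₀` around `c i` which belong to another circle. -/
def crossings (w₀ : ℝ) (c : ℕ → S2) (t : ℕ → ℝ) (n i : ℕ) : Set ℝ :=
  {θ | ∃ j < n, j ≠ i ∧ ⟪(polar (c i) (w₀, θ) : E3), c j⟫ = t j}

/-- The part of the sphere divided by the free caps. -/
def core (c : ℕ → S2) (t : ℕ → ℝ) (m n : ℕ) : Set S2 := ⋃ k ∈ Ico m n, region c t k

theorem isOpen_core {c : ℕ → S2} {t : ℕ → ℝ} {m n : ℕ} : IsOpen (core c t m n) :=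
  isOpen_biUnion fun k _ => isOpen_region k

/-- The position of a brick in the rows around the fixed points. -/
structure RingIndex {m : ℕ} (rows : Fin m → ℕ → ℕ → Row) (N : Fin m → ℕ → ℕ) where
  p : Fin m
  k : ℕ
  n : ℕ
  i : ℤ
  n_le : n ≤ N p k
  i_nonneg : 0 ≤ i
  i_lt : i < (rows p k n).m

/-- The indices of the tiles: the components of the core, and the bricks around the fixed
points. -/
abbrev TileIndex {m : ℕ} (c : ℕ → S2) (t : ℕ → ℝ) (n : ℕ) (rows : Fin m → ℕ → ℕ → Row)
    (N : Fin m → ℕ → ℕ) : Type :=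
  {C : Set S2 // ∃ x ∈ core c t m n, C = connectedComponentIn (core c t m n) x} ⊕ RingIndex rows N

namespace IsScaffold

variable {h : S2 ≃ₜ S2} {w₀ : ℝ} {c : ℕ → S2} {t : ℕ → ℝ} {m n : ℕ}

theorem nofix (H : IsScaffold h w₀ c t m n) {i : ℕ} (hi : i < m) (u θ : ℝ) (hu : w₀ ≤ u) :
    h (polar (c i) (u, θ)) ≠ polar (c i) (u, θ) := by
  intro h0
  obtain ⟨j, hj, hy⟩ := (H.fixed _).1 h0
  have h1 := inner_polar (c i) u θ
  have h2 := hgt_lt_one u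
  by_cases hij : i = j
  · rw [← hij] at hy
    rw [← hy, inner_self_coe] at h1
    linarith
  · have h3 := H.separated i hi j hj hij (polar (c i) (u, θ))
      (by rw [h1]; exact strictMono_hgt.monotone hu)
    rw [← hy, inner_self_coe] at h3
    linarith [hgt_lt_one w₀]

/-- Polar coordinates around the fixed points. -/
noncomputable def polarEnd (H : IsScaffold h w₀ c t m n) (i : Fin m) : PolarEnd h w₀ :=
  BrickDecomposition.polarEnd (c i) (H.nofix i.2)

/-- The circle meets the other ones at finitely many points, and each point has countably many
angles. -/
theorem countable_crossings (H : IsScaffold h w₀ c t m n) (i : Fin m) :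
    (crossings w₀ c t n i).Countable := by
  have hfin : (⋃ j ∈ {j | j < n ∧ j ≠ i}, {x : S2 | ⟪(x : E3), c i⟫ = hgt w₀ ∧
      ⟪(x : E3), c j⟫ = t j}).Finite := by
    refine ((finite_Iio n).subset fun j hj => hj.1).biUnion fun j hj => ?_
    refine finite_inter_circles fun x h1 h2 => ?_
    rw [← H.ends i i.2] at h1
    rcases lt_or_gt_of_ne hj.2 with h3 | h3
    · have := H.arrangement.spans j i h3 (i.2.trans_le H.le) x h2 h1
      exact fun v e1 e2 e3 => this v e1 e3 e2
    · exact H.arrangement.spans i j h3 hj.1 x h1 h2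
  refine (hfin.countable.biUnion (t := fun x _ => {θ | polar (c i) (w₀, θ) = x}) ?_).mono ?_
  · intro x _
    rcases {θ | polar (c i) (w₀, θ) = x}.eq_empty_or_nonempty with he | ⟨θ, hθ⟩
    · rw [he]; exact countable_empty
    · refine (countable_range fun k : ℤ => θ + k).mono fun θ' hθ' => ?_
      obtain ⟨-, k, hk⟩ := polar_inj (c i) w₀ θ w₀ θ' (Eq.trans hθ (Eq.symm hθ'))
      exact ⟨k, hk.symm⟩
  · rintro θ ⟨j, hj, hji, hθ⟩
    exact mem_iUnion₂.2 ⟨_, mem_iUnion₂.2 ⟨j, ⟨hj, hji⟩, inner_polar _ _ _, hθ⟩, rfl⟩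

theorem inner_lt_of_mem_core (H : IsScaffold h w₀ c t m n) {y : S2} (hy : y ∈ core c t m n)
    {i : ℕ} (hi : i < m) : ⟪(y : E3), c i⟫ < hgt w₀ := by
  obtain ⟨k, hk, hyk⟩ := mem_iUnion₂.1 hy
  rw [← H.ends i hi]
  exact hyk.2 i (hi.trans_le hk.1)

theorem isOpen_far (w₀ : ℝ) (c : ℕ → S2) (m : ℕ) (A : Set ℕ) :
    IsOpen {y : S2 | ∀ k < m, k ∉ A → ⟪(y : E3), c k⟫ < hgt w₀} := by
  have : {y : S2 | ∀ k < m, k ∉ A → ⟪(y : E3), c k⟫ < hgt w₀} =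
      ⋂ k ∈ {k | k < m ∧ k ∉ A}, {y : S2 | ⟪(y : E3), c k⟫ < hgt w₀} := by
    ext y; simp
  rw [this]
  exact ((finite_Iio m).subset fun k hk => hk.1).isOpen_biInter fun k _ =>
    isOpen_lt (continuous_inner_coe _) continuous_const

variable {rows : Fin m → ℕ → ℕ → Row} {N : Fin m → ℕ → ℕ}

/-- The tiles: the components of the core, and the bricks around the fixed points. -/
noncomputable def tile (H : IsScaffold h w₀ c t m n) (rows : Fin m → ℕ → ℕ → Row)
    (N : Fin m → ℕ → ℕ) : TileIndex c t n rows N → Set S2 :=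
  Sum.elim Subtype.val fun q => (H.polarEnd q.p).openBrick (rows q.p q.k q.n) q.i

variable (H : IsScaffold h w₀ c t m n)

include H in
-- The regions are disjoint and open, so a component of the core lies in a single region, hence in a
-- free closed cap.
theorem closure_component {C : Set S2}
    (hC : ∃ x ∈ core c t m n, C = connectedComponentIn (core c t m n) x) :
    FreeSet h (closure C) ∧ ∀ y ∈ closure C, ∀ i < m, ⟪(y : E3), c i⟫ ≤ hgt w₀ := by
  obtain ⟨x, hx, rfl⟩ := hC
  have hsub := connectedComponentIn_subset (core c t m n) x
  constructor
  · obtain ⟨k, hk, hxk⟩ := mem_iUnion₂.1 hx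
    have hCk : connectedComponentIn (core c t m n) x ⊆ region c t k := by
      have : core c t m n ⊆ region c t k ∪ ⋃ j ∈ {j | j ≠ k}, region c t j := by
        refine iUnion₂_subset fun j hj => ?_
        by_cases hjk : j = k
        · rw [hjk]; exact subset_union_left
        · exact (subset_biUnion_of_mem (u := fun j => region c t j) hjk).trans subset_union_right
      refine isPreconnected_connectedComponentIn.subset_left_of_subset_union (isOpen_region k)
        (isOpen_biUnion fun j _ => isOpen_region j) ?_ (hsub.trans this)
        ⟨x, mem_connectedComponentIn hx, hxk⟩
      rw [Set.disjoint_left]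
      intro y hy hy'
      obtain ⟨j, hj, hyj⟩ := mem_iUnion₂.1 hy'
      exact hj (eq_of_mem_region hyj hy)
    refine (H.free k hk.1 hk.2).mono (closure_minimal (fun y hy => (hCk hy).1.le) ?_)
    exact isClosed_le continuous_const (continuous_inner_coe _)
  · intro y hy i hi
    have : closure (connectedComponentIn (core c t m n) x) ⊆ {y : S2 | ⟪(y : E3), c i⟫ ≤ hgt w₀} :=
      closure_minimal (fun y hy => (H.inner_lt_of_mem_core (hsub hy) hi).le)
        (isClosed_le (continuous_inner_coe _) continuous_const)
    exact this hy

theorem exists_of_mem_brick {i : Fin m} {r : Row} {j : ℤ} {y : S2}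
    (hy : y ∈ (H.polarEnd i).brick r j) :
    ∃ u θ, u ∈ Icc r.bot r.top ∧ polar (c i) (u, θ) = y ∧ ⟪(y : E3), c i⟫ = hgt u := by
  obtain ⟨⟨u, θ⟩, ⟨hu, -⟩, rfl⟩ := hy
  exact ⟨u, θ, hu, rfl, inner_polar _ _ _⟩

theorem exists_tile_of_mem_ring {i : Fin m} {k n' : ℕ} (hn : n' ≤ N i k) {y : S2}
    (hy : y ∈ (H.polarEnd i).ring (rows i k n')) : ∃ q, y ∈ H.tile rows N q := by
  obtain ⟨j, h0, h1, hj⟩ := (H.polarEnd i).exists_openBrick_of_mem_ring hy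
  exact ⟨Sum.inr ⟨i, k, n', j, hn, h0, h1⟩, hj⟩

theorem exists_tile_of_mem_core {y : S2} (hy : y ∈ core c t m n) : ∃ q, y ∈ H.tile rows N q :=
  ⟨Sum.inl ⟨_, y, hy, rfl⟩, mem_connectedComponentIn hy⟩

/-- Near a point which is outside the caps centred at the fixed points, the tiles are regions. -/
theorem exists_chart_core {x : S2} (hx : ∀ i < m, ⟪(x : E3), c i⟫ < hgt w₀) :
    ∃ φ : OpenPartialHomeomorph S2 ℂ, x ∈ φ.source ∧ φ x = 0 ∧
      ∀ y ∈ φ.source, φ y ∉ teeModel → ∃ q, y ∈ H.tile rows N q := by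
  obtain ⟨φ, h1, h2, h3⟩ := H.arrangement.exists_chart H.sq_ne H.cover x
  refine ⟨φ.restrOpen _ (isOpen_far w₀ c m ∅), ⟨h1, fun i hi _ => hx i hi⟩, h2, ?_⟩
  rintro y ⟨hy, hy'⟩ hyt
  obtain ⟨k, hk, hyk⟩ := h3 y hy hyt
  refine H.exists_tile_of_mem_core (mem_iUnion₂.2 ⟨k, ⟨?_, hk⟩, hyk⟩)
  by_contra! hkm
  have := hyk.1
  rw [H.ends k hkm] at this
  linarith [hy' k hkm (notMem_empty k)]

variable (T : ∀ i, (H.polarEnd i).IsTower (crossings w₀ c t n i) (rows i) (N i))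

include T

/-- On the circle bounding the cap of a fixed point, either another circle of the arrangement
arrives from outside or a cut of the first row arrives from inside, never both, because the cuts
avoid `crossings`. In the first case the chart of the arrangement is used, and in the second the
chart at the base of a row. -/
theorem exists_chart_boundary (i : Fin m) (θ : ℝ) :
    ∃ φ : OpenPartialHomeomorph S2 ℂ, polar (c i) (w₀, θ) ∈ φ.source ∧
      φ (polar (c i) (w₀, θ)) = 0 ∧
      ∀ y ∈ φ.source, φ y ∉ teeModel → ∃ q, y ∈ H.tile rows N q := by
  have hbot : (rows i 0 0).bot = w₀ := by rw [(T i).bot, Nat.cast_zero, add_zero]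
  have hx := inner_polar (c i) w₀ θ
  have hfar : ∀ k < m, k ∉ ({(i : ℕ)} : Set ℕ) → ⟪(polar (c i) (w₀, θ) : E3), c k⟫ < hgt w₀ :=
    fun k hk hki => H.separated i i.2 k hk (fun h' => hki h'.symm) _ hx.ge
  have hcore : ∀ y : S2, ∀ k < n, y ∈ region c t k →
      (∀ k < m, k ∉ ({(i : ℕ)} : Set ℕ) → ⟪(y : E3), c k⟫ < hgt w₀) → k ≠ i →
      ∃ q, y ∈ H.tile rows N q := by
    intro y k hk hyk hy hki
    refine H.exists_tile_of_mem_core (mem_iUnion₂.2 ⟨k, ⟨?_, hk⟩, hyk⟩)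
    by_contra! hkm
    have := hyk.1
    rw [H.ends k hkm] at this
    linarith [hy k hkm hki]
  by_cases hθ : θ ∈ crossings w₀ c t n i
  · obtain ⟨ε, hε, hε0⟩ := (((rows i 0 0).eventually_notMem_range θ).and self_mem_nhdsWithin).exists
    replace hε0 : 0 < ε := hε0
    obtain ⟨φ, h1, h2, h3⟩ := H.arrangement.exists_chart H.sq_ne H.cover (polar (c i) (w₀, θ))
    have hW : IsOpen (polar (c i) '' (Iio (rows i 0 0).top ×ˢ Ioo (θ - ε) (θ + ε))) :=
      isOpenMap_polar _ _ (isOpen_Iio.prod isOpen_Ioo)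
    refine ⟨φ.restrOpen _ (hW.inter (isOpen_far w₀ c m {(i : ℕ)})), ⟨h1, ⟨(w₀, θ), ⟨?_, ?_⟩, rfl⟩,
      hfar⟩, h2, ?_⟩
    · have := (rows i 0 0).bot_lt
      rw [hbot] at this
      exact this
    · constructor <;> dsimp only <;> linarith
    · rintro y ⟨hy, ⟨⟨u, θ'⟩, ⟨hu, hθ'⟩, rfl⟩, hyf⟩ hyt
      obtain ⟨k, hk, hyk⟩ := h3 _ hy hyt
      by_cases hki : k = i
      · have h4 := hyk.1
        rw [hki, H.ends i i.2, inner_polar] at h4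
        refine H.exists_tile_of_mem_ring (i := i) (k := 0) (n' := 0) (Nat.zero_le _)
          ⟨(u, θ'), ⟨⟨?_, hu⟩, ?_⟩, rfl⟩
        · rw [hbot]; exact strictMono_hgt.lt_iff_lt.1 h4
        · by_cases hne : θ' = θ
          · dsimp only
            rw [hne]
            rintro ⟨j, rfl⟩
            exact (T i).cuts j hθ
          · refine hε θ' ?_ hne
            rw [abs_lt]
            constructor <;> linarith [hθ'.1, hθ'.2]
      · exact hcore _ k hk hyk hyf hki
  · obtain ⟨W, hW, hxW, hWne⟩ := eventually_inner_ne c t n (polar (c i) (w₀, θ))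
    obtain ⟨φ, h1, h2, h3⟩ := (H.polarEnd i).exists_chart_base (rows i 0 0) θ
    rw [hbot] at h1 h2 h3
    refine ⟨φ.restrOpen _ (hW.inter (isOpen_far w₀ c m {(i : ℕ)})), ⟨h1, hxW, hfar⟩, h2, ?_⟩
    rintro y ⟨hy, hyW, hyf⟩ hyt
    rcases h3 y hy hyt with h4 | ⟨u, θ', hu, rfl⟩
    · exact H.exists_tile_of_mem_ring (Nat.zero_le _) h4
    · have hlow : ⟪(polar (c i) (u, θ') : E3), c i⟫ < t i := by
        rw [inner_polar, H.ends i i.2]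
        exact strictMono_hgt hu
      obtain ⟨k, hk, hyk⟩ := exists_mem_region (H.cover (polar (c i) (u, θ'))) (fun k _ l _ hl => by
        by_cases hli : l = i
        · rw [hli]; exact hlow.ne
        · exact hWne _ hyW l hl fun h' => hθ ⟨l, hl, hli, h'⟩)
      refine hcore _ k hk hyk hyf ?_
      rintro rfl
      exact hyk.1.not_gt hlow

theorem isTiling : IsTiling h (H.tile rows N) where
  isOpen := by
    rintro (⟨C, x, hx, rfl⟩ | q)
    · exact isOpen_core.connectedComponentIn
    · exact (H.polarEnd q.p).isOpen_openBrick _ _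
  isPreconnected := by
    rintro (⟨C, x, hx, rfl⟩ | q)
    · exact isPreconnected_connectedComponentIn
    · exact (H.polarEnd q.p).isPreconnected_openBrick _ _
  nonempty := by
    rintro (⟨C, x, hx, rfl⟩ | q)
    · exact ⟨x, mem_connectedComponentIn hx⟩
    · exact (H.polarEnd q.p).nonempty_openBrick _ _
  disjoint := by
    have hlow : ∀ q : RingIndex rows N, ∀ y ∈ H.tile rows N (Sum.inr q),
        hgt w₀ < ⟪(y : E3), c q.p⟫ := by
      rintro q y ⟨⟨u, θ⟩, ⟨hu, -⟩, rfl⟩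
      have h1 : ⟪(polar (c q.p) (u, θ) : E3), c q.p⟫ = hgt u := inner_polar _ _ _
      refine lt_of_lt_of_eq (strictMono_hgt ?_) h1.symm
      have h2 := (T q.p).le_bot q.n_le
      have h3 : (0 : ℝ) ≤ q.k := by positivity
      linarith [hu.1]
    have hcr : ∀ C q, Disjoint (H.tile rows N (Sum.inl C)) (H.tile rows N (Sum.inr q)) := by
      rintro ⟨C, x, hx, rfl⟩ q
      rw [Set.disjoint_left]
      intro y hy hy'
      have h1 := H.inner_lt_of_mem_core (connectedComponentIn_subset _ _ hy) q.p.2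
      linarith [hlow q y hy']
    rintro (⟨C, x, hx, rfl⟩ | q) (⟨C', x', hx', rfl⟩ | q') hne
    · rw [Set.disjoint_left]
      intro y hy hy'
      refine hne (congrArg _ (Subtype.ext ?_))
      exact (connectedComponentIn_eq hy).trans (connectedComponentIn_eq hy').symm
    · exact hcr _ _
    · exact (hcr _ _).symm
    · rw [Set.disjoint_left]
      intro y hy hy'
      have hp : q.p = q'.p := by
        by_contra hp
        have := H.separated q.p q.p.2 q'.p q'.p.2 (fun h' => hp (Fin.ext h')) y (hlow q y hy).le
        linarith [hlow q' y hy']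
      obtain ⟨p, k, n₁, i, e1, e2, e3⟩ := q
      obtain ⟨p', k', n₁', i', e1', e2', e3'⟩ := q'
      obtain rfl : p = p' := hp
      obtain ⟨rfl, rfl, rfl⟩ := (T p).eq_of_mem e1 e1' e2 e3 e2' e3' hy hy'
      exact hne rfl
  closure_subset := by
    rintro (⟨C, hC⟩ | q) y hy hfix
    · have := (H.closure_component hC).1 y hy
      rw [show h y = y from hfix] at this
      exact this hy
    · change y ∈ closure ((H.polarEnd q.p).openBrick (rows q.p q.k q.n) q.i) at hy
      rw [PolarEnd.closure_openBrick] at hy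
      obtain ⟨u, θ, hu, rfl, -⟩ := H.exists_of_mem_brick hy
      refine H.nofix q.p.2 u θ ?_ hfix
      have h2 := (T q.p).le_bot q.n_le
      have h3 : (0 : ℝ) ≤ q.k := by positivity
      linarith [hu.1]
  chart := by
    intro x hx
    by_cases hcore : ∀ i < m, ⟪(x : E3), c i⟫ < hgt w₀
    · obtain ⟨φ, h1, h2, h3⟩ := H.exists_chart_core (rows := rows) (N := N) hcore
      exact ⟨φ, h1, h2, fun y hy _ => h3 y hy⟩
    · push Not at hcore
      obtain ⟨i, hi, hle⟩ := hcore
      have hne : x ≠ c i := fun h' => hx ((H.fixed x).2 ⟨i, hi, h'.symm⟩)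
      obtain ⟨u, θ, hu, rfl⟩ := exists_polar_of_le hne hle
      rcases hu.lt_or_eq with hu | rfl
      · obtain ⟨φ, h1, h2, h3⟩ := (T ⟨i, hi⟩).exists_chart hu θ
        refine ⟨φ, h1, h2, fun y hy _ hyt => ?_⟩
        obtain ⟨k, n', hn', hy'⟩ := h3 y hy hyt
        exact H.exists_tile_of_mem_ring hn' hy'
      · obtain ⟨φ, h1, h2, h3⟩ := H.exists_chart_boundary T ⟨i, hi⟩ θ
        exact ⟨φ, h1, h2, fun y hy _ => h3 y hy⟩

end IsScaffold

end BrickDecomposition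

/-! ### Circle barriers, and the pieces as classes of tiles. -/

namespace BrickDecomposition

open Set Topology

open scoped RealInnerProductSpace

instance : ConnectedSpace S2 :=
  Subtype.connectedSpace (isConnected_sphere (by
    rw [← Module.finrank_eq_rank, finrank_euclideanSpace_fin]; norm_num) _ zero_le_one)

instance : Nontrivial S2 := ⟨default, _, (exists_ne_point default).choose_spec.symm⟩

/-- The complement of an open cap is connected. -/
theorem isPreconnected_inner_le (p : S2) (v : ℝ) :
    IsPreconnected {y : S2 | ⟪(y : E3), p⟫ ≤ hgt v} := by
  have h1 : IsPreconnected (polar p '' (Iic v ×ˢ univ)) :=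
    (isPreconnected_Iic.prod isPreconnected_univ).image _ (continuous_polar p).continuousOn
  have h2 : ∀ y : S2, ⟪(y : E3), p⟫ ≤ hgt v → y ≠ -p → y ∈ polar p '' (Iic v ×ˢ univ) := by
    intro y hy hne
    obtain ⟨u, θ, rfl⟩ := exists_polar (by
      rintro rfl
      rw [inner_self_coe] at hy
      linarith [hgt_lt_one v]) hne
    rw [inner_polar, strictMono_hgt.le_iff_le] at hy
    exact ⟨(u, θ), ⟨hy, mem_univ _⟩, rfl⟩
  -- Polar coordinates miss the antipode `-p`, which is recovered as a limit point.
  refine h1.subset_closure ?_ ?_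
  · rintro _ ⟨⟨u, θ⟩, ⟨hu, -⟩, rfl⟩
    rw [mem_ofPred_eq, inner_polar]
    exact strictMono_hgt.monotone hu
  · intro y hy
    by_cases hne : y = -p
    · rw [hne, mem_closure_iff_nhds]
      intro W hW
      have hO : {y : S2 | ⟪(y : E3), p⟫ < hgt v} ∈ 𝓝 (-p) :=
        (isOpen_lt (continuous_inner_coe p) continuous_const).mem_nhds (by
          rw [mem_ofPred_eq, inner_neg_self]
          exact neg_one_lt_hgt v)
      obtain ⟨z, ⟨hzW, hz⟩, hzne⟩ := ((Filter.inter_mem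
        (mem_nhdsWithin_of_mem_nhds (Filter.inter_mem hW hO)) self_mem_nhdsWithin) :
        _ ∈ 𝓝[≠] (-p)) |> Filter.nonempty_of_mem
      exact ⟨z, hzW, h2 z hz.le hzne⟩
    · exact subset_closure (h2 y hy hne)

/-- A free connected set containing a circle around a fixed point does not accumulate at this
fixed point. -/
theorem notMem_closure_of_circle {h : S2 ≃ₜ S2} {p : S2} (hp : h p = p) {v : ℝ}
    (hfar : ∃ y : S2, ⟪(y : E3), p⟫ ≤ hgt v ∧ ⟪(h y : E3), p⟫ ≤ hgt v) {B : Set S2}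
    (hB : IsPreconnected B) (hf : FreeSet h B) (hC : ∀ θ, polar p (v, θ) ∈ B) :
    p ∉ closure B := by
  intro hcl
  have hC' : ∀ y : S2, ⟪(y : E3), p⟫ = hgt v → y ∈ B := by
    intro y hy
    obtain ⟨u, θ, hu, rfl⟩ := exists_polar_of_le (p := p) (y := y) (by
      rintro rfl
      rw [inner_self_coe] at hy
      linarith [hgt_lt_one v]) hy.ge
    rw [inner_polar] at hy
    rw [strictMono_hgt.injective hy]
    exact hC θ
  have hDo : IsOpen {y : S2 | hgt v < ⟪(y : E3), p⟫} :=
    isOpen_lt continuous_const (continuous_inner_coe p)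
  have hDo' : IsOpen {y : S2 | ⟪(y : E3), p⟫ < hgt v} :=
    isOpen_lt (continuous_inner_coe p) continuous_const
  have hside : ∀ A : Set S2, IsPreconnected A → (∀ y ∈ A, ⟪(y : E3), p⟫ ≠ hgt v) →
      (∃ y ∈ A, hgt v < ⟪(y : E3), p⟫) → ∀ y ∈ A, hgt v < ⟪(y : E3), p⟫ := by
    intro A hA hne hy
    refine hA.subset_left_of_subset_union hDo hDo' ?_ (fun y hy => (hne y hy).lt_or_gt.symm) hy
    exact Set.disjoint_left.2 fun y hy hy' => (show hgt v < ⟪(y : E3), p⟫ from hy).not_gt hy'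
  have hacc : ∀ g : S2 ≃ₜ S2, g p = p → ∃ y ∈ g '' B, hgt v < ⟪(y : E3), p⟫ := by
    intro g hg
    have : p ∈ closure (g '' B) := by
      rw [← g.image_closure]; exact ⟨p, hcl, hg⟩
    obtain ⟨y, hy, hy'⟩ := mem_closure_iff.1 this _ hDo (by
      rw [mem_ofPred_eq, inner_self_coe]; exact hgt_lt_one v)
    exact ⟨y, hy', hy⟩
  -- The circle is in the free set `B`, so `h '' B` avoids it; accumulating at `p`, this connected
  -- set stays in the disc. The same applies to the inverse image.
  have h1 := hside (h '' B) (hB.image _ h.continuous.continuousOn) (by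
    rintro _ ⟨y, hy, rfl⟩ h0
    exact hf y hy (hC' _ h0)) (hacc h hp)
  have h2 := hside (h.symm '' B) (hB.image _ h.symm.continuous.continuousOn) (by
    rintro _ ⟨y, hy, rfl⟩ h0
    refine hf _ (hC' _ h0) ?_
    rwa [h.apply_symm_apply]) (hacc h.symm ((h.symm_apply_eq).2 hp.symm))
  -- The inverse image of the circle is in the open disc, so the image of the connected complement
  -- of the disc avoids the circle. It contains the image of the circle, which is in the disc, and
  -- so lies entirely in the disc, contrary to `hfar`.
  have h3 := hside (h '' {y : S2 | ⟪(y : E3), p⟫ ≤ hgt v})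
    ((isPreconnected_inner_le p v).image _ h.continuous.continuousOn) (by
    rintro _ ⟨y, hy, rfl⟩ h0
    have := h2 _ ⟨_, hC' _ h0, rfl⟩
    rw [h.symm_apply_apply] at this
    exact this.not_ge hy)
    ⟨_, ⟨polar p (v, 0), (inner_polar p v 0).le, rfl⟩, h1 _ ⟨_, hC 0, rfl⟩⟩
  obtain ⟨y, hy, hy'⟩ := hfar
  exact (h3 _ ⟨y, hy, rfl⟩).not_ge hy'

namespace IsScaffold

variable {h : S2 ≃ₜ S2} {w₀ : ℝ} {c : ℕ → S2} {t : ℕ → ℝ} {m n : ℕ}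
  {rows : Fin m → ℕ → ℕ → Row} {N : Fin m → ℕ → ℕ}

/-- The label of a brick. -/
def _root_.BrickDecomposition.RingIndex.lab (q : RingIndex rows N) : ℕ := (rows q.p q.k q.n).lab q.i

/-- Two bricks around the same fixed point, in the same stack of rows, are equivalent if they have
the same label. -/
def tileSetoid (c : ℕ → S2) (t : ℕ → ℝ) (n : ℕ) (rows : Fin m → ℕ → ℕ → Row)
    (N : Fin m → ℕ → ℕ) : Setoid (TileIndex c t n rows N) :=
  Setoid.ker (Sum.map id fun q => (q.p, q.k, q.lab))

theorem tileSetoid_inl_iff {C : _} {j : TileIndex c t n rows N} :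
    tileSetoid c t n rows N (Sum.inl C) j ↔ j = Sum.inl C := by
  change Sum.map id _ (Sum.inl C) = Sum.map id _ j ↔ _
  rcases j with C' | q
  · simp [eq_comm]
  · simp

theorem tileSetoid_inr_iff {q : RingIndex rows N} {j : TileIndex c t n rows N} :
    tileSetoid c t n rows N (Sum.inr q) j ↔
      ∃ q', j = Sum.inr q' ∧ q'.p = q.p ∧ q'.k = q.k ∧ q'.lab = q.lab := by
  change Sum.map id _ (Sum.inr q) = Sum.map id _ j ↔ _
  rcases j with C' | q'
  · simp
  · simp [eq_comm]

variable (H : IsScaffold h w₀ c t m n)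

theorem closure_tile_inr (q : RingIndex rows N) : closure (H.tile rows N (Sum.inr q)) =
    (H.polarEnd q.p).brick (rows q.p q.k q.n) q.i :=
  PolarEnd.closure_openBrick _ _ _

theorem closure_tile_inr_subset (q : RingIndex rows N) : closure (H.tile rows N (Sum.inr q)) ⊆
    (H.polarEnd q.p).pieces (rows q.p q.k) (N q.p q.k) q.lab := by
  rw [closure_tile_inr]
  intro y hy
  exact mem_iUnion₂.2 ⟨q.n, q.n_le, mem_iUnion₂.2 ⟨q.i, rfl, hy⟩⟩

theorem exists_of_mem_pieces {i : Fin m} {k l : ℕ} {y : S2}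
    (hy : y ∈ (H.polarEnd i).pieces (rows i k) (N i k) l) :
    ∃ q : RingIndex rows N, q.p = i ∧ q.k = k ∧ q.lab = l ∧
      y ∈ closure (H.tile rows N (Sum.inr q)) := by
  obtain ⟨n', hn', hy⟩ := mem_iUnion₂.1 hy
  obtain ⟨j, rfl, hyj⟩ := mem_iUnion₂.1 hy
  obtain ⟨j', k', h0, h1, rfl⟩ := (rows i k n').exists_reduce j
  rw [PolarEnd.brick_add_mul] at hyj
  refine ⟨⟨i, k, n', j', hn', h0, h1⟩, rfl, rfl, ?_, ?_⟩
  · exact (Row.lab_add_mul _ _ _).symm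
  · rw [closure_tile_inr]; exact hyj

theorem brickOf_inl (C : _) : brickOf (H.tile rows N) (tileSetoid c t n rows N) (Sum.inl C) =
    closure C.1 := by
  ext y
  rw [mem_brickOf]
  constructor
  · rintro ⟨j, hj, hy⟩
    rw [tileSetoid_inl_iff] at hj
    rwa [hj] at hy
  · exact fun hy => ⟨_, tileSetoid_inl_iff.2 rfl, hy⟩

theorem brickOf_inr (q : RingIndex rows N) :
    brickOf (H.tile rows N) (tileSetoid c t n rows N) (Sum.inr q) =
      (H.polarEnd q.p).pieces (rows q.p q.k) (N q.p q.k) q.lab := by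
  ext y
  rw [mem_brickOf]
  constructor
  · rintro ⟨j, hj, hy⟩
    obtain ⟨q', rfl, h1, h2, h3⟩ := tileSetoid_inr_iff.1 hj
    have := H.closure_tile_inr_subset q' hy
    rwa [h1, h2, h3] at this
  · intro hy
    obtain ⟨q', h1, h2, h3, h4⟩ := H.exists_of_mem_pieces hy
    exact ⟨_, tileSetoid_inr_iff.2 ⟨q', rfl, h1, h2, h3⟩, h4⟩

end IsScaffold

end BrickDecomposition

/-! ### Barriers stop free connected unions of pieces; conclusion. -/

namespace BrickDecomposition

open Set Topology

open scoped RealInnerProductSpace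

namespace IsScaffold

variable {h : S2 ≃ₜ S2} {w₀ : ℝ} {c : ℕ → S2} {t : ℕ → ℝ} {m n : ℕ}
  {rows : Fin m → ℕ → ℕ → Row} {N : Fin m → ℕ → ℕ}

variable (H : IsScaffold h w₀ c t m n)
  (T : ∀ i, (H.polarEnd i).IsTower (crossings w₀ c t n i) (rows i) (N i))

/-- The levels of the points of a brick. -/
theorem exists_level {q : RingIndex rows N} {y : S2}
    (hy : y ∈ closure (H.tile rows N (Sum.inr q))) :
    ∃ u, u ∈ Icc (rows q.p q.k q.n).bot (rows q.p q.k q.n).top ∧ ⟪(y : E3), c q.p⟫ = hgt u := by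
  rw [closure_tile_inr] at hy
  obtain ⟨u, -, hu, -, h2⟩ := H.exists_of_mem_brick hy
  exact ⟨u, hu, h2⟩

include T

/-- A point of a tile is outside the cap of a fixed point, or the tile is a brick around it. -/
theorem low_or_ring {j : TileIndex c t n rows N} {y : S2} (hy : y ∈ closure (H.tile rows N j))
    (i : Fin m) : ⟪(y : E3), c i⟫ ≤ hgt w₀ ∨ ∃ q, j = Sum.inr q ∧ q.p = i := by
  rcases j with ⟨C, hC⟩ | q
  · exact Or.inl ((H.closure_component hC).2 y hy i i.2)
  · by_cases hi : q.p = i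
    · exact Or.inr ⟨q, rfl, hi⟩
    · left
      obtain ⟨u, hu, h1⟩ := H.exists_level hy
      have h2 := (T q.p).le_bot q.n_le
      have h3 : (0 : ℝ) ≤ q.k := by positivity
      have h4 : hgt w₀ ≤ hgt u := strictMono_hgt.monotone (by linarith [hu.1])
      exact (H.separated q.p q.p.2 i i.2 (fun h' => hi (Fin.ext h')) y (by rw [h1]; exact h4)).le

/-- A connected union of labelled bricks crossing a stack of rows around a fixed point is not
free if the labels are separated by pieces which cannot be merged. -/
theorem not_freeSet_of_split {J : Set (TileIndex c t n rows N)}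
    (hJ : ∀ i ∈ J, ∀ j, tileSetoid c t n rows N i j → j ∈ J)
    (hconn : IsPreconnected (⋃ j ∈ J, closure (H.tile rows N j))) {i : Fin m} {k : ℕ} (hk : 0 < k)
    {j₁ j₂ : TileIndex c t n rows N} (hj₁ : j₁ ∈ J) (hj₂ : j₂ ∈ J)
    (hup : ∃ q, j₁ = Sum.inr q ∧ q.p = i ∧ k < q.k)
    (hlow : ∀ q, j₂ = Sum.inr q → q.p = i → q.k < k) {F : Set ℕ}
    (hF₁ : Disjoint (Set.range (rows i k 0).lab) F) (hF₂ : Set.range (rows i k (N i k)).lab ⊆ F)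
    (hF : ∀ l ∉ F, ∀ l' ∈ F, ((H.polarEnd i).pieces (rows i k) (N i k) l ∩
      (H.polarEnd i).pieces (rows i k) (N i k) l').Nonempty →
      ¬ FreeSet h ((H.polarEnd i).pieces (rows i k) (N i k) l ∪
        (H.polarEnd i).pieces (rows i k) (N i k) l')) :
    ¬ FreeSet h (⋃ j ∈ J, closure (H.tile rows N j)) := by
  have hT := H.isTiling T
  -- The tiles beyond the barrier: those of the later stacks around the same fixed point, and those
  -- of the `k`-th stack whose label is in the upper family.
  set A : Set (TileIndex c t n rows N) :=
    {j | ∃ q, j = Sum.inr q ∧ q.p = i ∧ (k < q.k ∨ q.k = k ∧ q.lab ∈ F)} with hA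
  -- By connectedness the part of the union beyond the barrier and the other part have a common
  -- adherent point. By local finiteness it will lie in the closure of one tile of each sort.
  obtain ⟨x, hx, hx₁, hx₂⟩ : ((⋃ j ∈ J, closure (H.tile rows N j)) ∩
      (closure (⋃ j ∈ J ∩ A, closure (H.tile rows N j)) ∩
        closure (⋃ j ∈ J \ A, closure (H.tile rows N j)))).Nonempty := by
    refine isPreconnected_closed_iff.1 hconn _ _ isClosed_closure isClosed_closure ?_ ?_ ?_
    · refine iUnion₂_subset fun j hj => ?_
      by_cases hjA : j ∈ A
      · exact ((subset_biUnion_of_mem (u := fun j => closure (H.tile rows N j))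
          (show j ∈ J ∩ A from ⟨hj, hjA⟩)).trans subset_closure).trans subset_union_left
      · exact ((subset_biUnion_of_mem (u := fun j => closure (H.tile rows N j))
          (show j ∈ J \ A from ⟨hj, hjA⟩)).trans subset_closure).trans subset_union_right
    · obtain ⟨y, hy⟩ := hT.nonempty j₁
      obtain ⟨q, hq, h1, h2⟩ := hup
      exact ⟨y, mem_iUnion₂.2 ⟨j₁, hj₁, subset_closure hy⟩, subset_closure
        (mem_iUnion₂.2 ⟨j₁, ⟨hj₁, q, hq, h1, Or.inl h2⟩, subset_closure hy⟩)⟩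
    · obtain ⟨y, hy⟩ := hT.nonempty j₂
      refine ⟨y, mem_iUnion₂.2 ⟨j₂, hj₂, subset_closure hy⟩, subset_closure
        (mem_iUnion₂.2 ⟨j₂, ⟨hj₂, ?_⟩, subset_closure hy⟩)⟩
      rintro ⟨q, hq, h1, h2⟩
      have := hlow q hq h1
      omega
  have hxd : x ∈ domain h := by
    obtain ⟨j, -, hj⟩ := mem_iUnion₂.1 hx
    exact hT.closure_subset j hj
  obtain ⟨_, ⟨ha, q, rfl, hqi, hq⟩, hxa⟩ := mem_iUnion₂.1 (hT.closure_biUnion _ ⟨hx₁, hxd⟩)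
  obtain ⟨b, ⟨hb, hbA⟩, hxb⟩ := mem_iUnion₂.1 (hT.closure_biUnion _ ⟨hx₂, hxd⟩)
  obtain ⟨u, hu, hxu⟩ := H.exists_level hxa
  have hbot := (T q.p).le_bot q.n_le
  have hk1 : (k : ℝ) ≤ q.k := by
    rcases hq with h1 | h1
    · exact_mod_cast h1.le
    · exact_mod_cast h1.1.ge
  have hk0 : (0 : ℝ) < k := by exact_mod_cast hk
  rw [hqi] at hxu
  rcases H.low_or_ring T hxb i with h1 | ⟨q', rfl, hqi'⟩
  · rw [hxu, strictMono_hgt.le_iff_le] at h1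
    linarith [hu.1]
  · obtain ⟨u', hu', hxu'⟩ := H.exists_level hxb
    rw [hqi', hxu] at hxu'
    obtain rfl := strictMono_hgt.injective hxu'
    have htop' := (T q'.p).top_le q'.n_le
    have hbA' : ¬ (k < q'.k ∨ q'.k = k ∧ q'.lab ∈ F) := fun h' => hbA ⟨q', rfl, hqi', h'⟩
    push Not at hbA'
    have hpieces : ∀ q : RingIndex rows N, Sum.inr q ∈ J → q.p = i → q.k = k →
        (H.polarEnd i).pieces (rows i k) (N i k) q.lab ⊆ ⋃ j ∈ J, closure (H.tile rows N j) := by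
      intro q hqJ h1 h2 y hy
      obtain ⟨q'', e1, e2, e3, hy''⟩ := H.exists_of_mem_pieces hy
      exact mem_iUnion₂.2 ⟨_, hJ _ hqJ _ (tileSetoid_inr_iff.2 ⟨q'', rfl, e1.trans h1.symm,
        e2.trans h2.symm, e3⟩), hy''⟩
    have hmem : ∀ q : RingIndex rows N, x ∈ closure (H.tile rows N (Sum.inr q)) → q.p = i →
        q.k = k → x ∈ (H.polarEnd i).pieces (rows i k) (N i k) q.lab := by
      intro q hq h1 h2
      have := H.closure_tile_inr_subset q hq
      rwa [h1, h2] at this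
    rcases hbA'.1.lt_or_eq with hlt | heq
    -- Contact at the bottom of the `k`-th stack: the brick beyond the barrier is in the first row,
    -- whose labels are not in `F`.
    · have hlt' : (q'.k : ℝ) + 1 ≤ k := by exact_mod_cast hlt
      have hku : u = w₀ + k := by linarith [hu.1, hu'.2]
      rcases hq with h1 | ⟨h1, h2⟩
      · have : (k : ℝ) < q.k := by exact_mod_cast h1
        linarith [hu.1]
      · have hn0 : q.n = 0 := by
          by_contra hn0
          have h3 := Row.top_le_bot ((T q.p).overlap q.k) (Nat.pos_of_ne_zero hn0) q.n_le
          have h4 := (rows q.p q.k 0).bot_lt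
          rw [(T q.p).bot, h1] at h4
          rw [h1] at h3
          have h5 := hu.1
          rw [h1] at h5
          linarith
        refine absurd h2 (Set.disjoint_left.1 hF₁ ⟨q.i, ?_⟩)
        rw [RingIndex.lab, hqi, h1, hn0]
    · rcases hq with h1 | ⟨h1, h2⟩
      -- Contact at the top of the `k`-th stack: the brick before the barrier is in the last row,
      -- whose labels are all in `F`.
      · have hlt' : (k : ℝ) + 1 ≤ q.k := by exact_mod_cast h1
        have heq' : (q'.k : ℝ) = k := by exact_mod_cast heq
        have hku : u = w₀ + k + 1 := by linarith [hu.1, hu'.2]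
        have hnN : q'.n = N q'.p q'.k := by
          by_contra hnN
          have h3 := Row.top_le_bot ((T q'.p).overlap q'.k) (lt_of_le_of_ne q'.n_le hnN) le_rfl
          have h4 := (rows q'.p q'.k (N q'.p q'.k)).bot_lt
          rw [(T q'.p).top] at h4
          linarith [hu'.2]
        refine absurd (hF₂ ⟨q'.i, ?_⟩) (hbA'.2 heq)
        rw [RingIndex.lab, hnN, hqi', heq]
      -- Contact inside the stack: since `J` is saturated, the union contains both whole pieces, and
      -- these cannot be merged.
      · intro hfree
        refine hF _ (hbA'.2 heq) _ h2 ⟨x, hmem q' hxb hqi' heq, hmem q hxa hqi h1⟩ (hfree.mono ?_)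
        exact union_subset (hpieces q' hb hqi' heq) (hpieces q ha hqi h1)

/-- A free connected union of labelled bricks stays away from the fixed points. -/
theorem disjoint_fixedPoints {J : Set (TileIndex c t n rows N)}
    (hJ : ∀ i ∈ J, ∀ j, tileSetoid c t n rows N i j → j ∈ J)
    (hconn : IsPreconnected (⋃ j ∈ J, closure (H.tile rows N j)))
    (hfree : FreeSet h (⋃ j ∈ J, closure (H.tile rows N j))) :
    Disjoint (closure (⋃ j ∈ J, closure (H.tile rows N j))) (Function.fixedPoints h) := by
  rw [Set.disjoint_left]
  intro p hp hfix
  obtain ⟨i, hi, rfl⟩ := (H.fixed p).1 hfix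
  obtain ⟨i, rfl⟩ : ∃ i' : Fin m, (i' : ℕ) = i := ⟨⟨i, hi⟩, rfl⟩
  have hacc : ∀ v, ∃ j ∈ J, ∃ y ∈ closure (H.tile rows N j), hgt v < ⟪(y : E3), c i⟫ := by
    intro v
    obtain ⟨y, hy, hyB⟩ := mem_closure_iff.1 hp {y : S2 | hgt v < ⟪(y : E3), c i⟫}
      (isOpen_lt continuous_const (continuous_inner_coe _)) (by
        rw [mem_ofPred_eq, inner_self_coe]; exact hgt_lt_one v)
    obtain ⟨j, hj, hyj⟩ := mem_iUnion₂.1 hyB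
    exact ⟨j, hj, y, hyj, hy⟩
  obtain ⟨j₀, hj₀, -⟩ := hacc 0
  -- A barrier is chosen beyond one tile of the union. Since the union accumulates at the fixed
  -- point, it also has points beyond the barrier.
  obtain ⟨k, hk0, hk⟩ : ∃ k, 0 < k ∧ ∀ q, j₀ = Sum.inr q → q.p = i → q.k < k := by
    rcases j₀ with C | q
    · exact ⟨1, one_pos, fun q hq => by simp at hq⟩
    · refine ⟨q.k + 1, by omega, fun q' hq' _ => ?_⟩
      rw [← Sum.inr_injective hq']
      omega
  have hkpos : (0 : ℝ) ≤ k := by positivity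
  rcases (T i).barrier k with ⟨F, hF1, hF2, hF3⟩ | ⟨l, v, hv1, hv2, hlv⟩
  · obtain ⟨j₁, hj₁, y, hy, hyv⟩ := hacc (w₀ + k + 1)
    refine H.not_freeSet_of_split T hJ hconn hk0 hj₁ hj₀ ?_ hk hF1 hF2 hF3 hfree
    rcases H.low_or_ring T hy i with h1 | ⟨q, rfl, rfl⟩
    · have := strictMono_hgt.lt_iff_lt.1 (hyv.trans_le h1)
      linarith
    · obtain ⟨u, hu, h1⟩ := H.exists_level hy
      rw [h1, strictMono_hgt.lt_iff_lt] at hyv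
      have h2 := (T q.p).top_le q.n_le
      have h3 : (k : ℝ) < q.k := by linarith [hu.2]
      exact ⟨q, rfl, rfl, by exact_mod_cast h3⟩
  · refine notMem_closure_of_circle (v := v) hfix ?_ hconn hfree ?_ hp
    · obtain ⟨y, h1, h2⟩ := H.far i i.2
      have h3 : hgt w₀ ≤ hgt v := strictMono_hgt.monotone (by linarith)
      exact ⟨y, h1.le.trans h3, h2.le.trans h3⟩
    -- By connectedness the union meets the circle of the barrier. The tile met there carries the
    -- label of the piece containing the circle, and saturation puts the whole circle in the union.
    · obtain ⟨x, hxB, hx⟩ : ∃ x ∈ ⋃ j ∈ J, closure (H.tile rows N j), ⟪(x : E3), c i⟫ = hgt v := by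
        by_contra! hne
        obtain ⟨j₁, hj₁, y, hy, hyv⟩ := hacc v
        obtain ⟨z, hz⟩ := (H.isTiling T).nonempty j₀
        have hz' := subset_closure hz
        have h1 := hconn.subset_left_of_subset_union
          (isOpen_lt continuous_const (continuous_inner_coe (c i)))
          (isOpen_lt (continuous_inner_coe (c i)) continuous_const)
          (Set.disjoint_left.2 fun y hy hy' =>
            (show hgt v < ⟪(y : E3), c i⟫ from hy).not_gt hy')
          (fun y hy => (hne y hy).lt_or_gt.symm)
          ⟨y, mem_iUnion₂.2 ⟨j₁, hj₁, hy⟩, hyv⟩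
        have h2 : hgt v < ⟪(z : E3), c i⟫ := h1 (mem_iUnion₂.2 ⟨j₀, hj₀, hz'⟩)
        rcases H.low_or_ring T hz' i with h3 | ⟨q, rfl, rfl⟩
        · have := strictMono_hgt.lt_iff_lt.1 (h2.trans_le h3)
          linarith
        · obtain ⟨u, hu, h4⟩ := H.exists_level hz'
          rw [h4, strictMono_hgt.lt_iff_lt] at h2
          have h5 := (T q.p).top_le q.n_le
          have h6 : (q.k : ℝ) + 1 ≤ k := by exact_mod_cast hk q rfl rfl
          linarith [hu.2]
      obtain ⟨j, hj, hxj⟩ := mem_iUnion₂.1 hxB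
      obtain ⟨q, rfl, rfl⟩ := (H.low_or_ring T hxj i).resolve_left (by
        rw [hx, strictMono_hgt.le_iff_le]
        linarith)
      obtain ⟨u, hu, h1⟩ := H.exists_level hxj
      rw [hx] at h1
      obtain rfl := strictMono_hgt.injective h1
      have h2 := (T q.p).top_le q.n_le
      have h3 := (T q.p).le_bot q.n_le
      have hqk : q.k = k := by
        have e1 : (k : ℝ) < q.k + 1 := by linarith [hu.2]
        have e2 : (q.k : ℝ) < k + 1 := by linarith [hu.1]
        have e1' : k < q.k + 1 := by exact_mod_cast e1
        have e2' : q.k < k + 1 := by exact_mod_cast e2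
        omega
      obtain ⟨u', θ, -, rfl⟩ := exists_polar_of_le (p := c q.p) (y := x) (by
        rintro rfl
        rw [inner_self_coe] at hx
        linarith [hgt_lt_one v]) hx.ge
      rw [inner_polar] at hx
      obtain rfl := strictMono_hgt.injective hx
      have h4 := H.closure_tile_inr_subset q hxj
      rw [hqk] at h4
      have hlab := (hlv θ).2 _ h4
      intro θ'
      obtain ⟨q', e1, e2, e3, e4⟩ := H.exists_of_mem_pieces (hlv θ').1
      exact mem_iUnion₂.2 ⟨_, hJ _ hj _ (tileSetoid_inr_iff.2 ⟨q', rfl, e1, e2.trans hqk.symm,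
        e3.trans hlab.symm⟩), e4⟩

theorem exists_isBrickDecomposition : ∃ F, IsBrickDecomposition h F := by
  refine (H.isTiling T).exists_isBrickDecomposition (tileSetoid c t n rows N) ?_
    fun J hJ hconn hfree => H.disjoint_fixedPoints T hJ hconn hfree
  rintro (C | q)
  · rw [H.brickOf_inl]
    refine ⟨?_, (H.closure_component C.2).1⟩
    obtain ⟨x, -, hC⟩ := C.2
    rw [hC]
    exact isPreconnected_connectedComponentIn.closure
  · rw [H.brickOf_inr]
    exact ⟨(T q.p).conn q.k _, (T q.p).free q.k _⟩

end IsScaffold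

end BrickDecomposition

theorem mainTheorem11 (h : BrickDecomposition.S2 ≃ₜ BrickDecomposition.S2)
    (hfin : (Function.fixedPoints h).Finite) :
    ∃ F : Set BrickDecomposition.S2, BrickDecomposition.IsBrickDecomposition h F := by
  obtain ⟨w₀, c, t, m, n, H⟩ := BrickDecomposition.exists_isScaffold hfin
  choose rows N T using fun i => (H.polarEnd i).exists_tower (H.countable_crossings i)
  exact H.exists_isBrickDecomposition T
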